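/- \textbf{Setting.} Let $x,y$ be strings of length $n\ge 1$ over the alphabet $\{0,1,\dots,A n\}$ for a constant $A$, and let $T$ be an integer time budget with $n\le T\le n^2$. For strings $s,t$ let $L(s,t)$ be the length of their longest common subsequence and $M(s,t)$ the number of pairs $(a,b)$ with $s[a]=t[b]$; write $L=L(x,y)$. Put $m=\lceil n/\sqrt T\rceil$ and cut $x$ and $y$ into consecutive blocks $x_1,\dots,x_N$ and $y_1,\dots,y_N$ of length $m$, $N=\lceil n/m\rceil$ (the last block may be shorter). A block sequence is a set $\{(i_1,j_1),\dots,(i_r,j_r)\}\subseteq\{1,\dots,N\}^2$ with $i_1<\dots<i_r$ and $j_1<\dots<j_r$. Let \[ \lambda=\sum_{i,j=1}^{N} L(x_i,y_j),\qquad \mu=\max_{\mathcal S}\sum_{(i,j)\in\mathcal S}M(x_i,y_j), \] where the maximum is over all block sequences $\mathcal S$. Time is measured on a randomized random access machine with logarithmic cost (each operation is charged the bit lengths of the numbers involved). \textbf{Theorem.} There is an absolute constant $\kappa>0$ such that for all constants $c>0$ and $A\in\mathbb N$ there are a randomized algorithm and constants $C,k$ with the following properties. \begin{enumerate} \item On every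 input $(x,y,T)$ as above, the algorithm has expected running time at most $C\,T\,(1+\log n)^k$, i.e.\ $\widetilde O(T)$, and with probability $1$ it halts and returns a number $\widetilde L\in\mathbb N$ with $\widetilde L\le L$. \item For every $\varepsilon>0$ there is an $n_0$ such that on every input with $n\ge n_0$ and \[ \frac{L^2T^{0.5}}{n^2}\ge n^{\varepsilon},\qquad \frac{L^2T^{1.5}}{\lambda n^2}\ge n^{\varepsilon},\qquad \frac{L^3T^{1.5}}{\lambda\mu n^2}\ge n^{\varepsilon}, \] the returned number satisfies, with probability at least $1-n^{-c}$, \[ \widetilde L\;\ge\;\kappa\cdot\min\Big\{\frac{L^3}{n^2},\ \frac{L^3T}{\lambda n^2},\ \frac{L^4T}{\lambda\mu n^2}\Big\}. \] \end{enumerate} -/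

import Mathlib

namespace LCSApprox

/-! ### Strings, blocks and the parameters `L`, `λ`, `μ` -/

/-- Length of a longest common subsequence. -/
def lcs (x y : List ℕ) : ℕ :=
  (x.sublists.toFinset.filter fun z => z.Sublist y).sup List.length

/-- Number of matching pairs: positions `(i, j)` with `x[i] = y[j]`. -/
def matchingPairs (x y : List ℕ) : ℕ :=
  ((Finset.range x.length ×ˢ Finset.range y.length).filter
    fun p => x[p.1]? = y[p.2]?).card

/-- Block length `m = n / √T`, rounded up to an integer. -/
noncomputable def blockLen (n T : ℕ) : ℕ := ⌈(n : ℝ) / Real.sqrt T⌉₊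

/-- Number `⌈n / m⌉` of blocks of length `m` that a string of length `n` is cut into. -/
def numBlocks (n m : ℕ) : ℕ := (n + m - 1) / m

/-- The `i`-th block (counted from `0`) of length `m`; the last block may be shorter. -/
def block (m : ℕ) (x : List ℕ) (i : ℕ) : List ℕ := (x.drop (i * m)).take m

/-- Index pairs of blocks. -/
def blockPairs (n m : ℕ) : Finset (ℕ × ℕ) :=
  Finset.range (numBlocks n m) ×ˢ Finset.range (numBlocks n m)

/-- `S` can be listed so that both coordinates increase strictly. -/
def IsBlockSeq (S : Finset (ℕ × ℕ)) : Prop :=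
  IsChain (fun p q : ℕ × ℕ => p.1 < q.1 ∧ p.2 < q.2) (S : Set (ℕ × ℕ))

/-- `λ`: sum of the LCS lengths over all blocks. -/
noncomputable def lcsSum (n T : ℕ) (x y : List ℕ) : ℕ :=
  ∑ p ∈ blockPairs n (blockLen n T),
    lcs (block (blockLen n T) x p.1) (block (blockLen n T) y p.2)

open Classical in
/-- `μ`: maximum, over all block sequences, of the total number of matching pairs. -/
noncomputable def maxMatching (n T : ℕ) (x y : List ℕ) : ℕ :=
  ((blockPairs n (blockLen n T)).powerset.filter IsBlockSeq).sup fun S =>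
    ∑ p ∈ S, matchingPairs (block (blockLen n T) x p.1) (block (blockLen n T) y p.2)

/-! ### Randomized random access machine with logarithmic cost

Programs are structured RAM programs over natural numbers. An operation is charged the bit lengths
of the numbers it handles, so huge numbers cannot be used to hide work; on numbers bounded by a
polynomial in `n` this is unit cost up to a factor `O(log n)`. -/

/-- Arithmetic operations and comparisons (which return `0` or `1`). -/
inductive Op where
  | add | sub | mul | div | mod | lt | eq

/-- Value of an operation; `sub` truncates at `0`, division by `0` gives `0`. -/
def Op.eval : Op → ℕ → ℕ → ℕ
  | .add, a, b => a + b
  | .sub, a, b => a - b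
  | .mul, a, b => a * b
  | .div, a, b => a / b
  | .mod, a, b => a % b
  | .lt, a, b => if a < b then 1 else 0
  | .eq, a, b => if a = b then 1 else 0

/-- Expressions: constants, scalar registers, array cells, operations. -/
inductive Expr where
  | const (k : ℕ)
  | reg (v : ℕ)
  | read (a : ℕ) (i : Expr)
  | op (o : Op) (e₁ e₂ : Expr)

/-- Programs. -/
inductive Prog where
  | skip
  | assign (v : ℕ) (e : Expr)
  | store (a : ℕ) (i e : Expr)
  /-- Put a fresh uniformly random element of `{0, …, k - 1}` into register `v`,
  where `k` is the value of `e` (and `0` if `k = 0`). -/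
  | sample (v : ℕ) (e : Expr)
  | seq (p q : Prog)
  | ite (e : Expr) (p q : Prog)
  | loop (e : Expr) (p : Prog)

/-- Memory: scalar registers and arrays. -/
structure Mem where
  reg : ℕ → ℕ
  arr : ℕ → ℕ → ℕ

def Mem.setReg (s : Mem) (v a : ℕ) : Mem :=
  { s with reg := Function.update s.reg v a }

def Mem.setArr (s : Mem) (a i b : ℕ) : Mem :=
  { s with arr := Function.update s.arr a (Function.update (s.arr a) i b) }

def Expr.eval (s : Mem) : Expr → ℕ
  | .const k => k
  | .reg v => s.reg v
  | .read a i => s.arr a (i.eval s)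
  | .op o e₁ e₂ => o.eval (e₁.eval s) (e₂.eval s)

/-- Each node is charged one plus the bit length of its value. -/
def Expr.cost (s : Mem) : Expr → ℕ
  | .const k => 1 + k.size
  | .reg v => 1 + (s.reg v).size
  | .read a i => 1 + (s.arr a (i.eval s)).size + i.cost s
  | .op o e₁ e₂ =>
      1 + (o.eval (e₁.eval s) (e₂.eval s)).size + e₁.cost s + e₂.cost s

/-- Configuration: the programs still to be executed, in order, the memory, and the time used. -/
structure Config where
  todo : List Prog
  mem : Mem
  time : ℕ

/-- Uniform distribution on `{0, …, k - 1}`. -/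
noncomputable def uniformBelow : ℕ → PMF ℕ
  | 0 => PMF.pure 0
  | k + 1 => PMF.uniformOfFinset (Finset.range (k + 1)) Finset.nonempty_range_add_one

/-- One step of the machine. A halted configuration (nothing left to do) does not change. -/
noncomputable def step : Config → PMF Config
  | ⟨[], s, t⟩ => PMF.pure ⟨[], s, t⟩
  | ⟨.skip :: r, s, t⟩ => PMF.pure ⟨r, s, t + 1⟩
  | ⟨.assign v e :: r, s, t⟩ => PMF.pure ⟨r, s.setReg v (e.eval s), t + 1 + e.cost s⟩
  | ⟨.store a i e :: r, s, t⟩ =>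
      PMF.pure ⟨r, s.setArr a (i.eval s) (e.eval s), t + 1 + i.cost s + e.cost s⟩
  | ⟨.sample v e :: r, s, t⟩ =>
      (uniformBelow (e.eval s)).map fun a => ⟨r, s.setReg v a, t + 1 + e.cost s⟩
  | ⟨.seq p q :: r, s, t⟩ => PMF.pure ⟨p :: q :: r, s, t + 1⟩
  | ⟨.ite e p q :: r, s, t⟩ =>
      PMF.pure ⟨(if e.eval s ≠ 0 then p else q) :: r, s, t + 1 + e.cost s⟩
  | ⟨.loop e p :: r, s, t⟩ =>
      PMF.pure ⟨if e.eval s ≠ 0 then p :: .loop e p :: r else r, s, t + 1 + e.cost s⟩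

/-- Distribution of the configuration after a given number of steps. -/
noncomputable def stepN (c : Config) : ℕ → PMF Config
  | 0 => PMF.pure c
  | k + 1 => (stepN c k).bind step

/-- Initial configuration on strings `x`, `y` and time budget `T`: register `0` holds the length of
`x`, register `1` holds `T`, arrays `0` and `1` hold `x` and `y`, everything else is `0`. -/
def initConfig (P : Prog) (x y : List ℕ) (T : ℕ) : Config where
  todo := [P]
  mem :=
    { reg := fun v => if v = 0 then x.length else if v = 1 then T else 0
      arr := fun a i => if a = 0 then x.getD i 0 else if a = 1 then y.getD i 0 else 0 }
  time := 0

/-- Expected running time. The time used is nondecreasing along every run, so the supremum is the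
expectation of the total time (infinite on runs that never halt). -/
noncomputable def expectedTime (P : Prog) (x y : List ℕ) (T : ℕ) : ENNReal :=
  ⨆ k : ℕ, ∑' c : Config, stepN (initConfig P x y T) k c * (c.time : ENNReal)

/-- Probability that the program halts and its output, the content of register `2`,
satisfies `Q`. -/
noncomputable def outputProb (P : Prog) (x y : List ℕ) (T : ℕ) (Q : ℕ → Prop) : ENNReal :=
  ⨆ k : ℕ, (stepN (initConfig P x y T) k).toOuterMeasure
    {c | c.todo = [] ∧ Q (c.mem.reg 2)}

/-- Admissible input: two strings of length `n ≥ 1` over the alphabet `{0, …, A n}` and a time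
budget `T ∈ [n, n²]`. -/
structure IsInput (A n T : ℕ) (x y : List ℕ) : Prop where
  one_le : 1 ≤ n
  length_x : x.length = n
  length_y : y.length = n
  alphabet_x : ∀ a ∈ x, a ≤ A * n
  alphabet_y : ∀ a ∈ y, a ≤ A * n
  le_budget : n ≤ T
  budget_le : T ≤ n ^ 2

end LCSApprox

/-! A longest chain of matches visits fewer than `2 N` block pairs, because the visited pairs form a
staircase. Hence there is a block sequence `S` with at least `L / (4 m)` pairs, each of LCS at least
`L / (4 N)` (`exists_heavy_blockSeq`), and half of it has at most `2 μ / |S|` matches per pair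
(`Setup.exists_light_subset`). Keep every block of `x` with probability `ρ = 2 ^ (-v)`. About `ρ
|S|` pairs of the sequence survive, and a dynamic program over blocks glues their common
subsequences to one of length of order `ρ (L / m) (L / N)`, that is `ρ L ^ 2 / n`. The claimed
minimum is `L ^ 2 / n` times the minimum of `L / n`, `L T / (λ n)` and `L ^ 2 T / (λ μ n)`; these
are the rates `ρ` at which the expected work stays `O(T)` up to logarithms. The three hypotheses say
that at this rate many pairs of `S` survive.

An LCS computation for every pair would be too expensive, so the pairs of a selected block row run
through a cascade of tests. At level `k` patience sorting is applied to the matches in rows sampled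
at rate `2 ^ (-(u - k))`, where `2 ^ u` is of order `L / N`, and a pair goes on to level `k + 1`
only if the value found is at least `128 * 2 ^ k`. A pair of `S` passes all tests by Chebyshev's
inequality. A pair that reaches level `k + 1` has LCS at least `128 * 2 ^ k`, and this pays for the
capped work there (`Params.pairUse_succ_le`). So the later levels cost about `λ (m + 2 ^ w) / 2 ^ u`
in total, where `2 ^ w` bounds the matches of the useful pairs. Level `0` costs `2 ^ (-u)` times `N
^ 2 m` plus the number of all matches, which is at most `2 m λ` by `matchingPairs_le`. The balance
of the terms is `mean_fuel_bound`.

Markov's inequality for the work and Chebyshev's for the tests show that a round with suitable `u`,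
`v`, `w` succeeds with probability at least `1 / 2` (`Params.pr_round_bad_le`). The suitable values
are unknown, so all are tried, and `⌈c⌉ H` independent rounds lower the failure probability to `n ^
(-c)`, where `H` is the bit length of `n`. Every value found is at most the true LCS, so the maximum
over all runs is sound.

The time bound holds on every random tape: a fuel register cuts each run off, and a calculus of
weakest preconditions counts machine steps with fuel as credit. All stored numbers are at most `V`,
polynomial in `n` for fixed `A` and `c`, so a step costs `O(log n)`. All random numbers are drawn
beforehand onto a tape. The remaining program is deterministic, and the final configuration is the
image of a uniform tape (`Setup.lcsProg_dist`). -/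

namespace LCSApprox

/-! ### Bounded memories and the cost of expressions -/

/-- Every number stored in the memory is at most `V`. -/
def Mem.Bdd (V : ℕ) (s : Mem) : Prop :=
  (∀ v, s.reg v ≤ V) ∧ ∀ a i, s.arr a i ≤ V

@[simp] theorem Mem.setReg_reg (s : Mem) (v a w : ℕ) :
    (s.setReg v a).reg w = if w = v then a else s.reg w := by
  simp [Mem.setReg, Function.update_apply]

@[simp] theorem Mem.setReg_arr (s : Mem) (v a : ℕ) : (s.setReg v a).arr = s.arr := rfl

@[simp] theorem Mem.setArr_reg (s : Mem) (a i b : ℕ) : (s.setArr a i b).reg = s.reg := rfl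

@[simp] theorem Mem.setArr_arr (s : Mem) (a i b a' : ℕ) :
    (s.setArr a i b).arr a' = if a' = a then Function.update (s.arr a) i b else s.arr a' := by
  simp [Mem.setArr, Function.update_apply]

theorem Mem.Bdd.setReg {V : ℕ} {s : Mem} (hs : s.Bdd V) {v a : ℕ} (ha : a ≤ V) :
    (s.setReg v a).Bdd V := by
  refine ⟨fun w => ?_, hs.2⟩
  rw [Mem.setReg_reg]
  split
  · exact ha
  · exact hs.1 w

theorem Mem.Bdd.setArr {V : ℕ} {s : Mem} (hs : s.Bdd V) {a i b : ℕ} (hb : b ≤ V) :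
    (s.setArr a i b).Bdd V := by
  refine ⟨hs.1, fun a' i' => ?_⟩
  rw [Mem.setArr_arr]
  split
  · rw [Function.update_apply]
    split
    · exact hb
    · exact hs.2 _ _
  · exact hs.2 _ _

/-- Number of nodes of an expression. -/
def Expr.nodes : Expr → ℕ
  | .const _ => 1
  | .reg _ => 1
  | .read _ i => i.nodes + 1
  | .op _ e₁ e₂ => e₁.nodes + e₂.nodes + 1

/-- All constants in the expression are at most `V`. -/
def Expr.ConstLe (V : ℕ) : Expr → Prop
  | .const k => k ≤ V
  | .reg _ => True
  | .read _ i => i.ConstLe V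
  | .op _ e₁ e₂ => e₁.ConstLe V ∧ e₂.ConstLe V

/-- A product of numbers below `V ^ a` and `V ^ b` stays below `V ^ (a + b)`, and the extra factor
`V ≥ 2` of the node absorbs sums. Intermediate values may exceed `V`, but their bit length stays
linear in that of `V`. -/
theorem Expr.eval_le_pow {V : ℕ} (hV : 2 ≤ V) {s : Mem} (hs : s.Bdd V) (e : Expr)
    (he : e.ConstLe V) : e.eval s ≤ V ^ e.nodes := by
  induction e with
  | const k => simpa [Expr.eval, Expr.nodes, Expr.ConstLe] using he
  | reg v => simpa [Expr.eval, Expr.nodes] using hs.1 v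
  | read a i ih =>
    refine (hs.2 a _).trans ?_
    exact Nat.le_self_pow (by simp [Expr.nodes]) V
  | op o e₁ e₂ ih₁ ih₂ =>
    have h₁ := ih₁ he.1
    have h₂ := ih₂ he.2
    have p₁ : 1 ≤ V ^ e₁.nodes := Nat.one_le_pow _ _ (by omega)
    have p₂ : 1 ≤ V ^ e₂.nodes := Nat.one_le_pow _ _ (by omega)
    have hE : V ^ (Expr.op o e₁ e₂).nodes = V ^ e₁.nodes * V ^ e₂.nodes * V := by
      simp [Expr.nodes, pow_add]
    rw [hE]
    have hX : V ^ e₁.nodes * V ^ e₂.nodes * 2 ≤ V ^ e₁.nodes * V ^ e₂.nodes * V :=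
      Nat.mul_le_mul_left _ hV
    have hA : V ^ e₁.nodes ≤ V ^ e₁.nodes * V ^ e₂.nodes := Nat.le_mul_of_pos_right _ p₂
    have hB : V ^ e₂.nodes ≤ V ^ e₁.nodes * V ^ e₂.nodes := Nat.le_mul_of_pos_left _ p₁
    have hM : e₁.eval s * e₂.eval s ≤ V ^ e₁.nodes * V ^ e₂.nodes := Nat.mul_le_mul h₁ h₂
    cases o <;> simp only [Expr.eval, Op.eval]
    · omega
    · omega
    · omega
    · have := Nat.div_le_self (e₁.eval s) (e₂.eval s); omega
    · have := Nat.mod_le (e₁.eval s) (e₂.eval s); omega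
    · split <;> omega
    · split <;> omega

theorem size_le_of_le_pow {V k a : ℕ} (h : a ≤ V ^ k) : a.size ≤ k * V.size + 1 := by
  rw [Nat.size_le]
  have h1 : V ^ k ≤ (2 ^ V.size) ^ k := Nat.pow_le_pow_left (Nat.lt_size_self V).le k
  rw [← pow_mul] at h1
  have h2 : (2 : ℕ) ^ (V.size * k) < 2 ^ (k * V.size + 1) := by
    rw [mul_comm]; exact Nat.pow_lt_pow_right (by norm_num) (Nat.lt_succ_self _)
  omega

theorem Expr.cost_le {V : ℕ} (hV : 2 ≤ V) {s : Mem} (hs : s.Bdd V) (e : Expr)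
    (he : e.ConstLe V) {K : ℕ} (hK : e.nodes ≤ K) :
    e.cost s ≤ e.nodes * (2 + K * V.size) := by
  have node : ∀ f : Expr, f.ConstLe V → f.nodes ≤ K → (f.eval s).size ≤ 1 + K * V.size := by
    intro f hf hfK
    have := size_le_of_le_pow (f.eval_le_pow hV hs hf)
    have h2 : f.nodes * V.size ≤ K * V.size := Nat.mul_le_mul_right _ hfK
    omega
  induction e with
  | const k =>
    have := node (.const k) he hK
    simp only [Expr.cost, Expr.nodes, Expr.eval] at *; omega
  | reg v =>
    have := node (.reg v) he hK
    simp only [Expr.cost, Expr.nodes, Expr.eval] at *; omega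
  | read a i ih =>
    have h0 := node (.read a i) he hK
    have h1 := ih he (by simp only [Expr.nodes] at hK; omega)
    simp only [Expr.cost, Expr.nodes, Expr.eval] at *
    rw [Nat.add_mul]; omega
  | op o e₁ e₂ ih₁ ih₂ =>
    have h0 := node (.op o e₁ e₂) he hK
    have h1 := ih₁ he.1 (by simp only [Expr.nodes] at hK; omega)
    have h2 := ih₂ he.2 (by simp only [Expr.nodes] at hK; omega)
    simp only [Expr.cost, Expr.nodes, Expr.eval] at *
    rw [Nat.add_mul, Nat.add_mul]; omega

/-- The expression has at most `K` nodes and constants bounded by `V`. -/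
def Expr.Ok (V K : ℕ) (e : Expr) : Prop := e.ConstLe V ∧ e.nodes ≤ K

/-- All expressions of the program have at most `K` nodes and constants bounded by `V`. -/
def Prog.Ok (V K : ℕ) : Prog → Prop
  | .skip => True
  | .assign _ e => e.Ok V K
  | .store _ i e => i.Ok V K ∧ e.Ok V K
  | .sample _ e => e.Ok V K
  | .seq p q => p.Ok V K ∧ q.Ok V K
  | .ite e p q => e.Ok V K ∧ p.Ok V K ∧ q.Ok V K
  | .loop e p => e.Ok V K ∧ p.Ok V K

/-- Bound for the time of one machine step. -/
def stepCost (V K : ℕ) : ℕ := 1 + 2 * (K * (2 + K * V.size))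

theorem Expr.Ok.cost_le {V K : ℕ} (hV : 2 ≤ V) {s : Mem} (hs : s.Bdd V) {e : Expr}
    (he : e.Ok V K) : e.cost s ≤ K * (2 + K * V.size) :=
  (e.cost_le hV hs he.1 he.2).trans (Nat.mul_le_mul_right _ he.2)

/-! ### Big-step semantics of sampling-free programs -/

/-- `Exec V p s s' u`: on memory `s` the program `p` ends in memory `s'` after `u` machine steps,
none of which uses a random number, and all memories on the way are bounded by `V`. -/
inductive Exec (V : ℕ) : Prog → Mem → Mem → ℕ → Prop
  | skip (s : Mem) : Exec V .skip s s 1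
  | assign {s : Mem} (hs : s.Bdd V) (v : ℕ) (e : Expr) :
      Exec V (.assign v e) s (s.setReg v (e.eval s)) 1
  | store {s : Mem} (hs : s.Bdd V) (a : ℕ) (i e : Expr) :
      Exec V (.store a i e) s (s.setArr a (i.eval s) (e.eval s)) 1
  | seq {s s₁ s₂ : Mem} {p q : Prog} {u₁ u₂ : ℕ} (h₁ : Exec V p s s₁ u₁)
      (h₂ : Exec V q s₁ s₂ u₂) : Exec V (.seq p q) s s₂ (u₁ + u₂ + 1)
  | ite_pos {s s' : Mem} {e : Expr} {p q : Prog} {u : ℕ} (hs : s.Bdd V) (he : e.eval s ≠ 0)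
      (h : Exec V p s s' u) : Exec V (.ite e p q) s s' (u + 1)
  | ite_neg {s s' : Mem} {e : Expr} {p q : Prog} {u : ℕ} (hs : s.Bdd V) (he : e.eval s = 0)
      (h : Exec V q s s' u) : Exec V (.ite e p q) s s' (u + 1)
  | loop_done {s : Mem} {e : Expr} {p : Prog} (hs : s.Bdd V) (he : e.eval s = 0) :
      Exec V (.loop e p) s s 1
  | loop_step {s s₁ s₂ : Mem} {e : Expr} {p : Prog} {u₁ u₂ : ℕ} (hs : s.Bdd V)
      (he : e.eval s ≠ 0) (h₁ : Exec V p s s₁ u₁) (h₂ : Exec V (.loop e p) s₁ s₂ u₂) :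
      Exec V (.loop e p) s s₂ (u₁ + u₂ + 1)

theorem stepN_add (c : Config) (a b : ℕ) :
    stepN c (a + b) = (stepN c a).bind fun c' => stepN c' b := by
  induction b with
  | zero => simp [stepN]
  | succ b ih =>
    rw [← Nat.add_assoc]
    simp only [stepN]
    rw [ih, PMF.bind_bind]

theorem stepN_one (c : Config) : stepN c 1 = step c := by
  simp [stepN]

theorem stepN_pure_trans {c c' : Config} {a b : ℕ} {μ : PMF Config}
    (h : stepN c a = PMF.pure c') (h' : stepN c' b = μ) : stepN c (a + b) = μ := by
  rw [stepN_add, h, PMF.pure_bind, h']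

/-- Without sampling every `stepN` is a point mass, so big steps translate into machine steps. The
continuation `r` and the start time `t₀` vary because sequences and loops push further programs onto
the stack. -/
theorem Exec.stepN_eq {V K : ℕ} (hV : 2 ≤ V) {p : Prog} {s s' : Mem} {u : ℕ}
    (h : Exec V p s s' u) (hp : p.Ok V K) (r : List Prog) (t₀ : ℕ) :
    ∃ k t, stepN ⟨p :: r, s, t₀⟩ k = PMF.pure ⟨r, s', t⟩ ∧ t ≤ t₀ + u * stepCost V K := by
  induction h generalizing r t₀ with
  | skip s =>
    refine ⟨1, t₀ + 1, by rw [stepN_one]; rfl, ?_⟩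
    simp [stepCost]
  | assign hs v e =>
    refine ⟨1, _, by rw [stepN_one]; rfl, ?_⟩
    have := Expr.Ok.cost_le hV hs hp
    simp only [stepCost]; omega
  | store hs a i e =>
    refine ⟨1, _, by rw [stepN_one]; rfl, ?_⟩
    have h1 := Expr.Ok.cost_le hV hs hp.1
    have h2 := Expr.Ok.cost_le hV hs hp.2
    simp only [stepCost]; omega
  | @seq s s₁ s₂ p q u₁ u₂ h₁ h₂ ih₁ ih₂ =>
    obtain ⟨k₁, t₁, e₁, b₁⟩ := ih₁ hp.1 (q :: r) (t₀ + 1)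
    obtain ⟨k₂, t₂, e₂, b₂⟩ := ih₂ hp.2 r t₁
    refine ⟨1 + (k₁ + k₂), t₂, ?_, ?_⟩
    · refine stepN_pure_trans (c' := ⟨p :: q :: r, s, t₀ + 1⟩) ?_ (stepN_pure_trans e₁ e₂)
      rw [stepN_one]; rfl
    · have : 1 ≤ stepCost V K := by simp [stepCost]
      rw [Nat.add_mul, Nat.add_mul]; omega
  | @ite_pos s s' e p q u hs he h ih =>
    obtain ⟨k₁, t₁, e₁, b₁⟩ := ih hp.2.1 r (t₀ + 1 + e.cost s)
    refine ⟨1 + k₁, t₁, ?_, ?_⟩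
    · refine stepN_pure_trans (c' := ⟨p :: r, s, t₀ + 1 + e.cost s⟩) ?_ e₁
      rw [stepN_one]; simp [step, he]
    · have := Expr.Ok.cost_le hV hs hp.1
      have h2 : 1 + e.cost s ≤ stepCost V K := by simp only [stepCost]; omega
      rw [Nat.add_mul]; omega
  | @ite_neg s s' e p q u hs he h ih =>
    obtain ⟨k₁, t₁, e₁, b₁⟩ := ih hp.2.2 r (t₀ + 1 + e.cost s)
    refine ⟨1 + k₁, t₁, ?_, ?_⟩
    · refine stepN_pure_trans (c' := ⟨q :: r, s, t₀ + 1 + e.cost s⟩) ?_ e₁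
      rw [stepN_one]; simp [step, he]
    · have := Expr.Ok.cost_le hV hs hp.1
      have h2 : 1 + e.cost s ≤ stepCost V K := by simp only [stepCost]; omega
      rw [Nat.add_mul]; omega
  | @loop_done s e p hs he =>
    refine ⟨1, t₀ + 1 + e.cost s, by rw [stepN_one]; simp [step, he], ?_⟩
    have := Expr.Ok.cost_le hV hs hp.1
    simp only [stepCost]; omega
  | @loop_step s s₁ s₂ e p u₁ u₂ hs he h₁ h₂ ih₁ ih₂ =>
    obtain ⟨k₁, t₁, e₁, b₁⟩ := ih₁ hp.2 (.loop e p :: r) (t₀ + 1 + e.cost s)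
    obtain ⟨k₂, t₂, e₂, b₂⟩ := ih₂ hp r t₁
    refine ⟨1 + (k₁ + k₂), t₂, ?_, ?_⟩
    · refine stepN_pure_trans (c' := ⟨p :: .loop e p :: r, s, t₀ + 1 + e.cost s⟩) ?_
        (stepN_pure_trans e₁ e₂)
      rw [stepN_one]; simp [step, he]
    · have := Expr.Ok.cost_le hV hs hp.1
      have h2 : 1 + e.cost s ≤ stepCost V K := by simp only [stepCost]; omega
      rw [Nat.add_mul, Nat.add_mul]; omega

/-! ### Registers and arrays that a program leaves unchanged -/

/-- The registers a program writes to. -/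
def Prog.regs : Prog → List ℕ
  | .skip => []
  | .assign v _ => [v]
  | .store _ _ _ => []
  | .sample v _ => [v]
  | .seq p q => p.regs ++ q.regs
  | .ite _ p q => p.regs ++ q.regs
  | .loop _ p => p.regs

/-- The arrays a program writes to. -/
def Prog.arrs : Prog → List ℕ
  | .skip => []
  | .assign _ _ => []
  | .store a _ _ => [a]
  | .sample _ _ => []
  | .seq p q => p.arrs ++ q.arrs
  | .ite _ p q => p.arrs ++ q.arrs
  | .loop _ p => p.arrs

/-- `s'` agrees with `s` outside of what `p` may write to. -/
def Frame (p : Prog) (s s' : Mem) : Prop :=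
  (∀ v, v ∉ p.regs → s'.reg v = s.reg v) ∧ ∀ a, a ∉ p.arrs → s'.arr a = s.arr a

theorem Frame.refl (p : Prog) (s : Mem) : Frame p s s := ⟨fun _ _ => rfl, fun _ _ => rfl⟩

theorem Frame.trans {p : Prog} {s₁ s₂ s₃ : Mem} (h : Frame p s₁ s₂) (h' : Frame p s₂ s₃) :
    Frame p s₁ s₃ :=
  ⟨fun v hv => (h'.1 v hv).trans (h.1 v hv), fun a ha => (h'.2 a ha).trans (h.2 a ha)⟩

theorem Frame.mono {p q : Prog} {s s' : Mem} (h : Frame p s s') (hr : p.regs ⊆ q.regs)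
    (ha : p.arrs ⊆ q.arrs) : Frame q s s' :=
  ⟨fun v hv => h.1 v fun h' => hv (hr h'), fun a h' => h.2 a fun h'' => h' (ha h'')⟩

/-- Lets invariants mention only what changes: for a concrete program, that a register or array is
untouched is settled by `decide`. -/
theorem Exec.frame {V : ℕ} {p : Prog} {s s' : Mem} {u : ℕ} (h : Exec V p s s' u) :
    Frame p s s' := by
  induction h with
  | skip s => exact Frame.refl _ _
  | assign hs v e =>
    refine ⟨fun w hw => ?_, fun _ _ => rfl⟩
    simp only [Prog.regs, List.mem_singleton] at hw
    simp [hw]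
  | store hs a i e =>
    refine ⟨fun _ _ => rfl, fun b hb => ?_⟩
    simp only [Prog.arrs, List.mem_singleton] at hb
    simp [hb]
  | seq h₁ h₂ ih₁ ih₂ =>
    exact (ih₁.mono (by simp [Prog.regs]) (by simp [Prog.arrs])).trans
      (ih₂.mono (by simp [Prog.regs]) (by simp [Prog.arrs]))
  | ite_pos hs he h ih => exact ih.mono (by simp [Prog.regs]) (by simp [Prog.arrs])
  | ite_neg hs he h ih => exact ih.mono (by simp [Prog.regs]) (by simp [Prog.arrs])
  | loop_done hs he => exact Frame.refl _ _
  | loop_step hs he h₁ h₂ ih₁ ih₂ =>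
    exact (ih₁.mono (by simp [Prog.regs]) (by simp [Prog.arrs])).trans ih₂

/-! ### Weakest preconditions with step counts

Register `7` holds the remaining fuel; each unit of fuel pays for `w` machine steps. -/

/-- From `s` the program ends in a bounded memory satisfying `Q`; the number of steps is at most
`c` plus `w` times the amount of fuel used up. -/
def Wp (V w : ℕ) (p : Prog) (c : ℕ) (Q : Mem → Prop) (s : Mem) : Prop :=
  ∃ s' u, Exec V p s s' u ∧ s'.Bdd V ∧ Q s' ∧ u + w * s'.reg 7 ≤ c + w * s.reg 7

variable {V w : ℕ} {p q : Prog} {c c' : ℕ} {Q R : Mem → Prop} {s : Mem}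

theorem Wp.mono (h : Wp V w p c Q s)
    (hQ : ∀ s', s'.Bdd V → Frame p s s' → Q s' → R s') (hc : c ≤ c') :
    Wp V w p c' R s := by
  obtain ⟨s', u, h1, h2, h3, h4⟩ := h
  exact ⟨s', u, h1, h2, hQ s' h2 h1.frame h3, by omega⟩

theorem Wp.skip (hs : s.Bdd V) (hQ : Q s) : Wp V w .skip 1 Q s :=
  ⟨s, 1, .skip s, hs, hQ, le_rfl⟩

theorem Wp.assign {v : ℕ} {e : Expr} (hs : s.Bdd V) (hv : e.eval s ≤ V) (h7 : v ≠ 7)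
    (hQ : Q (s.setReg v (e.eval s))) : Wp V w (.assign v e) 1 Q s :=
  ⟨_, 1, .assign hs v e, hs.setReg hv, hQ, by simp [h7.symm]⟩

theorem Wp.store {a : ℕ} {i e : Expr} (hs : s.Bdd V) (hv : e.eval s ≤ V)
    (hQ : Q (s.setArr a (i.eval s) (e.eval s))) : Wp V w (.store a i e) 1 Q s :=
  ⟨_, 1, .store hs a i e, hs.setArr hv, hQ, by simp⟩

theorem Wp.seq (h : Wp V w p c R s)
    (h' : ∀ s', s'.Bdd V → Frame p s s' → R s' → Wp V w q c' Q s') :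
    Wp V w (.seq p q) (c + c' + 1) Q s := by
  obtain ⟨s₁, u₁, h1, h2, h3, h4⟩ := h
  obtain ⟨s₂, u₂, g1, g2, g3, g4⟩ := h' s₁ h2 h1.frame h3
  exact ⟨s₂, _, h1.seq g1, g2, g3, by omega⟩

theorem Wp.assign_seq {v : ℕ} {e : Expr} (hs : s.Bdd V) (hv : e.eval s ≤ V) (h7 : v ≠ 7)
    (h : (s.setReg v (e.eval s)).Bdd V → Wp V w q c Q (s.setReg v (e.eval s))) :
    Wp V w (.seq (.assign v e) q) (c + 2) Q s := by
  have := Wp.seq (q := q) (c' := c) (Q := Q) (R := fun s' => s' = s.setReg v (e.eval s))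
    (Wp.assign (w := w) hs hv h7 rfl) (fun s' hs' _ h' => by subst h'; exact h hs')
  exact this.mono (fun _ _ _ h => h) (by omega)

theorem Wp.store_seq {a : ℕ} {i e : Expr} (hs : s.Bdd V) (hv : e.eval s ≤ V)
    (h : (s.setArr a (i.eval s) (e.eval s)).Bdd V →
      Wp V w q c Q (s.setArr a (i.eval s) (e.eval s))) :
    Wp V w (.seq (.store a i e) q) (c + 2) Q s := by
  have := Wp.seq (q := q) (c' := c) (Q := Q)
    (R := fun s' => s' = s.setArr a (i.eval s) (e.eval s))
    (Wp.store (w := w) hs hv rfl) (fun s' hs' _ h' => by subst h'; exact h hs')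
  exact this.mono (fun _ _ _ h => h) (by omega)

theorem Wp.ite {e : Expr} (hs : s.Bdd V) (h₁ : e.eval s ≠ 0 → Wp V w p c Q s)
    (h₂ : e.eval s = 0 → Wp V w q c Q s) : Wp V w (.ite e p q) (c + 1) Q s := by
  by_cases he : e.eval s = 0
  · obtain ⟨s', u, g1, g2, g3, g4⟩ := h₂ he
    exact ⟨s', _, .ite_neg hs he g1, g2, g3, by omega⟩
  · obtain ⟨s', u, g1, g2, g3, g4⟩ := h₁ he
    exact ⟨s', _, .ite_pos hs he g1, g2, g3, by omega⟩

/-- Rule for loops with at most `k` iterations. -/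
theorem Wp.loop {e : Expr} (I : ℕ → Mem → Prop) {k : ℕ} (hs : s.Bdd V) (hI : I k s)
    (hstep : ∀ k s', s'.Bdd V → Frame p s s' → I k s' → e.eval s' ≠ 0 →
      ∃ k', k = k' + 1 ∧ Wp V w p c (I k') s') :
    Wp V w (.loop e p) ((c + 1) * k + 1) (fun s' => (∃ k, I k s') ∧ e.eval s' = 0) s := by
  suffices H : ∀ k s', s'.Bdd V → Frame p s s' → I k s' →
      Wp V w (.loop e p) ((c + 1) * k + 1) (fun s' => (∃ k, I k s') ∧ e.eval s' = 0) s' from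
    H k s hs (Frame.refl _ _) hI
  intro k
  induction k with
  | zero =>
    intro s' hs' hF hI'
    have he : e.eval s' = 0 := by
      by_contra hne
      obtain ⟨k', h, -⟩ := hstep 0 s' hs' hF hI' hne
      omega
    exact ⟨s', 1, .loop_done hs' he, hs', ⟨⟨_, hI'⟩, he⟩, by omega⟩
  | succ k ih =>
    intro s' hs' hF hI'
    by_cases he : e.eval s' = 0
    · exact ⟨s', 1, .loop_done hs' he, hs', ⟨⟨_, hI'⟩, he⟩, by omega⟩
    · obtain ⟨k', hk, s₁, u₁, g1, g2, g3, g4⟩ := hstep _ s' hs' hF hI' he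
      obtain rfl : k = k' := by omega
      obtain ⟨s₂, u₂, f1, f2, f3, f4⟩ := ih s₁ g2 (hF.trans g1.frame) g3
      refine ⟨s₂, _, .loop_step hs' he g1 f1, f2, f3, ?_⟩
      rw [Nat.mul_succ]; omega

/-- Rule for loops whose iterations are paid for by fuel. -/
theorem Wp.while_fuel {e : Expr} (I : Mem → Prop) (hw : c + 1 ≤ w) (hs : s.Bdd V) (hI : I s)
    (hstep : ∀ s', s'.Bdd V → Frame p s s' → I s' → e.eval s' ≠ 0 →
      Wp V 0 p c (fun s'' => I s'' ∧ s''.reg 7 + 1 = s'.reg 7) s') :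
    Wp V w (.loop e p) 1 (fun s' => I s' ∧ e.eval s' = 0) s := by
  suffices H : ∀ k s', s'.reg 7 = k → s'.Bdd V → Frame p s s' → I s' →
      Wp V w (.loop e p) 1 (fun s' => I s' ∧ e.eval s' = 0) s' from
    H _ s rfl hs (Frame.refl _ _) hI
  intro k
  induction k with
  | zero =>
    intro s' hk hs' hF hI'
    have he : e.eval s' = 0 := by
      by_contra hne
      obtain ⟨s₁, u₁, g1, g2, ⟨-, g3⟩, g4⟩ := hstep s' hs' hF hI' hne
      omega
    exact ⟨s', 1, .loop_done hs' he, hs', ⟨hI', he⟩, by omega⟩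
  | succ k ih =>
    intro s' hk hs' hF hI'
    by_cases he : e.eval s' = 0
    · exact ⟨s', 1, .loop_done hs' he, hs', ⟨hI', he⟩, by omega⟩
    · obtain ⟨s₁, u₁, g1, g2, ⟨g3, g3'⟩, g4⟩ := hstep s' hs' hF hI' he
      obtain ⟨s₂, u₂, f1, f2, f3, f4⟩ := ih s₁ (by omega) g2 (hF.trans g1.frame) g3
      refine ⟨s₂, _, .loop_step hs' he g1 f1, f2, f3, ?_⟩
      -- The unit of fuel that disappeared releases `w` steps, which cover the body and the loop
      -- test since `c + 1 ≤ w`.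
      have : w * s'.reg 7 = w * s₁.reg 7 + w := by rw [← g3']; ring
      omega

/-- `for v = 0, …, e - 1 do body`. -/
def forLoop (v : ℕ) (e : Expr) (body : Prog) : Prog :=
  .seq (.assign v (.const 0))
    (.loop (.op .lt (.reg v) e) (.seq body (.assign v (.op .add (.reg v) (.const 1)))))

/-- Rule for counting loops. -/
theorem Wp.forLoop {v : ℕ} {e : Expr} {k : ℕ} (I : ℕ → Mem → Prop) (hs : s.Bdd V)
    (hv7 : v ≠ 7) (hv : v ∉ p.regs) (hk : k ≤ V)
    (he : ∀ s', Frame (LCSApprox.forLoop v e p) s s' → e.eval s' = k)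
    (hI : I 0 (s.setReg v 0))
    (hstep : ∀ i s', i < k → s'.Bdd V → Frame (LCSApprox.forLoop v e p) s s' → s'.reg v = i →
      I i s' → Wp V w p c (fun s'' => I (i + 1) (s''.setReg v (i + 1))) s') :
    Wp V w (LCSApprox.forLoop v e p) ((c + 3) * k + 3) (fun s' => I k s' ∧ s'.reg v = k) s := by
  have hsub : ∀ {s₁ s₂}, Frame (.seq p (.assign v (.op .add (.reg v) (.const 1)))) s₁ s₂ →
      Frame (LCSApprox.forLoop v e p) s₁ s₂ := by
    intro s₁ s₂ h
    refine h.mono ?_ ?_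
    · simp [LCSApprox.forLoop, Prog.regs]
    · simp [LCSApprox.forLoop, Prog.arrs]
  have h0 : Frame (LCSApprox.forLoop v e p) s (s.setReg v 0) := by
    refine ⟨fun x hx => ?_, fun _ _ => rfl⟩
    have : x ≠ v := by
      rintro rfl; exact hx (by simp [LCSApprox.forLoop, Prog.regs])
    simp [this]
  refine Wp.mono (c := ((c + 2) + 1) * k + 1 + 2) (Wp.assign_seq hs (Nat.zero_le _) hv7
    fun hs0 => ?_) (fun _ _ _ h => h) (by ring_nf; omega)
  have hz : (Expr.const 0).eval s = 0 := rfl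
  rw [hz] at hs0 ⊢
  -- The loop rule counts the remaining iterations, so its index is `r = k - i`.
  have key := Wp.loop (V := V) (w := w) (c := c + 2) (e := .op .lt (.reg v) e)
    (p := .seq p (.assign v (.op .add (.reg v) (.const 1))))
    (fun r s' => ∃ i, i + r = k ∧ s'.reg v = i ∧ I i s') (k := k) hs0
    ⟨0, by omega, by simp, hI⟩ ?_
  · refine key.mono ?_ le_rfl
    rintro s' - hF ⟨⟨r, i, hir, hiv, hI'⟩, hz⟩
    have hek := he s' (h0.trans (hsub hF))
    simp only [Expr.eval, Op.eval, hek, hiv] at hz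
    have hlt : ¬ i < k := by
      intro h; simp [h] at hz
    obtain rfl : i = k := by omega
    exact ⟨hI', hiv⟩
  · rintro r s' hs' hF ⟨i, hir, hiv, hI'⟩ hne
    have hF' := h0.trans (hsub hF)
    have hek := he s' hF'
    simp only [Expr.eval, Op.eval, hek, hiv] at hne
    have hlt : i < k := by
      by_contra h; simp [h] at hne
    refine ⟨r - 1, by omega, ?_⟩
    refine Wp.seq (c' := 1) (hstep i s' hlt hs' hF' hiv hI') fun s₁ hs₁ hF₁ hI₁ => ?_
    have hv₁ : s₁.reg v = i := by rw [hF₁.1 v hv, hiv]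
    have hev : (Expr.op .add (.reg v) (.const 1)).eval s₁ = i + 1 := by
      simp [Expr.eval, Op.eval, hv₁]
    refine Wp.assign hs₁ (by rw [hev]; omega) hv7 ?_
    rw [hev]
    exact ⟨i + 1, by omega, by simp, hI₁⟩

end LCSApprox

namespace LCSApprox

/-! ### Common subsequences as chains of matching positions -/

theorem le_lcs {x y z : List ℕ} (hx : z.Sublist x) (hy : z.Sublist y) : z.length ≤ lcs x y := by
  unfold lcs
  exact Finset.le_sup (f := List.length) (by simp [hx, hy])

theorem exists_sublist_lcs (x y : List ℕ) :
    ∃ z : List ℕ, z.Sublist x ∧ z.Sublist y ∧ z.length = lcs x y := by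
  have hne : (x.sublists.toFinset.filter fun z => z.Sublist y).Nonempty := ⟨[], by simp⟩
  obtain ⟨z, hz, h⟩ := Finset.exists_mem_eq_sup _ hne List.length
  simp only [Finset.mem_filter, List.mem_toFinset, List.mem_sublists] at hz
  exact ⟨z, hz.1, hz.2, h.symm⟩

theorem lcs_le_length_left (x y : List ℕ) : lcs x y ≤ x.length := by
  obtain ⟨z, h1, -, h⟩ := exists_sublist_lcs x y
  exact h ▸ h1.length_le

theorem lcs_mono {x x' y y' : List ℕ} (hx : x.Sublist x') (hy : y.Sublist y') :
    lcs x y ≤ lcs x' y' := by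
  obtain ⟨z, h1, h2, h⟩ := exists_sublist_lcs x y
  exact h ▸ le_lcs (h1.trans hx) (h2.trans hy)

theorem lcs_add_lcs_le (x x' y y' : List ℕ) :
    lcs x y + lcs x' y' ≤ lcs (x ++ x') (y ++ y') := by
  obtain ⟨z, h1, h2, h⟩ := exists_sublist_lcs x y
  obtain ⟨z', h1', h2', h'⟩ := exists_sublist_lcs x' y'
  rw [← h, ← h', ← List.length_append]
  exact le_lcs (h1.append h1') (h2.append h2')

theorem map_getD_sublist {x l : List ℕ} (hl : l.Pairwise (· < ·)) (hx : ∀ a ∈ l, a < x.length) :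
    (l.map fun a => x.getD a 0).Sublist x := by
  let is : List (Fin x.length) := l.attach.map fun a => ⟨a.1, hx a.1 a.2⟩
  have his : is.Pairwise (· < ·) := by
    rw [List.pairwise_map]
    have h : (l.attach.map Subtype.val).Pairwise (· < ·) := by
      rw [List.attach_map_subtype_val]; exact hl
    rw [List.pairwise_map] at h
    exact h
  have h : l.map (fun a => x.getD a 0) = is.map fun a => x[a] := by
    simp only [is, List.map_map]
    conv_lhs => rw [← List.attach_map_subtype_val l, List.map_map]
    refine List.map_congr_left fun a _ => ?_
    exact List.getD_eq_getElem _ _ (hx a.1 a.2)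
  rw [h]
  exact List.map_getElem_sublist his

/-- Strict domination in both coordinates. -/
def PairLT (p q : ℕ × ℕ) : Prop := p.1 < q.1 ∧ p.2 < q.2

/-- A list of matching positions of `x` and `y` that increases in both coordinates. -/
def IsMatchChain (x y : List ℕ) (c : List (ℕ × ℕ)) : Prop :=
  c.Pairwise PairLT ∧
    ∀ p ∈ c, p.1 < x.length ∧ p.2 < y.length ∧ x.getD p.1 0 = y.getD p.2 0

/-- Both coordinate lists spell the same word, as matched positions carry equal letters; this word
is a common subsequence. -/
theorem IsMatchChain.length_le {x y : List ℕ} {c : List (ℕ × ℕ)} (h : IsMatchChain x y c) :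
    c.length ≤ lcs x y := by
  have h1 : ((c.map Prod.fst).map fun a => x.getD a 0).Sublist x := by
    refine map_getD_sublist ?_ ?_
    · rw [List.pairwise_map]; exact h.1.imp fun h => h.1
    · intro a ha
      obtain ⟨p, hp, rfl⟩ := List.mem_map.1 ha
      exact (h.2 p hp).1
  have h2 : ((c.map Prod.snd).map fun a => y.getD a 0).Sublist y := by
    refine map_getD_sublist ?_ ?_
    · rw [List.pairwise_map]; exact h.1.imp fun h => h.2
    · intro a ha
      obtain ⟨p, hp, rfl⟩ := List.mem_map.1 ha
      exact (h.2 p hp).2.1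
  have h3 : (c.map Prod.fst).map (fun a => x.getD a 0) =
      (c.map Prod.snd).map fun a => y.getD a 0 := by
    simp only [List.map_map]
    exact List.map_congr_left fun p hp => (h.2 p hp).2.2
  have := le_lcs h1 (h3 ▸ h2)
  simpa using this

/-- Pairs up the positions of an LCS in `x` with its positions in `y`. -/
theorem exists_matchChain (x y : List ℕ) : ∃ c, IsMatchChain x y c ∧ c.length = lcs x y := by
  obtain ⟨z, h1, h2, h⟩ := exists_sublist_lcs x y
  obtain ⟨is, e1, p1⟩ := List.sublist_eq_map_getElem h1
  obtain ⟨js, e2, p2⟩ := List.sublist_eq_map_getElem h2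
  have l1 : is.length = z.length := by rw [e1]; simp
  have l2 : js.length = z.length := by rw [e2]; simp
  refine ⟨List.ofFn fun t : Fin z.length =>
    ((is[t.1]'(by omega) : ℕ), (js[t.1]'(by omega) : ℕ)), ⟨?_, ?_⟩, by simp [h]⟩
  · rw [List.pairwise_ofFn]
    intro a b hab
    exact ⟨List.pairwise_iff_getElem.1 p1 a b _ _ hab, List.pairwise_iff_getElem.1 p2 a b _ _ hab⟩
  · intro p hp
    obtain ⟨t, rfl⟩ := List.mem_ofFn.1 hp
    refine ⟨Fin.is_lt _, Fin.is_lt _, ?_⟩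
    have a1 : z[t.1] = x[(is[t.1]'(by omega) : ℕ)]'(Fin.is_lt _) := by simp [e1]
    have a2 : z[t.1] = y[(js[t.1]'(by omega) : ℕ)]'(Fin.is_lt _) := by simp [e2]
    simp only
    rw [List.getD_eq_getElem _ _ (Fin.is_lt _), List.getD_eq_getElem _ _ (Fin.is_lt _), ← a1, ← a2]

/-! ### Blocks -/

theorem block_length (m : ℕ) (x : List ℕ) (i : ℕ) :
    (block m x i).length = min m (x.length - i * m) := by
  simp [block]

theorem block_length_le (m : ℕ) (x : List ℕ) (i : ℕ) : (block m x i).length ≤ m := by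
  rw [block_length]; exact min_le_left _ _

theorem block_getD {m a : ℕ} (x : List ℕ) (i : ℕ) (ha : a < m) :
    (block m x i).getD a 0 = x.getD (i * m + a) 0 := by
  simp [block, List.getD_eq_getElem?_getD, ha]

theorem take_succ_mul (m : ℕ) (x : List ℕ) (i : ℕ) :
    x.take ((i + 1) * m) = x.take (i * m) ++ block m x i := by
  rw [Nat.succ_mul, List.take_add, block]

theorem div_eq_iff_block {m a i : ℕ} (hm : 1 ≤ m) : a / m = i ↔ i * m ≤ a ∧ a < i * m + m := by
  rw [Nat.div_eq_iff (by omega)]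
  constructor <;> rintro ⟨h1, h2⟩ <;> constructor <;> omega

/-- A match chain all of whose points lie in the block pair `(i, j)`. -/
def IsBlockChain (m : ℕ) (x y : List ℕ) (i j : ℕ) (c : List (ℕ × ℕ)) : Prop :=
  IsMatchChain x y c ∧ ∀ p ∈ c, p.1 / m = i ∧ p.2 / m = j

theorem IsBlockChain.length_le {m : ℕ} (hm : 1 ≤ m) {x y : List ℕ} {i j : ℕ}
    {c : List (ℕ × ℕ)} (h : IsBlockChain m x y i j c) :
    c.length ≤ lcs (block m x i) (block m y j) := by
  have key : IsMatchChain (block m x i) (block m y j)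
      (c.map fun p => (p.1 - i * m, p.2 - j * m)) := by
    have hb : ∀ p ∈ c, (i * m ≤ p.1 ∧ p.1 < i * m + m) ∧ (j * m ≤ p.2 ∧ p.2 < j * m + m) :=
      fun p hp => ⟨(div_eq_iff_block hm).1 (h.2 p hp).1, (div_eq_iff_block hm).1 (h.2 p hp).2⟩
    refine ⟨?_, ?_⟩
    · rw [List.pairwise_map]
      refine h.1.1.imp_of_mem fun {p q} hp hq hpq => ?_
      have h1 := hb p hp
      have h2 := hb q hq
      unfold PairLT at *
      simp only
      omega
    · intro p hp
      obtain ⟨q, hq, rfl⟩ := List.mem_map.1 hp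
      obtain ⟨⟨h1, h2⟩, h3, h4⟩ := hb q hq
      obtain ⟨g1, g2, g3⟩ := h.1.2 q hq
      refine ⟨?_, ?_, ?_⟩
      · simp only [block_length]; omega
      · simp only [block_length]; omega
      · simp only
        rw [block_getD _ _ (by omega), block_getD _ _ (by omega)]
        rw [show i * m + (q.1 - i * m) = q.1 by omega, show j * m + (q.2 - j * m) = q.2 by omega]
        exact g3
  simpa using key.length_le

theorem exists_blockChain {m : ℕ} (hm : 1 ≤ m) (x y : List ℕ) (i j : ℕ) :
    ∃ c, IsBlockChain m x y i j c ∧ c.length = lcs (block m x i) (block m y j) := by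
  obtain ⟨c, hc, hl⟩ := exists_matchChain (block m x i) (block m y j)
  refine ⟨c.map fun p => (i * m + p.1, j * m + p.2), ⟨⟨?_, ?_⟩, ?_⟩, by simpa using hl⟩
  · rw [List.pairwise_map]
    refine hc.1.imp fun {p q} hpq => ?_
    unfold PairLT at *
    simp only
    omega
  · intro p hp
    obtain ⟨q, hq, rfl⟩ := List.mem_map.1 hp
    obtain ⟨g1, g2, g3⟩ := hc.2 q hq
    rw [block_length] at g1 g2
    rw [block_getD _ _ (by omega), block_getD _ _ (by omega)] at g3
    exact ⟨by simp only; omega, by simp only; omega, g3⟩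
  · intro p hp
    obtain ⟨q, hq, rfl⟩ := List.mem_map.1 hp
    obtain ⟨g1, g2, g3⟩ := hc.2 q hq
    rw [block_length] at g1 g2
    exact ⟨(div_eq_iff_block hm).2 ⟨by simp, by simp only; omega⟩,
      (div_eq_iff_block hm).2 ⟨by simp, by simp only; omega⟩⟩

/-! ### Matching pairs -/

theorem min_count_le_lcs (x y : List ℕ) (σ : ℕ) : min (x.count σ) (y.count σ) ≤ lcs x y := by
  have := le_lcs (x := x) (y := y) (z := List.replicate (min (x.count σ) (y.count σ)) σ)
    (List.replicate_sublist_iff.2 (min_le_left _ _))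
    (List.replicate_sublist_iff.2 (min_le_right _ _))
  simpa using this

theorem card_filter_getD_eq_count (y : List ℕ) (σ : ℕ) :
    ((Finset.range y.length).filter fun b => y.getD b 0 = σ).card = y.count σ := by
  induction y using List.reverseRecOn with
  | nil => simp
  | append_singleton y a ih =>
    rw [List.count_append, ← ih, List.length_append, List.length_singleton,
      Finset.range_add_one, Finset.filter_insert]
    have h1 : (Finset.range y.length).filter (fun b => (y ++ [a]).getD b 0 = σ) =
        (Finset.range y.length).filter (fun b => y.getD b 0 = σ) := by
      refine Finset.filter_congr fun b hb => ?_
      rw [List.getD_append _ _ _ _ (Finset.mem_range.1 hb)]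
    rw [h1]
    have h2 : (y ++ [a]).getD y.length 0 = a := by simp [List.getD_eq_getElem?_getD]
    rw [h2]
    by_cases h : a = σ
    · subst h
      rw [if_pos rfl, Finset.card_insert_of_notMem (by simp)]
      simp
    · rw [if_neg h]; simp [h]

theorem matchingPairs_eq_sum (x y : List ℕ) :
    matchingPairs x y = ∑ a ∈ Finset.range x.length, y.count (x.getD a 0) := by
  unfold matchingPairs
  rw [Finset.card_filter, Finset.sum_product]
  refine Finset.sum_congr rfl fun a ha => ?_
  rw [← card_filter_getD_eq_count, Finset.card_filter]
  refine Finset.sum_congr rfl fun b hb => ?_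
  rw [Finset.mem_range] at ha hb
  simp [ha, hb, eq_comm]

theorem sum_range_getD_eq_sum_count (x : List ℕ) (f : ℕ → ℕ) :
    ∑ a ∈ Finset.range x.length, f (x.getD a 0) = ∑ σ ∈ x.toFinset, x.count σ * f σ := by
  rw [Finset.sum_comp f fun a => x.getD a 0]
  have himg : (Finset.range x.length).image (fun a => x.getD a 0) = x.toFinset := by
    ext σ
    simp only [Finset.mem_image, Finset.mem_range, List.mem_toFinset]
    constructor
    · rintro ⟨a, ha, rfl⟩
      rw [List.getD_eq_getElem _ _ ha]; exact List.getElem_mem ha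
    · intro h
      obtain ⟨a, ha, rfl⟩ := List.getElem_of_mem h
      exact ⟨a, ha, List.getD_eq_getElem _ _ ha⟩
  rw [himg]
  refine Finset.sum_congr rfl fun σ _ => ?_
  rw [card_filter_getD_eq_count, smul_eq_mul]

/-- A symbol with `p` and `q` occurrences contributes `p q ≤ (p + q) min p q` pairs, and its `min p
q`-fold repetition is a common subsequence. Summed over block pairs this bounds all matches by `2 m
λ`. -/
theorem matchingPairs_le (x y : List ℕ) :
    matchingPairs x y ≤ (x.length + y.length) * lcs x y := by
  rw [matchingPairs_eq_sum, sum_range_getD_eq_sum_count x fun σ => y.count σ]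
  have h1 : ∀ σ, x.count σ * y.count σ ≤ (x.count σ + y.count σ) * lcs x y := by
    intro σ
    refine le_trans ?_ (Nat.mul_le_mul_left _ (min_count_le_lcs x y σ))
    rcases le_total (x.count σ) (y.count σ) with h | h
    · rw [min_eq_left h]; nlinarith
    · rw [min_eq_right h]; nlinarith
  refine (Finset.sum_le_sum fun σ _ => h1 σ).trans ?_
  rw [← Finset.sum_mul, Finset.sum_add_distrib]
  refine Nat.mul_le_mul_right _ (Nat.add_le_add (List.sum_toFinset_count_eq_length x).le ?_)
  rw [← List.sum_toFinset_count_eq_length y]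
  have : ∑ σ ∈ x.toFinset, y.count σ ≤ ∑ σ ∈ x.toFinset ∪ y.toFinset, y.count σ :=
    Finset.sum_le_sum_of_subset Finset.subset_union_left
  refine this.trans (Finset.sum_subset Finset.subset_union_right ?_).ge
  intro σ _ h
  exact List.count_eq_zero_of_not_mem (by simpa using h)

/-! ### A long block sequence of pairs with large LCS -/

theorem lt_numBlocks {n m a : ℕ} (hm : 1 ≤ m) (ha : a < n) : a / m < numBlocks n m := by
  unfold numBlocks
  have h : (a + m) / m ≤ (n + m - 1) / m := Nat.div_le_div_right (by omega)
  rw [Nat.add_div_right _ (by omega)] at h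
  omega

/-- Spread the points of a longest chain over the visited cells. Cells with fewer than `L / (4 N)`
points contain at most half of the chain. A block sequence of heavy cells that cannot be enlarged
blocks every heavy point by a common block row or column, and each block row or column contains at
most `m` points. -/
theorem exists_heavy_blockSeq {n m : ℕ} (hm : 1 ≤ m) {x y : List ℕ} (hx : x.length = n)
    (hy : y.length = n) :
    ∃ S ⊆ blockPairs n m, IsBlockSeq S ∧ lcs x y ≤ 4 * m * S.card ∧
      ∀ p ∈ S, lcs x y ≤ 4 * numBlocks n m * lcs (block m x p.1) (block m y p.2) := by
  classical
  obtain ⟨c, hc, hL⟩ := exists_matchChain x y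
  set L := lcs x y
  set N := numBlocks n m
  have hcn : c.Nodup := hc.1.imp fun {p q} h hpq => by
    subst hpq; exact absurd h.1 (lt_irrefl _)
  set C := c.toFinset with hCdef
  have hCcard : C.card = L := by rw [List.toFinset_card_of_nodup hcn, hL]
  have hcomp : ∀ p ∈ C, ∀ q ∈ C, p ≠ q → PairLT p q ∨ PairLT q p := by
    intro p hp q hq hpq
    have hp' := List.mem_toFinset.1 hp
    have hq' := List.mem_toFinset.1 hq
    have h2 : c.Pairwise fun p q => PairLT p q ∨ PairLT q p := hc.1.imp fun h => Or.inl h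
    have : Std.Symm fun p q : ℕ × ℕ => PairLT p q ∨ PairLT q p := ⟨fun _ _ h => Or.symm h⟩
    exact h2.forall hp' hq' hpq
  have hmem : ∀ p ∈ C, p.1 < n ∧ p.2 < n := fun p hp => by
    have := hc.2 p (List.mem_toFinset.1 hp); omega
  let cell : ℕ × ℕ → ℕ × ℕ := fun p => (p.1 / m, p.2 / m)
  have hcell : ∀ p ∈ C, ∀ q ∈ C,
      ((cell p).1 ≤ (cell q).1 ∧ (cell p).2 ≤ (cell q).2) ∨
        ((cell q).1 ≤ (cell p).1 ∧ (cell q).2 ≤ (cell p).2) := by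
    intro p hp q hq
    by_cases hpq : p = q
    · subst hpq; left; exact ⟨le_rfl, le_rfl⟩
    · rcases hcomp p hp q hq hpq with h | h
      · left; exact ⟨Nat.div_le_div_right h.1.le, Nat.div_le_div_right h.2.le⟩
      · right; exact ⟨Nat.div_le_div_right h.1.le, Nat.div_le_div_right h.2.le⟩
  -- The cells are totally ordered coordinatewise, so the sum of the coordinates tells them apart,
  -- and it is less than `2 N`.
  have hcells : (C.image cell).card ≤ 2 * N := by
    have hinj : Set.InjOn (fun h : ℕ × ℕ => h.1 + h.2) (C.image cell : Set (ℕ × ℕ)) := by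
      intro h hh k hk hhk
      simp only [Finset.coe_image, Set.mem_image, Finset.mem_coe] at hh hk
      obtain ⟨p, hp, rfl⟩ := hh
      obtain ⟨q, hq, rfl⟩ := hk
      have := hcell p hp q hq
      simp only at hhk
      refine Prod.ext ?_ ?_ <;> omega
    rw [← Finset.card_image_of_injOn hinj]
    calc _ ≤ (Finset.range (2 * N)).card := by
            refine Finset.card_le_card fun t ht => ?_
            simp only [Finset.mem_image] at ht
            obtain ⟨h, ⟨p, hp, rfl⟩, rfl⟩ := ht
            have h1 := lt_numBlocks hm (hmem p hp).1
            have h2 := lt_numBlocks hm (hmem p hp).2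
            simp only [Finset.mem_range, cell]
            omega
      _ = 2 * N := Finset.card_range _
  let cnt : ℕ × ℕ → ℕ := fun h => (C.filter fun p => cell p = h).card
  let Hp := C.filter fun p => L ≤ 4 * N * cnt (cell p)
  let Lp := C.filter fun p => ¬ L ≤ 4 * N * cnt (cell p)
  have hHL : Hp.card + Lp.card = L := by
    rw [← hCcard]; exact Finset.card_filter_add_card_filter_not _
  have hN0 : L = 0 ∨ 0 < N := by
    rcases Nat.eq_zero_or_pos L with h | h
    · exact Or.inl h
    · right
      obtain ⟨p, hp⟩ := Finset.card_pos.1 (hCcard ▸ h)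
      exact lt_of_le_of_lt (Nat.zero_le _) (lt_numBlocks hm (hmem p hp).1)
  -- At most `2 N` light cells with fewer than `L / (4 N)` points each: together at most `L / 2`
  -- points.
  have hLp : 4 * N * Lp.card ≤ 2 * N * L := by
    have h1 : Lp.card = ∑ h ∈ Lp.image cell, (Lp.filter fun p => cell p = h).card :=
      Finset.card_eq_sum_card_image _ _
    rw [h1, Finset.mul_sum]
    calc _ ≤ ∑ h ∈ Lp.image cell, L := by
            refine Finset.sum_le_sum fun h hh => ?_
            obtain ⟨p, hp, rfl⟩ := Finset.mem_image.1 hh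
            have h2 := (Finset.mem_filter.1 hp).2
            have h3 : (Lp.filter fun q => cell q = cell p).card ≤ cnt (cell p) :=
              Finset.card_le_card (Finset.filter_subset_filter _ (Finset.filter_subset _ _))
            have := Nat.mul_le_mul_left (4 * N) h3
            omega
      _ = (Lp.image cell).card * L := by rw [Finset.sum_const, smul_eq_mul]
      _ ≤ 2 * N * L := Nat.mul_le_mul_right _ ((Finset.card_le_card
          (Finset.image_subset_image (Finset.filter_subset _ _))).trans hcells)
  have hHp : L ≤ 2 * Hp.card := by
    rcases hN0 with h | h
    · omega
    · have : 2 * Lp.card ≤ L := by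
        by_contra hcon
        have : 2 * N * L < 2 * N * (2 * Lp.card) := Nat.mul_lt_mul_of_pos_left (by omega) (by omega)
        nlinarith
      omega
  -- A block sequence of maximal size cannot be extended, which is all that the covering argument
  -- needs.
  let F := (Hp.image cell).powerset.filter fun S => IsBlockSeq S
  have hFne : F.Nonempty := ⟨∅, Finset.mem_filter.2 ⟨by simp, by simp [IsBlockSeq]⟩⟩
  obtain ⟨S, hSF, hmax⟩ := Finset.exists_max_image F Finset.card hFne
  obtain ⟨hSsub, hSchain⟩ := Finset.mem_filter.1 hSF
  rw [Finset.mem_powerset] at hSsub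
  have hcover : ∀ p ∈ Hp, ∃ h ∈ S, h.1 = (cell p).1 ∨ h.2 = (cell p).2 := by
    intro p hp
    by_contra hcon
    push Not at hcon
    have hnot : cell p ∉ S := fun h => (hcon _ h).1 rfl
    have hin : insert (cell p) S ∈ F := by
      refine Finset.mem_filter.2 ⟨Finset.mem_powerset.2 (Finset.insert_subset
        (Finset.mem_image_of_mem _ hp) hSsub), ?_⟩
      unfold IsBlockSeq
      rw [Finset.coe_insert]
      refine IsChain.insert hSchain fun h hh hne => ?_
      obtain ⟨q, hq, rfl⟩ := Finset.mem_image.1 (hSsub hh)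
      have h1 := hcell p (Finset.mem_filter.1 hp).1 q (Finset.mem_filter.1 hq).1
      have h2 := hcon _ hh
      omega
    have := hmax _ hin
    rw [Finset.card_insert_of_notMem hnot] at this
    omega
  -- Distinct points of the chain have distinct first coordinates, and a block row offers only `m`
  -- of them.
  have hrow : ∀ i, (C.filter fun p => p.1 / m = i).card ≤ m := by
    intro i
    have hinj : Set.InjOn Prod.fst (C.filter (fun p => p.1 / m = i) : Set (ℕ × ℕ)) := by
      intro p hp q hq h
      by_contra hne
      have := hcomp p (Finset.mem_filter.1 hp).1 q (Finset.mem_filter.1 hq).1 hne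
      unfold PairLT at this
      omega
    rw [← Finset.card_image_of_injOn hinj]
    calc _ ≤ (Finset.Ico (i * m) (i * m + m)).card := by
            refine Finset.card_le_card fun t ht => ?_
            obtain ⟨p, hp, rfl⟩ := Finset.mem_image.1 ht
            exact Finset.mem_Ico.2 ((div_eq_iff_block hm).1 (Finset.mem_filter.1 hp).2)
      _ = m := by simp
  have hcol : ∀ j, (C.filter fun p => p.2 / m = j).card ≤ m := by
    intro i
    have hinj : Set.InjOn Prod.snd (C.filter (fun p => p.2 / m = i) : Set (ℕ × ℕ)) := by
      intro p hp q hq h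
      by_contra hne
      have := hcomp p (Finset.mem_filter.1 hp).1 q (Finset.mem_filter.1 hq).1 hne
      unfold PairLT at this
      omega
    rw [← Finset.card_image_of_injOn hinj]
    calc _ ≤ (Finset.Ico (i * m) (i * m + m)).card := by
            refine Finset.card_le_card fun t ht => ?_
            obtain ⟨p, hp, rfl⟩ := Finset.mem_image.1 ht
            exact Finset.mem_Ico.2 ((div_eq_iff_block hm).1 (Finset.mem_filter.1 hp).2)
      _ = m := by simp
  refine ⟨S, ?_, hSchain, ?_, ?_⟩
  · intro h hh
    obtain ⟨p, hp, rfl⟩ := Finset.mem_image.1 (hSsub hh)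
    have := hmem p (Finset.mem_filter.1 hp).1
    simp only [blockPairs, Finset.mem_product, Finset.mem_range]
    exact ⟨lt_numBlocks hm this.1, lt_numBlocks hm this.2⟩
  · have hb : Hp ⊆ S.biUnion fun h =>
        (C.filter fun p => p.1 / m = h.1) ∪ C.filter fun p => p.2 / m = h.2 := by
      intro p hp
      obtain ⟨h, hh, hor⟩ := hcover p hp
      have hpC := (Finset.mem_filter.1 hp).1
      refine Finset.mem_biUnion.2 ⟨h, hh, Finset.mem_union.2 ?_⟩
      rcases hor with h1 | h1
      · exact Or.inl (Finset.mem_filter.2 ⟨hpC, h1.symm⟩)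
      · exact Or.inr (Finset.mem_filter.2 ⟨hpC, h1.symm⟩)
    have h1 := (Finset.card_le_card hb).trans Finset.card_biUnion_le
    have h2 : ∑ h ∈ S, ((C.filter fun p => p.1 / m = h.1) ∪
        C.filter fun p => p.2 / m = h.2).card ≤ ∑ h ∈ S, 2 * m := by
      refine Finset.sum_le_sum fun h _ => (Finset.card_union_le _ _).trans ?_
      have := hrow h.1
      have := hcol h.2
      omega
    rw [Finset.sum_const, smul_eq_mul] at h2
    -- `L ≤ 2 |Hp|` and `|Hp| ≤ |S| * 2 m`.
    nlinarith
  · intro h hh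
    obtain ⟨p, hp, rfl⟩ := Finset.mem_image.1 (hSsub hh)
    refine (Finset.mem_filter.1 hp).2.trans (Nat.mul_le_mul_left _ ?_)
    have hch : IsBlockChain m x y (cell p).1 (cell p).2 (c.filter fun q => cell q = cell p) := by
      refine ⟨⟨hc.1.sublist List.filter_sublist, fun q hq => hc.2 q (List.mem_of_mem_filter hq)⟩,
        fun q hq => ?_⟩
      have := List.of_mem_filter hq
      simp only [decide_eq_true_eq] at this
      exact ⟨congrArg Prod.fst this, congrArg Prod.snd this⟩
    refine le_trans (le_of_eq ?_) (hch.length_le hm)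
    simp only [cnt]
    rw [← List.toFinset_card_of_nodup (hcn.filter _), List.toFinset_filter]
    simp [C]

end LCSApprox

namespace LCSApprox

/-! ### Patience sorting -/

/-- `bs` has a strictly increasing subsequence of length `k + 1` that ends with `b`. -/
def IncEnds (bs : List ℕ) (k b : ℕ) : Prop :=
  ∃ t : List ℕ, (t ++ [b]).Sublist bs ∧ (t ++ [b]).Pairwise (· < ·) ∧ t.length = k

/-- `D k`, for `k < len`, is the least end of an increasing subsequence of `bs` of length `k + 1`,
and `len` is the length of a longest increasing subsequence. -/
structure IsPatience (bs : List ℕ) (D : ℕ → ℕ) (len : ℕ) : Prop where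
  ends : ∀ l < len, IncEnds bs l (D l)
  least : ∀ k b, IncEnds bs k b → k < len ∧ D k ≤ b
  mono : ∀ l l', l < l' → l' < len → D l < D l'

theorem IncEnds.append {bs : List ℕ} {k b : ℕ} (h : IncEnds bs k b) (b' : ℕ) :
    IncEnds (bs ++ [b']) k b := by
  obtain ⟨t, h1, h2, h3⟩ := h
  exact ⟨t, h1.trans (List.sublist_append_left _ _), h2, h3⟩

theorem IncEnds.snoc {bs : List ℕ} {k b b' : ℕ} (h : IncEnds bs k b) (hb : b < b') :
    IncEnds (bs ++ [b']) (k + 1) b' := by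
  obtain ⟨t, h1, h2, h3⟩ := h
  refine ⟨t ++ [b], h1.append (List.Sublist.refl _), ?_, by simp [h3]⟩
  refine List.pairwise_append.2 ⟨h2, by simp, ?_⟩
  intro a ha c hc
  rw [List.mem_singleton] at hc
  subst hc
  rcases List.mem_append.1 ha with h | h
  · exact ((List.pairwise_append.1 h2).2.2 a h b (by simp)).trans hb
  · rw [List.mem_singleton] at h; omega

theorem IncEnds.zero_append (bs : List ℕ) (b : ℕ) : IncEnds (bs ++ [b]) 0 b :=
  ⟨[], by simp, by simp, rfl⟩

theorem incEnds_append {bs : List ℕ} {k b b' : ℕ} (h : IncEnds (bs ++ [b']) k b) :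
    IncEnds bs k b ∨ (b = b' ∧ (k = 0 ∨ ∃ k' b₀, k = k' + 1 ∧ b₀ < b' ∧ IncEnds bs k' b₀)) := by
  obtain ⟨t, h1, h2, h3⟩ := h
  obtain ⟨l₁, l₂, e, s1, s2⟩ := List.sublist_append_iff.1 h1
  rcases l₂.eq_nil_or_concat' with rfl | ⟨l₂', z, rfl⟩
  · left
    rw [List.append_nil] at e
    exact ⟨t, e ▸ s1, h2, h3⟩
  · right
    have hl : l₂' = [] := by
      have := s2.length_le
      simp only [List.length_append, List.length_singleton] at this
      exact List.eq_nil_of_length_eq_zero (by omega)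
    subst hl
    have hz : z = b' := by simpa using s2
    subst hz
    rw [List.nil_append] at e
    obtain ⟨rfl, hbz⟩ := List.append_inj' e rfl
    obtain rfl : b = z := by simpa using hbz
    refine ⟨rfl, ?_⟩
    rcases t.eq_nil_or_concat' with rfl | ⟨t', b₀, rfl⟩
    · left; simpa using h3.symm
    · right
      refine ⟨t'.length, b₀, by simpa using h3.symm, ?_, t', s1, (List.pairwise_append.1 h2).1, rfl⟩
      exact (List.pairwise_append.1 h2).2.2 b₀ (by simp) b (by simp)

theorem isPatience_nil (D : ℕ → ℕ) : IsPatience [] D 0 := by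
  refine ⟨by simp, fun k b h => ?_, by simp⟩
  obtain ⟨t, h1, -, -⟩ := h
  simp at h1

/-- The new element `b` extends the best sequence of length `lo` and none longer, since the ends
from `lo` on are at least `b`. So only the optimum at index `lo` can improve, and `lo = len` is the
case of a new record length. -/
theorem IsPatience.insert {bs : List ℕ} {D : ℕ → ℕ} {len lo b : ℕ} (h : IsPatience bs D len)
    (hlo : lo ≤ len) (hlt : ∀ l < lo, D l < b) (hge : ∀ l, lo ≤ l → l < len → b ≤ D l) :
    IsPatience (bs ++ [b]) (Function.update D lo b) (if lo = len then len + 1 else len) := by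
  have hlen' : lo < (if lo = len then len + 1 else len) ∧
      len ≤ (if lo = len then len + 1 else len) ∧
      ∀ l, l < (if lo = len then len + 1 else len) → l ≠ lo → l < len := by
    split <;> refine ⟨by omega, by omega, fun l _ _ => by omega⟩
  obtain ⟨p1, p2, p3⟩ := hlen'
  refine ⟨fun l hl => ?_, fun k b' hk => ?_, fun l l' hll hl' => ?_⟩
  · by_cases hlo' : l = lo
    · subst hlo'
      rw [Function.update_self]
      rcases l with _ | l
      · exact .zero_append _ _
      · exact (h.ends l (by omega)).snoc (hlt l (by omega))
    · rw [Function.update_of_ne hlo']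
      exact (h.ends l (p3 l hl hlo')).append b
  · rcases incEnds_append hk with hk | ⟨rfl, rfl | ⟨k', b₀, rfl, hb₀, hk'⟩⟩
    · obtain ⟨h1, h2⟩ := h.least k b' hk
      refine ⟨by omega, ?_⟩
      by_cases hklo : k = lo
      · subst hklo
        rw [Function.update_self]
        exact (hge k le_rfl h1).trans h2
      · rw [Function.update_of_ne hklo]; exact h2
    · refine ⟨by omega, ?_⟩
      by_cases hklo : 0 = lo
      · subst hklo; rw [Function.update_self]
      · rw [Function.update_of_ne hklo]; exact (hlt 0 (by omega)).le
    · obtain ⟨h1, h2⟩ := h.least k' b₀ hk'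
      have hklo : k' < lo := by
        by_contra hcon
        have := hge k' (by omega) h1
        omega
      refine ⟨by omega, ?_⟩
      by_cases hk2 : k' + 1 = lo
      · rw [hk2, Function.update_self]
      · rw [Function.update_of_ne hk2]; exact (hlt _ (by omega)).le
  · by_cases h1 : l = lo
    · subst h1
      rw [Function.update_self, Function.update_of_ne (by omega)]
      have hl2 := p3 l' hl' (by omega)
      exact lt_of_le_of_lt (hge l le_rfl (by omega)) (h.mono l l' hll hl2)
    · rw [Function.update_of_ne h1]
      by_cases h2 : l' = lo
      · subst h2; rw [Function.update_self]; exact hlt l hll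
      · rw [Function.update_of_ne h2]; exact h.mono l l' hll (p3 l' hl' h2)

theorem IsPatience.length_le {bs : List ℕ} {D : ℕ → ℕ} {len : ℕ} (h : IsPatience bs D len)
    {t : List ℕ} (ht : t.Sublist bs) (hp : t.Pairwise (· < ·)) : t.length ≤ len := by
  rcases t.eq_nil_or_concat' with rfl | ⟨t', b, rfl⟩
  · simp
  · have := (h.least t'.length b ⟨t', ht, hp, rfl⟩).1
    simpa using this

theorem IsPatience.exists_sublist {bs : List ℕ} {D : ℕ → ℕ} {len : ℕ} (h : IsPatience bs D len) :
    ∃ t : List ℕ, t.Sublist bs ∧ t.Pairwise (· < ·) ∧ t.length = len := by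
  rcases len with _ | l
  · exact ⟨[], by simp, by simp, rfl⟩
  · obtain ⟨t, h1, h2, h3⟩ := h.ends l (by omega)
    exact ⟨_, h1, h2, by simp [h3]⟩

/-! ### Occurrence lists and the points of a block pair -/

/-- The positions `b < k` of the symbol `σ` in block `j` of `y`, in increasing order. -/
def occBelow (y : List ℕ) (m j σ k : ℕ) : List ℕ :=
  (List.range k).filter fun b => b / m = j ∧ y.getD b 0 = σ

/-- The positions of the symbol `σ` in block `j` of `y`, in increasing order. -/
def occ (y : List ℕ) (m j σ : ℕ) : List ℕ := occBelow y m j σ y.length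

theorem mem_occ {y : List ℕ} {m j σ b : ℕ} :
    b ∈ occ y m j σ ↔ b < y.length ∧ b / m = j ∧ y.getD b 0 = σ := by
  simp [occ, occBelow]

theorem occ_pairwise (y : List ℕ) (m j σ : ℕ) : (occ y m j σ).Pairwise (· < ·) :=
  List.pairwise_lt_range.sublist List.filter_sublist

theorem occ_length {m : ℕ} (hm : 1 ≤ m) (y : List ℕ) (j σ : ℕ) :
    (occ y m j σ).length = (block m y j).count σ := by
  rw [← card_filter_getD_eq_count, ← List.toFinset_card_of_nodup ((occ_pairwise y m j σ).imp
    fun h => ne_of_lt h)]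
  refine Finset.card_nbij' (fun b => b - j * m) (fun b => j * m + b) ?_ ?_ ?_ ?_
  · intro b hb
    simp only [List.coe_toFinset, Set.mem_ofPred_eq, mem_occ, div_eq_iff_block hm] at hb
    simp only [Finset.coe_filter, Finset.mem_range, Set.mem_ofPred_eq, block_length]
    refine ⟨by omega, ?_⟩
    rw [block_getD _ _ (by omega), show j * m + (b - j * m) = b by omega]
    exact hb.2.2
  · intro b hb
    simp only [Finset.coe_filter, Finset.mem_range, Set.mem_ofPred_eq, block_length] at hb
    simp only [List.coe_toFinset, Set.mem_ofPred_eq, mem_occ, div_eq_iff_block hm]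
    rw [block_getD _ _ (by omega)] at hb
    exact ⟨by omega, ⟨by omega, by omega⟩, hb.2⟩
  · intro b hb
    simp only [List.coe_toFinset, Set.mem_ofPred_eq, mem_occ, div_eq_iff_block hm] at hb
    simp only
    omega
  · intro b _
    simp

/-- The points of the block column `j` whose row is in `S`, row by row, each row in decreasing
order. -/
def points (x y : List ℕ) (m j : ℕ) (S : List ℕ) : List ℕ :=
  S.flatMap fun a => (occ y m j (x.getD a 0)).reverse

/-- The work list for `points`: the entry `none` stands for the start of a row. -/
def tokens (x y : List ℕ) (m j : ℕ) (S : List ℕ) : List (Option ℕ) :=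
  S.flatMap fun a => none :: ((occ y m j (x.getD a 0)).reverse.map some)

theorem tokens_reduceOption (x y : List ℕ) (m j : ℕ) (S : List ℕ) :
    (tokens x y m j S).reduceOption = points x y m j S := by
  induction S with
  | nil => rfl
  | cons a S ih =>
    simp only [tokens, points, List.flatMap_cons, List.cons_append] at *
    rw [List.reduceOption_cons_of_none, List.reduceOption_append, ih]
    congr 1
    generalize (occ y m j (x.getD a 0)).reverse = l
    induction l with
    | nil => rfl
    | cons b l ih => rw [List.map_cons, List.reduceOption_cons_of_some, ih]

theorem tokens_length (x y : List ℕ) (m j : ℕ) (S : List ℕ) :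
    (tokens x y m j S).length = (S.map fun a => 1 + (occ y m j (x.getD a 0)).length).sum := by
  simp only [tokens, List.length_flatMap, List.length_cons, List.length_map, List.length_reverse]
  congr 1
  exact List.map_congr_left fun a _ => by omega

/-- Each row is listed in decreasing order, so a strictly increasing subsequence takes at most one
point per row. Increasing columns therefore force increasing rows, and the search for chains becomes
one-dimensional. -/
theorem exists_chain_of_sublist_points {x y : List ℕ} {m j : ℕ} {S t : List ℕ}
    (ht : t.Sublist (points x y m j S)) (hp : t.Pairwise (· < ·)) :
    ∃ c : List (ℕ × ℕ), c.map Prod.snd = t ∧ (c.map Prod.fst).Sublist S ∧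
      ∀ p ∈ c, p.2 ∈ occ y m j (x.getD p.1 0) := by
  induction S generalizing t with
  | nil =>
    have : t = [] := by simpa [points] using ht
    exact ⟨[], by simp [this], by simp, by simp⟩
  | cons a S ih =>
    simp only [points, List.flatMap_cons] at ht
    obtain ⟨t₁, t₂, rfl, s₁, s₂⟩ := List.sublist_append_iff.1 ht
    obtain ⟨c, e1, e2, e3⟩ := ih s₂ (List.pairwise_append.1 hp).2.1
    have hdec : t₁.Pairwise (· > ·) := by
      refine List.Pairwise.sublist s₁ ?_
      rw [List.pairwise_reverse]
      exact occ_pairwise y m j _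
    match t₁, s₁, hp, hdec with
    | [], _, _, _ => exact ⟨c, by simpa using e1, e2.cons a, e3⟩
    | [b], s₁, _, _ =>
      refine ⟨(a, b) :: c, by simp [e1], ?_, ?_⟩
      · simpa using e2
      · intro p hp
        rcases List.mem_cons.1 hp with rfl | hp
        · have : b ∈ (occ y m j (x.getD a 0)).reverse := s₁.subset (by simp)
          simpa using this
        · exact e3 p hp
    | b :: b' :: t, _, hp, hdec =>
      exfalso
      have h1 : b < b' := by simp at hp; exact hp.1.1
      have h2 : b > b' := by simp at hdec; exact hdec.1.1
      omega

theorem sublist_flatMap_of_chain {f : ℕ → List ℕ} {S : List ℕ} {c : List (ℕ × ℕ)}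
    (hc : (c.map Prod.fst).Sublist S) (hf : ∀ p ∈ c, p.2 ∈ f p.1) :
    (c.map Prod.snd).Sublist (S.flatMap f) := by
  induction S generalizing c with
  | nil =>
    have : c = [] := by simpa using hc
    simp [this]
  | cons a S ih =>
    rw [List.flatMap_cons]
    match c, hc, hf with
    | [], _, _ => simp
    | p :: c, hc, hf =>
      rw [List.map_cons] at hc ⊢
      rcases List.sublist_cons_iff.1 hc with h | ⟨r, hr, h⟩
      · exact (ih (c := p :: c) h hf).trans (List.sublist_append_right _ _)
      · obtain ⟨rfl, rfl⟩ := List.cons.inj hr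
        refine List.Sublist.append (l₁ := [p.2]) ?_ (ih h fun q hq => hf q (by simp [hq]))
        simpa using hf p (by simp)

/-- Patience sorting on points of a block pair never exceeds the LCS of the pair. -/
theorem IsPatience.le_lcs_block {x y : List ℕ} {m i j : ℕ} (hm : 1 ≤ m) {S bs : List ℕ}
    {D : ℕ → ℕ} {len : ℕ} (h : IsPatience bs D len) (hbs : bs.Sublist (points x y m j S))
    (hS : S.Pairwise (· < ·)) (hSi : ∀ a ∈ S, a < x.length ∧ a / m = i) :
    len ≤ lcs (block m x i) (block m y j) := by
  obtain ⟨t, h1, h2, rfl⟩ := h.exists_sublist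
  obtain ⟨c, e1, e2, e3⟩ := exists_chain_of_sublist_points (h1.trans hbs) h2
  have hc : IsBlockChain m x y i j c := by
    refine ⟨⟨?_, fun p hp => ?_⟩, fun p hp => ?_⟩
    · have a1 : c.Pairwise fun p q => p.1 < q.1 := List.pairwise_map.1 (hS.sublist e2)
      have a2 : c.Pairwise fun p q => p.2 < q.2 := List.pairwise_map.1 (e1 ▸ h2)
      exact a1.and a2
    · have b1 := hSi p.1 (e2.subset (List.mem_map_of_mem hp))
      have b2 := mem_occ.1 (e3 p hp)
      exact ⟨b1.1, b2.1, b2.2.2.symm⟩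
    · exact ⟨(hSi p.1 (e2.subset (List.mem_map_of_mem hp))).2, (mem_occ.1 (e3 p hp)).2.1⟩
  rw [← e1, List.length_map]
  exact hc.length_le hm

/-- Patience sorting on all points with rows in `S` finds every chain with rows in `S`. -/
theorem IsPatience.length_filter_le {x y : List ℕ} {m i j : ℕ} {S : List ℕ}
    {D : ℕ → ℕ} {len : ℕ} (h : IsPatience (points x y m j S) D len)
    (hS : S.Pairwise (· < ·)) {c : List (ℕ × ℕ)} (hc : IsBlockChain m x y i j c) :
    (c.filter fun p => p.1 ∈ S).length ≤ len := by
  set c' := c.filter fun p => p.1 ∈ S with hc'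
  have hsub : c'.Sublist c := List.filter_sublist
  have hp := hc.1.1.sublist hsub
  have h1 : (c'.map Prod.fst).Pairwise (· < ·) := List.pairwise_map.2 (hp.imp fun h => h.1)
  have h2 : (c'.map Prod.snd).Pairwise (· < ·) := List.pairwise_map.2 (hp.imp fun h => h.2)
  have h3 : (c'.map Prod.fst).Sublist S := by
    refine List.sublist_of_subperm_of_pairwise (r := (· ≤ ·)) ?_ (h1.imp fun h => le_of_lt h)
      (hS.imp fun h => le_of_lt h)
    refine List.subperm_of_subset (h1.imp fun h => ne_of_lt h) ?_
    intro a ha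
    obtain ⟨p, hp, rfl⟩ := List.mem_map.1 ha
    simpa using List.of_mem_filter hp
  have h4 : (c'.map Prod.snd).Sublist (points x y m j S) := by
    refine sublist_flatMap_of_chain h3 fun p hp => ?_
    have hpc := hsub.subset hp
    rw [List.mem_reverse, mem_occ]
    exact ⟨(hc.1.2 p hpc).2.1, (hc.2 p hpc).2, (hc.1.2 p hpc).2.2.symm⟩
  simpa using h.length_le h4 h2

/-- The positions `a < k` in block `i` of a string of length `n` that satisfy `P`. -/
def rowsBelow (n m i : ℕ) (P : ℕ → Prop) [DecidablePred P] (k : ℕ) : List ℕ :=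
  ((List.range k).map fun a => i * m + a).filter fun a => a < n ∧ P a

theorem rowsBelow_pairwise (n m i : ℕ) (P : ℕ → Prop) [DecidablePred P] (k : ℕ) :
    (rowsBelow n m i P k).Pairwise (· < ·) := by
  refine List.Pairwise.sublist List.filter_sublist ?_
  rw [List.pairwise_map]
  exact List.pairwise_lt_range.imp fun h => by omega

theorem mem_rowsBelow {n m i : ℕ} (hm : 1 ≤ m) {P : ℕ → Prop} [DecidablePred P] {a : ℕ} :
    a ∈ rowsBelow n m i P m ↔ a < n ∧ a / m = i ∧ P a := by
  simp only [rowsBelow, List.mem_filter, List.mem_map, List.mem_range, decide_eq_true_eq]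
  rw [div_eq_iff_block hm]
  constructor
  · rintro ⟨⟨b, hb, rfl⟩, h1, h2⟩
    exact ⟨h1, ⟨by omega, by omega⟩, h2⟩
  · rintro ⟨h1, ⟨h2, h3⟩, h4⟩
    exact ⟨⟨a - i * m, by omega, by omega⟩, h1, h4⟩

end LCSApprox

namespace LCSApprox

/-! ### The program -/

infixl:65 "+ₑ" => Expr.op Op.add
infixl:65 "-ₑ" => Expr.op Op.sub
infixl:70 "*ₑ" => Expr.op Op.mul
infixl:70 "/ₑ" => Expr.op Op.div
infix:50 "<ₑ" => Expr.op Op.lt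
infix:50 "=ₑ" => Expr.op Op.eq
infix:35 "≔" => Prog.assign
infixr:30 ";;" => Prog.seq
prefix:max "§" => Expr.const
prefix:max "!ₑ" => Expr.reg

notation "r_n" => 0
notation "r_T" => 1
notation "r_out" => 2
notation "r_m" => 3
notation "r_N" => 4
notation "r_H" => 5
notation "r_Q" => 6
notation "r_fuel" => 7
notation "r_idx" => 8
notation "r_tmp" => 9
notation "r_g" => 10
notation "r_u" => 11
notation "r_v" => 12
notation "r_w" => 13
notation "r_i" => 14
notation "r_k" => 15
notation "r_j" => 16
notation "r_d" => 17
notation "r_rows" => 18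
notation "r_th" => 19
notation "r_capv" => 20
notation "r_cap" => 21
notation "r_len" => 22
notation "r_s" => 23
notation "r_c" => 24
notation "r_key" => 25
notation "r_b" => 26
notation "r_lo" => 27
notation "r_hi" => 28
notation "r_mid" => 29
notation "r_it" => 30
notation "r_left" => 31
notation "r_diag" => 32
notation "r_old" => 33
notation "r_a" => 34

notation "a_x" => 0
notation "a_y" => 1
notation "a_tape" => 2
notation "a_pow" => 3
notation "a_cnt" => 4
notation "a_cell" => 5
notation "a_best" => 6
notation "a_val" => 7
notation "a_rows" => 8
notation "a_pat" => 9

/-- Binary search: `lo` becomes the number of entries of `pat` below `b`. -/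
def searchProg : Prog :=
  r_lo ≔ §0 ;; r_hi ≔ !ₑr_len ;;
  forLoop r_it (!ₑr_H) (.ite (!ₑr_lo <ₑ !ₑr_hi)
    (r_mid ≔ (!ₑr_lo +ₑ !ₑr_hi) /ₑ §2 ;;
      .ite (.read a_pat (!ₑr_mid) <ₑ !ₑr_b) (r_lo ≔ !ₑr_mid +ₑ §1) (r_hi ≔ !ₑr_mid))
    .skip)

/-- Insert `b` into the patience array. -/
def insertProg : Prog :=
  searchProg ;; .store a_pat (!ₑr_lo) (!ₑr_b) ;;
  .ite (!ₑr_lo =ₑ !ₑr_len) (r_len ≔ !ₑr_len +ₑ §1) .skip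

/-- Treat one entry of the work list of a block pair. -/
def tokenProg : Prog :=
  r_fuel ≔ !ₑr_fuel -ₑ §1 ;; r_cap ≔ !ₑr_cap -ₑ §1 ;;
  .ite (!ₑr_c)
    -- The counter runs downwards, so the columns of a row are read in decreasing order.
    (r_c ≔ !ₑr_c -ₑ §1 ;; r_b ≔ .read a_cell (!ₑr_key *ₑ !ₑr_m +ₑ !ₑr_c) ;; insertProg)
    (r_key ≔ .read a_x (.read a_rows (!ₑr_s)) *ₑ !ₑr_N +ₑ !ₑr_j ;;
      r_c ≔ .read a_cnt (!ₑr_key) ;; r_s ≔ !ₑr_s +ₑ §1)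

/-- Condition under which a block pair has work left. -/
def pairCond : Expr := !ₑr_fuel *ₑ !ₑr_cap *ₑ (!ₑr_c +ₑ (!ₑr_s <ₑ !ₑr_rows))

/-- Longest common subsequence of a block pair, restricted to the listed rows. -/
def pairProg : Prog :=
  r_len ≔ §0 ;; r_s ≔ §0 ;; r_c ≔ §0 ;; r_cap ≔ !ₑr_capv ;; .loop pairCond tokenProg

/-- List the rows of block `i` that are selected at rate `1 / d`. -/
def rowsProg : Prog :=
  r_rows ≔ §0 ;;
  forLoop r_a (!ₑr_m)
    (r_tmp ≔ !ₑr_i *ₑ !ₑr_m +ₑ !ₑr_a ;;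
      .ite ((!ₑr_tmp <ₑ !ₑr_n) *ₑ
          (.read a_tape (!ₑr_g *ₑ (§2 *ₑ !ₑr_n) +ₑ !ₑr_tmp) *ₑ !ₑr_d <ₑ !ₑr_Q))
        (.store a_rows (!ₑr_rows) (!ₑr_tmp) ;; r_rows ≔ !ₑr_rows +ₑ §1)
        .skip)

/-- Test all block pairs of row `i` that are still alive at the current rate. -/
def levelProg : Prog :=
  r_d ≔ .read a_pow (!ₑr_u -ₑ !ₑr_k) ;; rowsProg ;;
  -- At `k = 0` the truncated quotient is `0`, so every pair is tested at the first level; at `k +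
  -- 1` the threshold is `128 * 2 ^ k`.
  r_th ≔ §128 *ₑ (.read a_pow (!ₑr_k) /ₑ §2) ;;
  r_capv ≔ §64 *ₑ !ₑr_H *ₑ ((!ₑr_m +ₑ .read a_pow (!ₑr_w)) /ₑ !ₑr_d +ₑ §1) ;;
  forLoop r_j (!ₑr_N)
    (.ite (.read a_val (!ₑr_j) <ₑ !ₑr_th)
      -- The value `0` lies below all later thresholds, so an erased pair stays erased and adds
      -- nothing to the dynamic program.
      (.store a_val (!ₑr_j) (§0))
      (pairProg ;; .store a_val (!ₑr_j) (!ₑr_len)))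

/-- One row of the dynamic program over blocks. -/
def dpProg : Prog :=
  r_left ≔ §0 ;; r_diag ≔ §0 ;;
  forLoop r_j (!ₑr_N)
    (r_old ≔ .read a_best (!ₑr_j +ₑ §1) ;;
      r_tmp ≔ !ₑr_diag +ₑ .read a_val (!ₑr_j) ;;
      .ite (!ₑr_left <ₑ !ₑr_tmp) (r_left ≔ !ₑr_tmp) .skip ;;
      .ite (!ₑr_left <ₑ !ₑr_old) (r_left ≔ !ₑr_old) .skip ;;
      .store a_best (!ₑr_j +ₑ §1) (!ₑr_left) ;;
      r_diag ≔ !ₑr_old)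

/-- Treat block `i` if it is selected at rate `2 ^ (-v)`. -/
def rowProg : Prog :=
  -- A round owns `2 n` tape cells. The first `n` select rows and the last `n` select blocks, which
  -- makes the selection of blocks independent of the tests.
  .ite (.read a_tape (!ₑr_g *ₑ (§2 *ₑ !ₑr_n) +ₑ !ₑr_n +ₑ !ₑr_i) *ₑ .read a_pow (!ₑr_v) <ₑ !ₑr_Q)
    (forLoop r_j (!ₑr_N) (.store a_val (!ₑr_j) (§0)) ;;
      forLoop r_k (!ₑr_u +ₑ §1) levelProg ;; dpProg)
    .skip

/-- One run for the current round `g` and parameters `u`, `v`, `w`. -/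
def runProg : Prog :=
  -- Large enough that, for suitable parameters, the mean consumption is at most an eighth of the
  -- fuel.
  r_fuel ≔ §(2 ^ 24) *ₑ !ₑr_T *ₑ !ₑr_H *ₑ !ₑr_H ;;
  forLoop r_j (!ₑr_N +ₑ §1) (.store a_best (!ₑr_j) (§0)) ;;
  forLoop r_i (!ₑr_N) rowProg ;;
  .ite (!ₑr_out <ₑ .read a_best (!ₑr_N)) (r_out ≔ .read a_best (!ₑr_N)) .skip

/-- All runs; `G` times the bit length is the number of rounds. -/
def mainProg (G : ℕ) : Prog :=
  forLoop r_g (§G *ₑ !ₑr_H)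
    (forLoop r_u (!ₑr_H +ₑ §1)
      (forLoop r_v (!ₑr_H +ₑ §1)
        -- `2 ^ w` has to reach the order of `n ^ 3`, hence the factor `3`.
        (forLoop r_w (§3 *ₑ !ₑr_H +ₑ §7) runProg)))

/-- Sort the positions of `y` into buckets by block and symbol. -/
def bucketProg : Prog :=
  forLoop r_b (!ₑr_n)
    -- The bucket of symbol `σ` in block `j` has number `σ N + j` and room for `m` positions.
    (r_key ≔ .read a_y (!ₑr_b) *ₑ !ₑr_N +ₑ !ₑr_b /ₑ !ₑr_m ;;
      .store a_cell (!ₑr_key *ₑ !ₑr_m +ₑ .read a_cnt (!ₑr_key)) (!ₑr_b) ;;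
      .store a_cnt (!ₑr_key) (.read a_cnt (!ₑr_key) +ₑ §1))

/-- Compute the block length, the number of blocks, the bit length and the powers of two. -/
def setupProg : Prog :=
  r_m ≔ §1 ;;
  -- The least `m` with `n ^ 2 ≤ m ^ 2 T` is `⌈n / √T⌉`; squaring avoids the root.
  .loop (!ₑr_m *ₑ !ₑr_m *ₑ !ₑr_T <ₑ !ₑr_n *ₑ !ₑr_n) (r_m ≔ !ₑr_m +ₑ §1) ;;
  r_N ≔ (!ₑr_n +ₑ !ₑr_m -ₑ §1) /ₑ !ₑr_m ;;
  r_H ≔ §0 ;; r_Q ≔ §1 ;;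
  .loop (!ₑr_Q <ₑ !ₑr_n +ₑ §1) (r_Q ≔ !ₑr_Q *ₑ §2 ;; r_H ≔ !ₑr_H +ₑ §1) ;;
  .store a_pow (§0) (§1) ;;
  forLoop r_idx (§3 *ₑ !ₑr_H +ₑ §7)
    (.store a_pow (!ₑr_idx +ₑ §1) (§2 *ₑ .read a_pow (!ₑr_idx))) ;;
  bucketProg ;; r_idx ≔ §0

/-- Fill the tape with random numbers below `Q`. -/
def tapeProg (G : ℕ) : Prog :=
  .loop (!ₑr_idx <ₑ §G *ₑ !ₑr_H *ₑ (§2 *ₑ !ₑr_n))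
    (.sample r_tmp (!ₑr_Q) ;; .store a_tape (!ₑr_idx) (!ₑr_tmp) ;; r_idx ≔ !ₑr_idx +ₑ §1)

/-- The approximation algorithm. -/
def lcsProg (G : ℕ) : Prog := setupProg ;; tapeProg G ;; mainProg G

/-! ### The memory layout -/

/-- An input together with its bit length `H` and the number `G` that controls the number of
rounds. -/
structure Setup where
  A : ℕ
  n : ℕ
  T : ℕ
  H : ℕ
  G : ℕ
  x : List ℕ
  y : List ℕ
  input : IsInput A n T x y
  lt_pow : n < 2 ^ H
  pow_le : 2 ^ H ≤ 2 * n

namespace Setup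

variable (I : Setup)

/-- Block length. -/
noncomputable def m : ℕ := blockLen I.n I.T

/-- Number of blocks. -/
noncomputable def N : ℕ := numBlocks I.n I.m

/-- Bound for all numbers in memory. -/
def V : ℕ := (I.A + 1) * (I.G + 1) * 2 ^ (8 * I.H + 40)

theorem n_pos : 1 ≤ I.n := I.input.one_le

theorem T_pos : 1 ≤ I.T := I.n_pos.trans I.input.le_budget

theorem H_pos : 1 ≤ I.H := by
  have h1 := I.lt_pow
  have h2 := I.n_pos
  by_contra h
  have : I.H = 0 := by omega
  rw [this] at h1
  omega

theorem H_lt : I.H < 2 ^ I.H := Nat.lt_two_pow_self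

theorem sqrt_pos : 0 < Real.sqrt I.T := Real.sqrt_pos.2 (by exact_mod_cast I.T_pos)

theorem m_pos : 1 ≤ I.m := by
  unfold m blockLen
  rw [Nat.one_le_ceil_iff]
  exact div_pos (by exact_mod_cast I.n_pos) I.sqrt_pos

theorem m_le_iff (k : ℕ) : I.m ≤ k ↔ I.n * I.n ≤ k * k * I.T := by
  unfold m blockLen
  rw [Nat.ceil_le, div_le_iff₀ I.sqrt_pos]
  have h1 : (0 : ℝ) ≤ k * Real.sqrt I.T := by positivity
  rw [← abs_of_nonneg (show (0 : ℝ) ≤ I.n by positivity), ← abs_of_nonneg h1, ← sq_le_sq, mul_pow,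
    Real.sq_sqrt (by positivity)]
  constructor
  · intro h
    have : ((I.n * I.n : ℕ) : ℝ) ≤ ((k * k * I.T : ℕ) : ℝ) := by push_cast; nlinarith
    exact_mod_cast this
  · intro h
    have : ((I.n * I.n : ℕ) : ℝ) ≤ ((k * k * I.T : ℕ) : ℝ) := by exact_mod_cast h
    push_cast at this
    nlinarith

theorem m_le_n : I.m ≤ I.n := by
  rw [m_le_iff]
  exact Nat.le_mul_of_pos_right _ I.T_pos

theorem N_le_n : I.N ≤ I.n := by
  unfold N numBlocks
  have h1 := I.m_pos
  have h2 := I.n_pos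
  rw [Nat.div_le_iff_le_mul_add_pred (by omega)]
  have := Nat.le_mul_of_pos_left I.n (show 0 < I.m by omega)
  omega

theorem N_pos : 1 ≤ I.N := by
  exact Nat.lt_of_le_of_lt (Nat.zero_le _) (lt_numBlocks (n := I.n) I.m_pos (a := 0) I.n_pos)

theorem N_mul_m_le : I.N * I.m ≤ 2 * I.n := by
  unfold N numBlocks
  have h := I.m_pos
  have := Nat.div_mul_le_self (I.n + I.m - 1) I.m
  have := I.m_le_n
  omega

theorem pow_le_V {k : ℕ} (hk : k ≤ 8 * I.H + 40) : 2 ^ k ≤ I.V := by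
  unfold V
  calc 2 ^ k ≤ 1 * 2 ^ (8 * I.H + 40) := by
        rw [one_mul]; exact Nat.pow_le_pow_right (by norm_num) hk
    _ ≤ _ := Nat.mul_le_mul_right _ (Nat.mul_pos (by omega) (by omega))

theorem le_V_of_le {a k : ℕ} (ha : a ≤ 2 ^ k) (hk : k ≤ 8 * I.H + 40) : a ≤ I.V :=
  ha.trans (I.pow_le_V hk)

theorem n_lt_V : I.n + 1 < I.V := by
  have h1 := I.lt_pow
  have h2 : 2 ^ (I.H + 1) ≤ I.V := I.pow_le_V (by omega)
  rw [pow_succ] at h2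
  have := I.n_pos
  omega

/-- The part of the memory that stays fixed while the runs are executed; `ζ` is the tape. -/
structure Ctx (ζ : ℕ → ℕ) (s : Mem) : Prop where
  n : s.reg r_n = I.n
  T : s.reg r_T = I.T
  m : s.reg r_m = I.m
  N : s.reg r_N = I.N
  H : s.reg r_H = I.H
  Q : s.reg r_Q = 2 ^ I.H
  x : s.arr a_x = fun i => I.x.getD i 0
  tape : s.arr a_tape = ζ
  pow : ∀ t < 3 * I.H + 8, s.arr a_pow t = 2 ^ t
  cnt : ∀ σ, ∀ j < I.N, s.arr a_cnt (σ * I.N + j) = (occ I.y I.m j σ).length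
  cell : ∀ σ, ∀ j < I.N, ∀ c < (occ I.y I.m j σ).length,
    s.arr a_cell ((σ * I.N + j) * I.m + c) = (occ I.y I.m j σ).getD c 0

variable {I}

theorem Ctx.frame {ζ : ℕ → ℕ} {s s' : Mem} {p : Prog} (h : I.Ctx ζ s) (hF : Frame p s s')
    (hr : ∀ v ∈ [0, 1, 3, 4, 5, 6], v ∉ p.regs) (ha : ∀ a ∈ [0, 2, 3, 4, 5], a ∉ p.arrs) :
    I.Ctx ζ s' := by
  constructor
  · rw [hF.1 _ (hr _ (by simp)), h.n]
  · rw [hF.1 _ (hr _ (by simp)), h.T]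
  · rw [hF.1 _ (hr _ (by simp)), h.m]
  · rw [hF.1 _ (hr _ (by simp)), h.N]
  · rw [hF.1 _ (hr _ (by simp)), h.H]
  · rw [hF.1 _ (hr _ (by simp)), h.Q]
  · rw [hF.2 _ (ha _ (by simp)), h.x]
  · rw [hF.2 _ (ha _ (by simp)), h.tape]
  · rw [hF.2 _ (ha _ (by simp))]; exact h.pow
  · rw [hF.2 _ (ha _ (by simp))]; exact h.cnt
  · rw [hF.2 _ (ha _ (by simp))]; exact h.cell

end Setup

end LCSApprox

namespace LCSApprox

/-- For `w = 0` fuel carries no credit, so the fuel register may be written like any other. The body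
of a loop paid by fuel is verified in this form. -/
theorem Wp.assign_zero {V : ℕ} {s : Mem} {Q : Mem → Prop} {v : ℕ} {e : Expr} (hs : s.Bdd V)
    (hv : e.eval s ≤ V) (hQ : Q (s.setReg v (e.eval s))) : Wp V 0 (.assign v e) 1 Q s :=
  ⟨_, 1, .assign hs v e, hs.setReg hv, hQ, by simp⟩

theorem Wp.assign_zero_seq {V : ℕ} {s : Mem} {q : Prog} {c : ℕ} {Q : Mem → Prop} {v : ℕ}
    {e : Expr} (hs : s.Bdd V) (hv : e.eval s ≤ V)
    (h : (s.setReg v (e.eval s)).Bdd V → Wp V 0 q c Q (s.setReg v (e.eval s))) :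
    Wp V 0 (.seq (.assign v e) q) (c + 2) Q s := by
  have := Wp.seq (q := q) (c' := c) (Q := Q) (R := fun s' => s' = s.setReg v (e.eval s))
    (Wp.assign_zero hs hv rfl) (fun s' hs' _ h' => by subst h'; exact h hs')
  exact this.mono (fun _ _ _ h => h) (by omega)

/-! ### Verification of the inner loops -/

/-- The number `H` of iterations is fixed: the interval has length below `2 ^ (H - t)` after `t` of
them, and once it is empty the iterations do nothing. -/
theorem searchProg_wp {V w : ℕ} {s : Mem} (hs : s.Bdd V) {H len b : ℕ}
    {D : ℕ → ℕ} (hH : s.reg r_H = H) (hlen : s.reg r_len = len) (hb : s.reg r_b = b)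
    (hD : s.arr a_pat = D) (hl : len < 2 ^ H) (hHV : H ≤ V) (hlV : len + len ≤ V)
    (hmono : ∀ l l', l < l' → l' < len → D l < D l') :
    Wp V w searchProg (10 * H + 10)
      (fun s' => s'.reg r_lo ≤ len ∧ (∀ l < s'.reg r_lo, D l < b) ∧
        ∀ l, s'.reg r_lo ≤ l → l < len → b ≤ D l) s := by
  unfold searchProg
  refine Wp.mono (c := (6 + 3) * H + 3 + 2 + 2) (Wp.assign_seq hs (Nat.zero_le _) (by decide)
    fun hs1 => Wp.assign_seq hs1 (hs1.1 _) (by decide) fun hs2 => ?_)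
    (fun _ _ _ h => h) (by omega)
  refine (Wp.forLoop (V := V) (w := w) (c := 6) (k := H)
    (fun t s' => s'.reg r_lo ≤ s'.reg r_hi ∧ s'.reg r_hi ≤ len ∧
      s'.reg r_hi - s'.reg r_lo < 2 ^ (H - t) ∧ (∀ l < s'.reg r_lo, D l < b) ∧
      ∀ l, s'.reg r_hi ≤ l → l < len → b ≤ D l) hs2 (by decide) (by decide) hHV ?_ ?_ ?_).mono
    ?_ le_rfl
  · intro s' hF
    have := hF.1 r_H (by decide)
    simpa [Expr.eval, hH] using this
  · simp [Expr.eval, hlen, hl]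
    intro l h1 h2
    omega
  · rintro t s' ht hs' hF - ⟨h1, h2, h3, h4, h5⟩
    have e1 : s'.reg r_b = b := by rw [hF.1 r_b (by decide)]; simpa using hb
    have e2 : s'.arr a_pat = D := by rw [hF.2 a_pat (by decide)]; simpa using hD
    have hpow : 2 ^ (H - t) = 2 * 2 ^ (H - (t + 1)) := by
      rw [← pow_succ']; congr 1; omega
    have hpos : 0 < 2 ^ (H - (t + 1)) := by positivity
    refine Wp.ite (c := 5) hs' (fun hc => ?_) (fun hc => ?_)
    · have hlt : s'.reg r_lo < s'.reg r_hi := by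
        by_contra hcon
        simp [Expr.eval, Op.eval, hcon] at hc
      have hev : (((!ₑr_lo +ₑ !ₑr_hi) /ₑ §2 : Expr)).eval s' = (s'.reg r_lo + s'.reg r_hi) / 2 :=
        rfl
      refine Wp.mono (c := 2 + 2) (Wp.assign_seq hs' (by rw [hev]; omega) (by decide) fun hs3 => ?_)
        (fun _ _ _ h => h) (by norm_num)
      rw [hev] at hs3 ⊢
      set mid := (s'.reg r_lo + s'.reg r_hi) / 2 with hmid
      refine Wp.ite (c := 1) hs3 (fun hc => ?_) (fun hc => ?_)
      · have hlt2 : D mid < b := by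
          by_contra hcon
          simp [Expr.eval, Op.eval, e1, e2, hcon] at hc
        refine Wp.assign hs3 (by simp [Expr.eval, Op.eval]; omega) (by decide) ?_
        simp only [Mem.setReg_reg, Expr.eval, Op.eval]
        norm_num
        refine ⟨by omega, h2, by omega, fun l hl => ?_, h5⟩
        rcases Nat.lt_or_ge l mid with h | h
        · exact (hmono l mid h (by omega)).trans hlt2
        · obtain rfl : l = mid := by omega
          exact hlt2
      · have hge : b ≤ D mid := by
          by_contra hcon
          simp [Expr.eval, Op.eval, e1, e2] at hc
          omega
        refine Wp.assign hs3 (by simp [Expr.eval]; omega) (by decide) ?_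
        simp only [Mem.setReg_reg, Expr.eval]
        norm_num
        refine ⟨by omega, by omega, by omega, h4, fun l hl hl' => ?_⟩
        rcases Nat.lt_or_ge mid l with h | h
        · exact hge.trans (hmono mid l h hl').le
        · obtain rfl : l = mid := by omega
          exact hge
    · have hge : s'.reg r_hi ≤ s'.reg r_lo := by
        by_contra hcon
        have : s'.reg r_lo < s'.reg r_hi := by omega
        simp [Expr.eval, Op.eval, this] at hc
      refine (Wp.skip hs' ?_).mono (fun _ _ _ h => h) (by norm_num)
      simp only [Mem.setReg_reg]
      norm_num
      exact ⟨h1, h2, by omega, h4, h5⟩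
  · rintro s' - - ⟨⟨h1, h2, h3, h4, h5⟩, -⟩
    have : s'.reg r_hi = s'.reg r_lo := by
      simp at h3
      omega
    rw [this] at h5 h2
    exact ⟨h2, h4, h5⟩

theorem insertProg_wp {V w : ℕ} {s : Mem} (hs : s.Bdd V) {H len b : ℕ} {bs : List ℕ}
    (hH : s.reg r_H = H) (hlen : s.reg r_len = len) (hb : s.reg r_b = b)
    (hl : len < 2 ^ H) (hHV : H ≤ V) (hlV : len + len + 1 ≤ V)
    (hP : IsPatience bs (s.arr a_pat) len) :
    Wp V w insertProg (10 * H + 15)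
      (fun s' => IsPatience (bs ++ [b]) (s'.arr a_pat) (s'.reg r_len)) s := by
  unfold insertProg
  refine Wp.mono (c := 10 * H + 10 + (2 + 2) + 1) (Wp.seq (searchProg_wp hs hH hlen hb rfl hl hHV
    (by omega) hP.mono) fun s' hs' hF h => ?_) (fun _ _ _ h => h) (by omega)
  obtain ⟨h1, h2, h3⟩ := h
  have e1 : s'.reg r_b = b := by rw [hF.1 r_b (by decide)]; exact hb
  have e2 : s'.arr a_pat = s.arr a_pat := hF.2 a_pat (by decide)
  have e3 : s'.reg r_len = len := by rw [hF.1 r_len (by decide)]; exact hlen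
  have hins := hP.insert h1 h2 h3
  refine Wp.store_seq hs' (hs'.1 _) fun hs3 => ?_
  refine Wp.ite (c := 1) hs3 (fun hc => ?_) (fun hc => ?_)
  · have heq : s'.reg r_lo = len := by
      by_contra hcon
      simp [Expr.eval, Op.eval, e3, hcon] at hc
    refine Wp.assign hs3 (by simp [Expr.eval, Op.eval, e3]; omega) (by decide) ?_
    rw [if_pos heq] at hins
    simpa [Expr.eval, Op.eval, e1, e2, e3] using hins
  · have heq : s'.reg r_lo ≠ len := by
      intro hcon
      simp [Expr.eval, Op.eval, e3, hcon] at hc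
    refine Wp.skip hs3 ?_
    rw [if_neg heq] at hins
    simpa [Expr.eval, Op.eval, e1, e2, e3] using hins

end LCSApprox

/-! ### Patience sorting on a block pair, paid for by fuel -/

namespace LCSApprox

namespace Setup

variable {I : Setup}

theorem getD_x_le (I : Setup) (a : ℕ) : I.x.getD a 0 ≤ I.A * I.n := by
  rcases Nat.lt_or_ge a I.x.length with h | h
  · rw [List.getD_eq_getElem _ _ h]
    exact I.input.alphabet_x _ (List.getElem_mem h)
  · rw [List.getD_eq_default _ _ h]; exact Nat.zero_le _

theorem getD_y_le (I : Setup) (a : ℕ) : I.y.getD a 0 ≤ I.A * I.n := by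
  rcases Nat.lt_or_ge a I.y.length with h | h
  · rw [List.getD_eq_getElem _ _ h]
    exact I.input.alphabet_y _ (List.getElem_mem h)
  · rw [List.getD_eq_default _ _ h]; exact Nat.zero_le _

theorem key_le_V (I : Setup) {σ j : ℕ} (hσ : σ ≤ I.A * I.n) (hj : j ≤ I.N) :
    σ * I.N + j ≤ I.V := by
  have h1 : σ * I.N + j ≤ (I.A + 1) * (I.n * I.n) := by
    have a1 : σ * I.N ≤ I.A * I.n * I.n := Nat.mul_le_mul hσ I.N_le_n
    have a2 := I.N_le_n
    have a3 : I.n ≤ I.n * I.n := Nat.le_mul_of_pos_left _ I.n_pos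
    nlinarith
  refine h1.trans ?_
  unfold V
  rw [mul_assoc]
  refine Nat.mul_le_mul_left _ ?_
  have h2 : I.n * I.n ≤ 2 ^ I.H * 2 ^ I.H := Nat.mul_le_mul I.lt_pow.le I.lt_pow.le
  rw [← pow_add] at h2
  calc I.n * I.n ≤ 1 * 2 ^ (8 * I.H + 40) := by
        rw [one_mul]; exact h2.trans (Nat.pow_le_pow_right (by norm_num) (by omega))
    _ ≤ _ := Nat.mul_le_mul_right _ (by omega)

/-- The loop invariant of `pairProg`: `pre` is the part of the work list already treated. -/
def PairInv (I : Setup) (j : ℕ) (S : List ℕ) (cap fuel : ℕ) (s : Mem) : Prop :=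
  ∃ (pre : List (Option ℕ)) (σ : ℕ),
    tokens I.x I.y I.m j S = pre ++ (((occ I.y I.m j σ).take (s.reg r_c)).reverse.map some ++
      tokens I.x I.y I.m j (S.drop (s.reg r_s))) ∧
    s.reg r_s ≤ S.length ∧ s.reg r_c ≤ (occ I.y I.m j σ).length ∧
    (s.reg r_c ≠ 0 → s.reg r_key = σ * I.N + j) ∧
    IsPatience pre.reduceOption (s.arr a_pat) (s.reg r_len) ∧
    s.reg r_cap + pre.length = cap ∧ s.reg r_fuel + pre.length = fuel

/-- One entry of the work list costs one unit of fuel and `O(H)` steps. Row starts are entries of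
their own, so scanning rows without matches is paid for as well. -/
theorem tokenProg_wp {ζ : ℕ → ℕ} {s : Mem} (hC : I.Ctx ζ s) (hs : s.Bdd I.V) {i j : ℕ}
    (hj : j < I.N) (hjr : s.reg r_j = j) {S : List ℕ} (hS : s.reg r_rows = S.length)
    (hSa : ∀ t < S.length, s.arr a_rows t = S.getD t 0) (hSp : S.Pairwise (· < ·))
    (hSi : ∀ a ∈ S, a < I.n ∧ a / I.m = i) {cap fuel : ℕ} (hI : I.PairInv j S cap fuel s)
    (hc : pairCond.eval s ≠ 0) :
    Wp I.V 0 tokenProg (10 * I.H + 24)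
      (fun s' => I.PairInv j S cap fuel s' ∧ s'.reg r_fuel + 1 = s.reg r_fuel) s := by
  obtain ⟨pre, σ, h1, h2, h3, h4, h5, h6, h7⟩ := hI
  have hc' : s.reg r_fuel ≠ 0 ∧ s.reg r_cap ≠ 0 ∧ (s.reg r_c ≠ 0 ∨ s.reg r_s < S.length) := by
    simp only [pairCond, Expr.eval, Op.eval, hS] at hc
    refine ⟨fun h => hc (by simp [h]), fun h => hc (by simp [h]), ?_⟩
    by_contra hcon
    push Not at hcon
    exact hc (by simp [hcon.1, hcon.2])
  obtain ⟨c1, c2, c3⟩ := hc'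
  have hsubl : pre.reduceOption.Sublist (points I.x I.y I.m j S) := by
    rw [← tokens_reduceOption, h1, List.reduceOption_append]
    exact List.sublist_append_left _ _
  -- The treated prefix already yields a genuine chain in the block pair, so the length stays at
  -- most `n < 2 ^ H` and `H` rounds of binary search suffice.
  have hlen : s.reg r_len ≤ I.n :=
    (h5.le_lcs_block I.m_pos hsubl hSp (fun a ha => by rw [I.input.length_x]; exact hSi a ha)).trans
      ((lcs_le_length_left _ _).trans ((block_length_le _ _ _).trans I.m_le_n))
  have hlV : s.reg r_len + s.reg r_len + 1 ≤ I.V := by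
    have h := I.lt_pow
    have h' : 2 ^ (I.H + 1) ≤ I.V := I.pow_le_V (by omega)
    rw [pow_succ] at h'
    omega
  have hHV : I.H ≤ I.V := I.H_lt.le.trans (I.pow_le_V (by omega))
  have hf := hs.1 r_fuel
  have hcp := hs.1 r_cap
  unfold tokenProg
  refine Wp.mono (c := (10 * I.H + 15 + 2 + 2) + 1 + 2 + 2)
    (Wp.assign_zero_seq hs (by simp [Expr.eval, Op.eval]; omega) fun hs1 =>
      Wp.assign_zero_seq hs1 (by simp [Expr.eval, Op.eval]; omega) fun hs2 => ?_)
    (fun _ _ _ h => h) (by omega)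
  refine Wp.ite hs2 (fun hc => ?_) (fun hc => ?_)
  · have hcn : s.reg r_c ≠ 0 := by simpa [Expr.eval] using hc
    have hcV := hs.1 r_c
    refine Wp.assign_zero_seq hs2 (by simp [Expr.eval, Op.eval]; omega) fun hs3 =>
      Wp.assign_zero_seq hs3 (hs3.2 _ _) fun hs4 => ?_
    obtain ⟨c', hc'⟩ : ∃ c', s.reg r_c = c' + 1 := ⟨s.reg r_c - 1, by omega⟩
    have hkey := h4 hcn
    have hcell := hC.cell σ j hj c' (by omega)
    have hm := hC.m
    refine (insertProg_wp (V := I.V) (w := 0) (H := I.H) (len := s.reg r_len)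
      (b := (occ I.y I.m j σ).getD c' 0) (bs := pre.reduceOption) hs4 ?_ ?_ ?_ ?_ hHV hlV ?_).mono
      ?_ le_rfl
    · simpa [Expr.eval] using hC.H
    · simp [Expr.eval]
    · simp [Expr.eval, Op.eval, hc', hkey, hm]
      simpa using hcell
    · exact lt_of_le_of_lt hlen I.lt_pow
    · simpa using h5
    · intro s' _ hF hP
      have g1 := hF.1 r_c (by decide)
      have g2 := hF.1 r_s (by decide)
      have g3 := hF.1 r_key (by decide)
      have g4 := hF.1 r_cap (by decide)
      have g5 := hF.1 r_fuel (by decide)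
      simp [Expr.eval, Op.eval, hc'] at g1 g2 g3 g4 g5
      refine ⟨⟨pre ++ [some ((occ I.y I.m j σ).getD c' 0)], σ, ?_, ?_, ?_, ?_, ?_, ?_, ?_⟩, ?_⟩
      -- The reversed list of the first `c' + 1` occurrences starts with occurrence number `c'`, the
      -- one just read.
      · rw [h1, g1, g2, hc', List.take_succ_eq_append_getElem (by omega), List.reverse_append,
          List.getD_eq_getElem _ _ (by omega)]
        simp
      · rw [g2]; exact h2
      · rw [g1]; omega
      · intro _; rw [g3]; exact hkey
      · rw [List.reduceOption_append]
        simpa [List.reduceOption] using hP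
      · rw [g4]; simp; omega
      · rw [g5]; simp; omega
      · rw [g5]; omega
  · have hc0 : s.reg r_c = 0 := by simpa [Expr.eval] using hc
    have hts : s.reg r_s < S.length := by
      rcases c3 with h | h
      · exact absurd hc0 h
      · exact h
    have hsa := hSa _ hts
    have hx := hC.x
    have hN := hC.N
    have hev : (.read a_x (.read a_rows (!ₑr_s)) *ₑ !ₑr_N +ₑ !ₑr_j : Expr).eval
        ((s.setReg r_fuel ((!ₑr_fuel -ₑ §1).eval s)).setReg r_cap
          ((!ₑr_cap -ₑ §1).eval (s.setReg r_fuel ((!ₑr_fuel -ₑ §1).eval s)))) =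
        I.x.getD (S.getD (s.reg r_s) 0) 0 * I.N + j := by
      simp [Expr.eval, Op.eval, hx, hN, hjr, hsa]
    refine Wp.mono (c := 1 + 2 + 2) (Wp.assign_zero_seq hs2 (by
      rw [hev]; exact I.key_le_V (I.getD_x_le _) hj.le) fun hs3 =>
      Wp.assign_zero_seq hs3 (hs3.2 _ _) fun hs4 => Wp.assign_zero hs4 ?_ ?_)
      (fun _ _ _ h => h) (by omega)
    · have h8 : S.length ≤ I.V := hS ▸ hs.1 r_rows
      simp [Expr.eval, Op.eval]; omega
    · rw [hev]
      set τ := I.x.getD (S.getD (s.reg r_s) 0) 0 with hτ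
      have hcnt := hC.cnt τ j hj
      -- Opening a row consumes its marker and makes all its occurrences pending.
      refine ⟨⟨pre ++ [none], τ, ?_, ?_, ?_, ?_, ?_, ?_, ?_⟩, ?_⟩
      · have ht : tokens I.x I.y I.m j (S.drop (s.reg r_s)) =
            none :: ((occ I.y I.m j τ).reverse.map some) ++
              tokens I.x I.y I.m j (S.drop (s.reg r_s + 1)) := by
          rw [List.drop_eq_getElem_cons hts, hτ, List.getD_eq_getElem _ _ hts]
          simp only [tokens, List.flatMap_cons]
        rw [h1, hc0, ht]
        simp [Expr.eval, Op.eval, hcnt, List.take_of_length_le]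
      · simp [Expr.eval, Op.eval]; omega
      · simp [Expr.eval, hcnt]
      · simp
      · rw [List.reduceOption_append]
        simpa [List.reduceOption] using h5
      · simp [Expr.eval, Op.eval]; omega
      · simp [Expr.eval, Op.eval]; omega
      · simp [Expr.eval, Op.eval]; omega

/-- The upper bound by the LCS holds even if the loop is cut off. The lower bound by the sampled
chain needs that neither fuel nor cap stops the loop early. Fuel use is bounded both by the work
list and by the cap, because level `0` is charged by the former and later levels by the latter. -/
theorem pairProg_wp {ζ : ℕ → ℕ} {s : Mem} {w : ℕ} (hw : 10 * I.H + 25 ≤ w) (hC : I.Ctx ζ s)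
    (hs : s.Bdd I.V) {i j : ℕ}
    (hj : j < I.N) (hjr : s.reg r_j = j) {S : List ℕ} (hS : s.reg r_rows = S.length)
    (hSa : ∀ t < S.length, s.arr a_rows t = S.getD t 0) (hSp : S.Pairwise (· < ·))
    (hSi : ∀ a ∈ S, a < I.n ∧ a / I.m = i) :
    Wp I.V w pairProg 9
      (fun s' => s'.reg r_fuel ≤ s.reg r_fuel ∧
        s.reg r_fuel ≤ s'.reg r_fuel + (tokens I.x I.y I.m j S).length ∧
        s.reg r_fuel ≤ s'.reg r_fuel + s.reg r_capv ∧
        s'.reg r_len ≤ lcs (block I.m I.x i) (block I.m I.y j) ∧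
        (s'.reg r_fuel ≠ 0 → (tokens I.x I.y I.m j S).length ≤ s.reg r_capv →
          ∀ c, IsBlockChain I.m I.x I.y i j c →
            (c.filter fun p => p.1 ∈ S).length ≤ s'.reg r_len)) s := by
  unfold pairProg
  refine Wp.assign_seq hs (Nat.zero_le _) (by decide) fun hs1 =>
    Wp.assign_seq hs1 (Nat.zero_le _) (by decide) fun hs2 =>
    Wp.assign_seq hs2 (Nat.zero_le _) (by decide) fun hs3 =>
    Wp.assign_seq hs3 (hs3.1 _) (by decide) fun hs4 => ?_
  refine (Wp.while_fuel (V := I.V) (w := w) (c := 10 * I.H + 24)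
    (I.PairInv j S (s.reg r_capv) (s.reg r_fuel)) hw hs4 ?_ ?_).mono ?_ le_rfl
  · refine ⟨[], 0, ?_, ?_, ?_, ?_, ?_, ?_, ?_⟩ <;> simp [Expr.eval]
    exact isPatience_nil _
  · intro s' hs' hF hI hc
    have hC' : I.Ctx ζ s' := by
      refine Ctx.frame (p := pairProg) hC ⟨fun v hv => ?_, fun a ha => ?_⟩ (by decide) (by decide)
      · simp [pairProg, Prog.regs] at hv
        rw [hF.1 v hv.2.2.2.2]
        simp [hv.1, hv.2.1, hv.2.2.1, hv.2.2.2.1]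
      · simp [pairProg, Prog.arrs] at ha
        rw [hF.2 a ha]
        simp
    refine tokenProg_wp hC' hs' hj ?_ ?_ ?_ hSp hSi hI hc
    · rw [hF.1 r_j (by decide)]; simpa [Expr.eval] using hjr
    · rw [hF.1 r_rows (by decide)]; simpa [Expr.eval] using hS
    · rw [hF.2 a_rows (by decide)]; simpa [Expr.eval] using hSa
  · rintro s' - hF ⟨⟨pre, σ, h1, h2, h3, h4, h5, h6, h7⟩, hz⟩
    have hlenW := congrArg List.length h1
    rw [List.length_append] at hlenW
    have hsubl : pre.reduceOption.Sublist (points I.x I.y I.m j S) := by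
      rw [← tokens_reduceOption, h1, List.reduceOption_append]
      exact List.sublist_append_left _ _
    refine ⟨by omega, by omega, by omega, h5.le_lcs_block I.m_pos hsubl hSp
      (fun a ha => by rw [I.input.length_x]; exact hSi a ha), fun hf hW c hc => ?_⟩
    -- With fuel left, either the cap is used up, and then the treated prefix is as long as the
    -- whole work list, or no entry is pending.
    have hfull : points I.x I.y I.m j S = pre.reduceOption := by
      rw [← tokens_reduceOption]
      congr 1
      by_cases hcap : s'.reg r_cap = 0
      · have : pre.length = (tokens I.x I.y I.m j S).length := by omega
        exact (List.IsPrefix.eq_of_length ⟨_, h1.symm⟩ this).symm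
      · have hrows : s'.reg r_rows = S.length := by
          rw [hF.1 r_rows (by decide)]; simpa [Expr.eval] using hS
        simp only [pairCond, Expr.eval, Op.eval, hrows] at hz
        have hz' : s'.reg r_c = 0 ∧ ¬ s'.reg r_s < S.length := by
          simpa [hf, hcap] using hz
        rw [h1, hz'.1, List.drop_eq_nil_of_le (by omega)]
        simp [tokens]
    rw [← hfull] at h5
    exact h5.length_filter_le hSp hc

end Setup

end LCSApprox

/-! ### The cascade of sampled tests in one block row -/

namespace LCSApprox

namespace Setup

/-- A tape together with the round and the parameters of a run. -/
structure Run (I : Setup) where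
  ζ : ℕ → ℕ
  g : ℕ
  u : ℕ
  v : ℕ
  w : ℕ
  g_lt : g < I.G * I.H
  u_le : u ≤ I.H
  v_le : v ≤ I.H
  w_lt : w < 3 * I.H + 7
  tape_lt : ∀ t < I.G * I.H * (2 * I.n), ζ t < 2 ^ I.H

namespace Run

variable {I : Setup} (r : I.Run)

/-- The tape of the current round. -/
def z (a : ℕ) : ℕ := r.ζ (r.g * (2 * I.n) + a)

/-- The rows of block `i` selected at rate `1 / d`. -/
noncomputable def rows (i d : ℕ) : List ℕ := rowsBelow I.n I.m i (fun a => r.z a * d < 2 ^ I.H) I.m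

/-- The work list of the block pair `(i, j)` at rate `1 / d`. -/
noncomputable def work (i j d : ℕ) : List (Option ℕ) := tokens I.x I.y I.m j (r.rows i d)

/-- Bound for the amount of work on one block pair at rate `1 / d`. -/
noncomputable def cap (d : ℕ) : ℕ := 64 * I.H * ((I.m + 2 ^ r.w) / d + 1)

/-- The value a block pair needs in order to be treated at level `k`. -/
def thr (k : ℕ) : ℕ := 128 * (2 ^ k / 2)

/-- The LCS of the block pair `(i, j)`. -/
noncomputable def blcs (I : Setup) (i j : ℕ) : ℕ := lcs (block I.m I.x i) (block I.m I.y j)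

/-- Bound for the fuel used by the block pair `(i, j)` at level `k`. -/
noncomputable def pairUse (i j k : ℕ) : ℕ :=
  if k = 0 then (r.work i j (2 ^ r.u)).length
  else if thr k ≤ blcs I i j then r.cap (2 ^ (r.u - k)) else 0

/-- Block `i` is selected. -/
def Sel (i : ℕ) : Prop := r.z (I.n + i) * 2 ^ r.v < 2 ^ I.H

instance (i : ℕ) : Decidable (r.Sel i) := by unfold Sel; infer_instance

/-- Bound for the fuel used by block `i`. -/
noncomputable def rowUse (i : ℕ) : ℕ :=
  if r.Sel i then ∑ k ∈ Finset.range (r.u + 1), ∑ j ∈ Finset.range I.N, r.pairUse i j k else 0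

/-- The number of points of the chain `c` selected at rate `1 / d`. -/
noncomputable def hits (i : ℕ) (c : List (ℕ × ℕ)) (d : ℕ) : ℕ :=
  (c.filter fun p => p.1 ∈ r.rows i d).length

/-- The block pair `(i, j)` with chain `c` passes all tests. -/
def Good (i j : ℕ) (c : List (ℕ × ℕ)) : Prop :=
  (∀ k ≤ r.u, (r.work i j (2 ^ (r.u - k))).length ≤ r.cap (2 ^ (r.u - k))) ∧
    ∀ k < r.u, thr (k + 1) ≤ r.hits i c (2 ^ (r.u - k))

/-- The memory during the run. -/
structure Ctx (s : Mem) : Prop where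
  base : I.Ctx r.ζ s
  g : s.reg r_g = r.g
  u : s.reg r_u = r.u
  v : s.reg r_v = r.v
  w : s.reg r_w = r.w

variable {r}

theorem Ctx.frame {s s' : Mem} {p : Prog} (h : r.Ctx s) (hF : Frame p s s')
    (hr : ∀ v ∈ [0, 1, 3, 4, 5, 6, 10, 11, 12, 13], v ∉ p.regs)
    (ha : ∀ a ∈ [0, 2, 3, 4, 5], a ∉ p.arrs) : r.Ctx s' := by
  refine ⟨h.base.frame hF (fun v hv => hr v ?_) ha, ?_, ?_, ?_, ?_⟩
  · simp at hv ⊢; omega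
  · rw [hF.1 _ (hr _ (by simp)), h.g]
  · rw [hF.1 _ (hr _ (by simp)), h.u]
  · rw [hF.1 _ (hr _ (by simp)), h.v]
  · rw [hF.1 _ (hr _ (by simp)), h.w]

theorem Ctx.setReg {s : Mem} (h : r.Ctx s) {v a : ℕ}
    (hv : v ∉ [0, 1, 3, 4, 5, 6, 10, 11, 12, 13]) : r.Ctx (s.setReg v a) := by
  refine h.frame (p := .assign v (.const 0)) ⟨fun x hx => ?_, fun _ _ => rfl⟩ ?_ ?_
  · simp only [Prog.regs, List.mem_singleton] at hx; simp [hx]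
  · intro x hx hx'
    simp only [Prog.regs, List.mem_singleton] at hx'
    exact hv (hx' ▸ hx)
  · simp [Prog.arrs]

theorem two_mul_n_lt_V (I : Setup) : 2 * I.n < I.V := by
  have h := I.lt_pow
  have h' : 2 ^ (I.H + 1) ≤ I.V := I.pow_le_V (by omega)
  rw [pow_succ] at h'
  omega

theorem rowsProg_wp {s : Mem} (hs : s.Bdd I.V) (hC : r.Ctx s) {i d w : ℕ} (hi : s.reg r_i = i)
    (hiN : i < I.N) (hd : s.reg r_d = d) :
    Wp I.V w rowsProg (9 * I.m + 5)
      (fun s' => s'.reg r_rows = (r.rows i d).length ∧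
        ∀ t < (r.rows i d).length, s'.arr a_rows t = (r.rows i d).getD t 0) s := by
  have hV := two_mul_n_lt_V I
  have him : i * I.m + I.m ≤ 2 * I.n := by
    have h1 : (i + 1) * I.m ≤ I.N * I.m := Nat.mul_le_mul_right _ hiN
    have := I.N_mul_m_le
    rw [Nat.succ_mul] at h1
    omega
  have hmn := I.m_le_n
  unfold rowsProg
  refine Wp.assign_seq hs (Nat.zero_le _) (by decide) fun hs1 => ?_
  set L : ℕ → List ℕ := fun k => rowsBelow I.n I.m i (fun a => r.z a * d < 2 ^ I.H) k with hL
  have hsucc : ∀ a, L (a + 1) = L a ++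
      (if i * I.m + a < I.n ∧ r.z (i * I.m + a) * d < 2 ^ I.H then [i * I.m + a] else []) := by
    intro a
    simp only [hL, rowsBelow, List.range_succ, List.map_append, List.filter_append]
    congr 1
    simp only [List.map_cons, List.map_nil, List.filter_cons, List.filter_nil, decide_eq_true_eq]
  have hlen : ∀ a, (L a).length ≤ a := by
    intro a
    refine (List.length_filter_le _ _).trans ?_
    simp
  refine (Wp.forLoop (V := I.V) (w := w) (c := 6) (k := I.m)
    (fun a s' => s'.reg r_rows = (L a).length ∧
      ∀ t < (L a).length, s'.arr a_rows t = (L a).getD t 0) hs1 (by decide) (by decide)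
    (by omega) ?_ ?_ ?_).mono ?_ le_rfl
  · intro s' hF
    have := hF.1 r_m (by decide)
    simpa [Expr.eval, hC.base.m] using this
  · simp [L, rowsBelow, Expr.eval]
  · rintro a s' ha hs' hF har ⟨h1, h2⟩
    have e0 : s'.reg r_n = I.n := by
      rw [hF.1 r_n (by decide)]; simpa using hC.base.n
    have e1 : s'.reg r_m = I.m := by
      rw [hF.1 r_m (by decide)]; simpa using hC.base.m
    have e2 : s'.reg r_i = i := by
      rw [hF.1 r_i (by decide)]; simpa using hi
    have e3 : s'.reg r_d = d := by
      rw [hF.1 r_d (by decide)]; simpa using hd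
    have e4 : s'.reg r_Q = 2 ^ I.H := by
      rw [hF.1 r_Q (by decide)]; simpa using hC.base.Q
    have e5 : s'.reg r_g = r.g := by
      rw [hF.1 r_g (by decide)]; simpa using hC.g
    have e6 : s'.arr a_tape = r.ζ := by
      rw [hF.2 a_tape (by decide)]; simpa using hC.base.tape
    have hev : (!ₑr_i *ₑ !ₑr_m +ₑ !ₑr_a : Expr).eval s' = i * I.m + a := by
      simp [Expr.eval, Op.eval, e1, e2, har]
    refine Wp.assign_seq (c := 4) hs' (by rw [hev]; omega) (by decide) fun hs2 => ?_
    rw [hev] at hs2 ⊢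
    refine Wp.ite (c := 3) hs2 (fun hc => ?_) (fun hc => ?_)
    · have hcond : i * I.m + a < I.n ∧ r.z (i * I.m + a) * d < 2 ^ I.H := by
        simp only [Expr.eval, Op.eval, Mem.setReg_reg, Mem.setReg_arr, e6] at hc
        by_contra hcon
        rw [not_and_or] at hcon
        rcases hcon with h | h <;> simp [e0, e3, e4, e5, z] at hc h <;> omega
      refine Wp.store_seq (c := 1) hs2 (hs2.1 _) fun hs3 => Wp.assign hs3 ?_ (by decide) ?_
      · have := hlen a
        simp [Expr.eval, Op.eval, h1]; omega
      · rw [hsucc, if_pos hcond]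
        simp only [Mem.setReg_reg, Mem.setReg_arr, Mem.setArr_arr, Mem.setArr_reg, Expr.eval,
          Op.eval]
        norm_num [h1]
        intro t ht
        rw [Function.update_apply]
        split
        · rename_i h; subst h; simp
        · have ht' : t < (L a).length := by omega
          rw [h2 t ht', List.getElem?_append_left ht', List.getD_eq_getElem?_getD]
    · have hcond : ¬ (i * I.m + a < I.n ∧ r.z (i * I.m + a) * d < 2 ^ I.H) := by
        rintro ⟨g1, g2⟩
        unfold z at g2
        simp [Expr.eval, Op.eval, e0, e3, e4, e5, e6, g1, g2] at hc
      refine (Wp.skip hs2 ?_).mono (fun _ _ _ h => h) (by norm_num)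
      rw [hsucc, if_neg hcond]
      simp only [Mem.setReg_reg, Mem.setReg_arr, List.append_nil]
      norm_num [h1]
      simpa using h2
  · rintro s' - - ⟨h, -⟩
    exact h

theorem blcs_le_n (I : Setup) (i j : ℕ) : blcs I i j ≤ I.n :=
  (lcs_le_length_left _ _).trans ((block_length_le _ _ _).trans I.m_le_n)

theorem cap_le_V (r : I.Run) (d : ℕ) : r.cap d ≤ I.V := by
  unfold cap
  have h1 : (I.m + 2 ^ r.w) / d ≤ I.m + 2 ^ r.w := Nat.div_le_self _ _
  have h2 : 2 ^ r.w ≤ 2 ^ (3 * I.H + 7) := Nat.pow_le_pow_right (by norm_num) r.w_lt.le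
  have h3 : I.m ≤ 2 ^ (3 * I.H + 7) :=
    (I.m_le_n.trans I.lt_pow.le).trans (Nat.pow_le_pow_right (by norm_num) (by omega))
  have h4 : 1 ≤ 2 ^ (3 * I.H + 7) := Nat.one_le_two_pow
  have h5 : 64 * I.H * ((I.m + 2 ^ r.w) / d + 1) ≤ 64 * 2 ^ I.H * (4 * 2 ^ (3 * I.H + 7)) :=
    Nat.mul_le_mul (Nat.mul_le_mul_left _ I.H_lt.le) (by omega)
  have h6 : 64 * 2 ^ I.H * (4 * 2 ^ (3 * I.H + 7)) = 2 ^ (4 * I.H + 15) := by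
    have : (64 : ℕ) = 2 ^ 6 := by norm_num
    rw [this, show (4 : ℕ) = 2 ^ 2 by norm_num, ← pow_add, ← pow_add, ← pow_add]
    congr 1; ring
  rw [h6] at h5
  exact I.le_V_of_le h5 (by omega)

/-- The state of the values of block row `i` before level `k`, with `fuel` the fuel at the start of
the row and `ch` the chains of the pairs. -/
structure LevelInv (r : I.Run) (i : ℕ) (ch : ℕ → List (ℕ × ℕ)) (fuel k : ℕ) (s : Mem) : Prop where
  le_lcs : ∀ j < I.N, s.arr a_val j ≤ blcs I i j
  fuel_le : s.reg r_fuel ≤ fuel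
  le_fuel : fuel ≤ s.reg r_fuel +
    ∑ k' ∈ Finset.range k, ∑ j ∈ Finset.range I.N, r.pairUse i j k'
  good : s.reg r_fuel ≠ 0 → ∀ j < I.N, IsBlockChain I.m I.x I.y i j (ch j) → r.Good i j (ch j) →
    0 < k → r.hits i (ch j) (2 ^ (r.u - (k - 1))) ≤ s.arr a_val j

theorem thr_le_V {k : ℕ} (I : Setup) (hk : k ≤ I.H) : thr k ≤ I.V := by
  unfold thr
  have h1 : 2 ^ k / 2 ≤ 2 ^ I.H :=
    (Nat.div_le_self _ _).trans (Nat.pow_le_pow_right (by norm_num) hk)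
  have h2 : 128 * (2 ^ k / 2) ≤ 2 ^ (7 + I.H) := by
    rw [pow_add]; exact Nat.mul_le_mul (by norm_num) h1
  exact I.le_V_of_le h2 (by omega)

/-- The columns left of `j` satisfy the claim for the new level, those from `j` on still hold the
values of the previous one. -/
theorem levelProg_wp {s : Mem} {w : ℕ} (hw : 10 * I.H + 25 ≤ w) (hs : s.Bdd I.V) (hC : r.Ctx s)
    {i k : ℕ} (hi : s.reg r_i = i) (hiN : i < I.N) (hk : s.reg r_k = k) (hku : k ≤ r.u)
    {ch : ℕ → List (ℕ × ℕ)} {fuel : ℕ} (hI : r.LevelInv i ch fuel k s) :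
    Wp I.V w levelProg (9 * I.m + 15 * I.N + 15) (r.LevelInv i ch fuel (k + 1)) s := by
  have huH := r.u_le
  have hwH := r.w_lt
  set d := 2 ^ (r.u - k) with hd
  unfold levelProg
  refine Wp.mono (c := ((9 * I.m + 5) + (((12 + 3) * I.N + 3) + 2 + 2) + 1) + 2)
    (Wp.assign_seq hs (hs.2 _ _) (by decide) fun hs1 => ?_) (fun _ _ _ h => h) (by omega)
  have hev : (.read a_pow (!ₑr_u -ₑ !ₑr_k) : Expr).eval s = d := by
    simp only [Expr.eval, Op.eval, hC.u, hk]
    exact hC.base.pow _ (by omega)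
  rw [hev] at hs1 ⊢
  have hC1 : r.Ctx (s.setReg r_d d) := hC.setReg (by decide)
  refine Wp.seq (rowsProg_wp (i := i) (d := d) hs1 hC1 (by simpa using hi) hiN (by simp))
    fun s2 hs2 hF2 ⟨hr1, hr2⟩ => ?_
  have hC2 : r.Ctx s2 := hC1.frame hF2 (by decide) (by decide)
  have k2 : s2.reg r_k = k := by rw [hF2.1 r_k (by decide)]; simpa using hk
  have d2 : s2.reg r_d = d := by rw [hF2.1 r_d (by decide)]; simp
  have v2 : s2.arr a_val = s.arr a_val := by rw [hF2.2 a_val (by decide)]; simp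
  have f2 : s2.reg r_fuel = s.reg r_fuel := by rw [hF2.1 r_fuel (by decide)]; simp
  have i2 : s2.reg r_i = i := by rw [hF2.1 r_i (by decide)]; simpa using hi
  have hevth : (§128 *ₑ (.read a_pow (!ₑr_k) /ₑ §2) : Expr).eval s2 = thr k := by
    simp only [Expr.eval, Op.eval, k2, thr]
    rw [hC2.base.pow k (by omega)]
  refine Wp.assign_seq hs2 (by rw [hevth]; exact thr_le_V I (by omega)) (by decide) fun hs3 => ?_
  rw [hevth] at hs3 ⊢
  have hevcap : (§64 *ₑ !ₑr_H *ₑ ((!ₑr_m +ₑ .read a_pow (!ₑr_w)) /ₑ !ₑr_d +ₑ §1) : Expr).eval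
      (s2.setReg r_th (thr k)) = r.cap d := by
    simp [Expr.eval, Op.eval, hC2.base.H, hC2.base.m, d2, hC2.w, cap,
      hC2.base.pow r.w (by omega)]
  refine Wp.assign_seq hs3 (by rw [hevcap]; exact r.cap_le_V d) (by decide) fun hs4 => ?_
  rw [hevcap] at hs4 ⊢
  have hC4 : r.Ctx ((s2.setReg r_th (thr k)).setReg r_capv (r.cap d)) :=
    (hC2.setReg (by decide)).setReg (by decide)
  set s4 := (s2.setReg r_th (thr k)).setReg r_capv (r.cap d) with hs4def
  refine (Wp.forLoop (V := I.V) (w := w) (c := 12) (k := I.N)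
    (fun j s' => (∀ j' < I.N, s'.arr a_val j' ≤ blcs I i j') ∧
      s'.reg r_fuel ≤ s.reg r_fuel ∧
      s.reg r_fuel ≤ s'.reg r_fuel + ∑ j' ∈ Finset.range j, r.pairUse i j' k ∧
      (s'.reg r_fuel ≠ 0 → ∀ j' < j, IsBlockChain I.m I.x I.y i j' (ch j') →
        r.Good i j' (ch j') → r.hits i (ch j') d ≤ s'.arr a_val j') ∧
      ∀ j', j ≤ j' → s'.arr a_val j' = s.arr a_val j')
    hs4 (by decide) (by decide) (I.N_le_n.trans (by have := I.n_lt_V; omega)) ?_ ?_ ?_).mono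
    ?_ (by omega)
  · intro s' hF
    have := hF.1 r_N (by decide)
    simpa [Expr.eval, hC4.base.N] using this
  · simp only [hs4def, Mem.setReg_reg, Mem.setReg_arr, v2]
    norm_num [f2]
    exact hI.le_lcs
  · rintro j s5 hj hs5 hF5 j5 ⟨h1, h2, h3, h4, h5⟩
    have hC5 : r.Ctx s5 := hC4.frame hF5 (by decide) (by decide)
    have th5 : s5.reg r_th = thr k := by rw [hF5.1 r_th (by decide)]; simp [s4]
    have cap5 : s5.reg r_capv = r.cap d := by rw [hF5.1 r_capv (by decide)]; simp [s4]
    have rows5 : s5.reg r_rows = (r.rows i d).length := by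
      rw [hF5.1 r_rows (by decide)]; simpa [s4] using hr1
    have rows5' : s5.arr a_rows = s2.arr a_rows := by
      rw [hF5.2 a_rows (by decide)]; simp [s4]
    have hval : s5.arr a_val j = s.arr a_val j := h5 j le_rfl
    refine Wp.ite (c := 11) hs5 (fun hc => ?_) (fun hc => ?_)
    · have hlt : s.arr a_val j < thr k := by
        by_contra hcon
        simp [Expr.eval, Op.eval, th5, j5, hval, hcon] at hc
      refine (Wp.store hs5 (Nat.zero_le _) ?_).mono (fun _ _ _ h => h) (by norm_num)
      have ej : (!ₑr_j : Expr).eval s5 = j := j5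
      rw [ej]
      simp only [Mem.setReg_reg, Mem.setArr_reg, Mem.setReg_arr, Mem.setArr_arr, if_true]
      norm_num
      refine ⟨fun j' hj' => ?_, h2, ?_, fun hf j' hj' hch hg => ?_, fun j' hj' => ?_⟩
      · rw [Function.update_apply]; split
        · exact Nat.zero_le _
        · exact h1 j' hj'
      · rw [Finset.sum_range_succ]; omega
      · rw [Function.update_apply]
        split
        · rename_i hjj
          subst hjj
          -- A good pair is never erased: its value is at least the number of hits at the previous
          -- level, which reaches the threshold. At level `0` the threshold is `0`.
          exfalso
          have hk0 : 0 < k := by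
            by_contra h0
            obtain rfl : k = 0 := by omega
            simp [thr] at hlt
          have hgood := hI.good (by omega) j' hj hch hg hk0
          have hth := hg.2 (k - 1) (by omega)
          rw [show k - 1 + 1 = k by omega] at hth
          omega
        · exact h4 hf j' (by omega) hch hg
      · rw [Function.update_apply, if_neg (by omega)]
        exact h5 j' (by omega)
    · have hge : thr k ≤ s.arr a_val j := by
        by_contra hcon
        have : s.arr a_val j < thr k := by omega
        simp [Expr.eval, Op.eval, th5, j5, hval, this] at hc
      refine Wp.mono (c := 9 + 1 + 1) (Wp.seq (pairProg_wp (i := i) (S := r.rows i d) hw hC5.base hs5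
        hj j5 rows5 (by rw [rows5']; exact hr2) (rowsBelow_pairwise _ _ _ _ _) ?_) ?_)
        (fun _ _ _ h => h) le_rfl
      · intro a ha
        have := (mem_rowsBelow I.m_pos).1 ha
        exact ⟨this.1, this.2.1⟩
      · rintro s6 hs6 hF6 ⟨g1, g2, g3, g4, g5⟩
        rw [cap5] at g3 g5
        have v6 : s6.arr a_val = s5.arr a_val := hF6.2 a_val (by decide)
        have j6 : s6.reg r_j = j := by rw [hF6.1 r_j (by decide)]; exact j5
        refine Wp.store hs6 (hs6.1 _) ?_
        have ej : (!ₑr_j : Expr).eval s6 = j := j6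
        have el : (!ₑr_len : Expr).eval s6 = s6.reg r_len := rfl
        rw [ej, el]
        simp only [Mem.setReg_reg, Mem.setArr_reg, Mem.setReg_arr, Mem.setArr_arr, if_true, v6]
        norm_num
        refine ⟨fun j' hj' => ?_, by omega, ?_, fun hf j' hj' hch hg => ?_, fun j' hj' => ?_⟩
        · rw [Function.update_apply]; split
          · rename_i h; subst h; exact g4
          · exact h1 j' hj'
        · rw [Finset.sum_range_succ]
          -- Level `0` is charged by the work list. At later levels the cap applies, and since
          -- values never exceed the LCS, the LCS reaches the threshold too, as `pairUse` demands.
          have huse : s5.reg r_fuel ≤ s6.reg r_fuel + r.pairUse i j k := by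
            unfold pairUse
            split
            · rename_i hk0
              subst hk0
              exact g2
            · rw [if_pos (hge.trans (hI.le_lcs j hj))]
              exact g3
          omega
        · rw [Function.update_apply]
          split
          · rename_i hjj
            subst hjj
            exact g5 hf (hg.1 k hku) _ hch
          · exact h4 (by omega) j' (by omega) hch hg
        · rw [Function.update_apply, if_neg (by omega)]
          exact h5 j' (by omega)
  · rintro s7 - - ⟨⟨h1, h2, h3, h4, h5⟩, -⟩
    refine ⟨h1, h2.trans hI.fuel_le, ?_, fun hf j hj hch hg _ => ?_⟩
    · rw [Finset.sum_range_succ]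
      have := hI.le_fuel
      omega
    · rw [show k + 1 - 1 = k by omega]
      exact h4 hf j hj hch hg

end Run

end Setup

end LCSApprox

/-! ### The dynamic program over blocks -/

namespace LCSApprox

namespace Setup

namespace Run

variable {I : Setup} {r : I.Run}

/-- One row of the dynamic program over blocks. -/
def dpRow (e val : ℕ → ℕ) : ℕ → ℕ
  | 0 => 0
  | j + 1 => max (max (dpRow e val j) (e j + val j)) (e (j + 1))

/-- One array suffices: the old entry is saved before it is overwritten and serves as the diagonal
entry of the next column. -/
theorem dpProg_wp {s : Mem} {w : ℕ} (hs : s.Bdd I.V) (hN : s.reg r_N = I.N) {e val : ℕ → ℕ}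
    (he : s.arr a_best = e) (hv : s.arr a_val = val) (he0 : e 0 = 0)
    (hen : ∀ j ≤ I.N, e j ≤ I.n) (hvn : ∀ j < I.N, val j ≤ I.n) :
    Wp I.V w dpProg (16 * I.N + 7) (fun s' => ∀ j ≤ I.N, s'.arr a_best j = dpRow e val j) s := by
  have hV := two_mul_n_lt_V I
  unfold dpProg
  refine Wp.mono (c := (13 + 3) * I.N + 3 + 2 + 2) (Wp.assign_seq hs (Nat.zero_le _) (by decide)
    fun hs1 => Wp.assign_seq hs1 (Nat.zero_le _) (by decide) fun hs2 => ?_)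
    (fun _ _ _ h => h) (by omega)
  refine (Wp.forLoop (V := I.V) (w := w) (c := 13) (k := I.N)
    (fun j s' => s'.reg r_left = dpRow e val j ∧ s'.reg r_diag = e j ∧
      (∀ j' ≤ j, s'.arr a_best j' = dpRow e val j') ∧ ∀ j' > j, s'.arr a_best j' = e j')
    hs2 (by decide) (by decide) (I.N_le_n.trans (by omega)) ?_ ?_ ?_).mono ?_ le_rfl
  · intro s' hF
    have := hF.1 r_N (by decide)
    simpa [Expr.eval, hN] using this
  · simp [Expr.eval, dpRow, he, he0]
  · rintro j s' hj hs' hF hjr ⟨h1, h2, h3, h4⟩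
    have hv' : s'.arr a_val = val := by rw [hF.2 a_val (by decide)]; simpa using hv
    have hold := h4 (j + 1) (by omega)
    have b1 := hen j hj.le
    have b2 := hvn j hj
    refine Wp.assign_seq (c := 11) hs' (hs'.2 _ _) (by decide) fun hs3 =>
      Wp.assign_seq (c := 9) hs3 ?_ (by decide) fun hs4 => ?_
    · simp [Expr.eval, Op.eval, h2, hv', hjr]; omega
    have ev1 : (.read a_best (!ₑr_j +ₑ §1) : Expr).eval s' = e (j + 1) := by
      simpa [Expr.eval, Op.eval, hjr] using hold
    rw [ev1] at hs3 hs4 ⊢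
    have ev2 : (!ₑr_diag +ₑ .read a_val (!ₑr_j) : Expr).eval (s'.setReg r_old (e (j + 1))) =
        e j + val j := by
      simp [Expr.eval, Op.eval, h2, hv', hjr]
    rw [ev2] at hs4 ⊢
    refine Wp.seq (c := 2) (c' := 6)
      (R := fun s5 => s5.reg r_left = max (dpRow e val j) (e j + val j)) ?_ ?_
    · refine Wp.ite hs4 (fun hc => Wp.assign hs4 (hs4.1 _) (by decide) ?_)
        (fun hc => Wp.skip hs4 ?_)
      · simp [Expr.eval, Op.eval, h1] at hc ⊢; omega
      · simp [Expr.eval, Op.eval, h1] at hc ⊢; omega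
    intro s5 hs5 hF5 hl5
    have o5 : s5.reg r_old = e (j + 1) := by rw [hF5.1 r_old (by decide)]; simp
    have j5 : s5.reg r_j = j := by rw [hF5.1 r_j (by decide)]; simpa using hjr
    have a5 : s5.arr a_best = s'.arr a_best := by rw [hF5.2 a_best (by decide)]; simp
    refine Wp.seq (c := 2) (c' := 3) (R := fun s6 => s6.reg r_left = dpRow e val (j + 1)) ?_ ?_
    · refine Wp.ite hs5 (fun hc => Wp.assign hs5 (hs5.1 _) (by decide) ?_)
        (fun hc => Wp.skip hs5 ?_)
      · simp [Expr.eval, Op.eval, hl5, o5, dpRow] at hc ⊢; omega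
      · simp [Expr.eval, Op.eval, hl5, o5, dpRow] at hc ⊢; omega
    intro s6 hs6 hF6 hl6
    have o6 : s6.reg r_old = e (j + 1) := by rw [hF6.1 r_old (by decide)]; exact o5
    have j6 : s6.reg r_j = j := by rw [hF6.1 r_j (by decide)]; exact j5
    have a6 : s6.arr a_best = s'.arr a_best := by rw [hF6.2 a_best (by decide)]; exact a5
    refine Wp.store_seq (c := 1) hs6 (hs6.1 _) fun hs7 => Wp.assign hs7 (hs7.1 _) (by decide) ?_
    have ev3 : (!ₑr_j +ₑ §1 : Expr).eval s6 = j + 1 := by simp [Expr.eval, Op.eval, j6]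
    have ev4 : (!ₑr_left : Expr).eval s6 = dpRow e val (j + 1) := hl6
    rw [ev3, ev4]
    simp only [Mem.setReg_reg, Mem.setArr_reg, Mem.setReg_arr, Mem.setArr_arr, if_true, a6,
      Expr.eval]
    norm_num
    refine ⟨hl6, o6, fun j' hj' => ?_, fun j' hj' => ?_⟩
    · rw [Function.update_apply]
      split
      · rename_i h; rw [h]
      · exact h3 j' (by omega)
    · rw [Function.update_apply, if_neg (by omega)]
      exact h4 j' (by omega)
  · rintro s' - - ⟨⟨-, -, h, -⟩, -⟩
    exact h

open Classical in
/-- The pairs of `S` below `(i, j)` whose block is selected and that pass all tests. -/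
noncomputable def goodBelow (r : I.Run) (S : Finset (ℕ × ℕ)) (ch : ℕ → ℕ → List (ℕ × ℕ))
    (i j : ℕ) : Finset (ℕ × ℕ) :=
  S.filter fun p => p.1 < i ∧ p.2 < j ∧ r.Sel p.1 ∧ r.Good p.1 p.2 (ch p.1 p.2)

/-- Step of the lower bound for the dynamic program. -/
theorem card_goodBelow_le {S : Finset (ℕ × ℕ)} (hS : IsBlockSeq S) (ch : ℕ → ℕ → List (ℕ × ℕ))
    {i θ : ℕ} {e e' val : ℕ → ℕ} {N : ℕ} (he' : ∀ j ≤ N, e' j = dpRow e val j)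
    (he : ∀ j ≤ N, θ * (r.goodBelow S ch i j).card ≤ e j)
    (hval : r.Sel i → ∀ j < N, (i, j) ∈ S → r.Good i j (ch i j) → θ ≤ val j) :
    ∀ j ≤ N, θ * (r.goodBelow S ch (i + 1) j).card ≤ e' j := by
  classical
  intro j
  induction j with
  | zero =>
    intro _
    have : r.goodBelow S ch (i + 1) 0 = ∅ := by
      unfold goodBelow; exact Finset.filter_eq_empty_iff.2 (by simp)
    simp [this]
  | succ j ih =>
    intro hj
    have ih := ih (by omega)
    rw [he' _ (by omega)] at ih
    rw [he' _ hj, dpRow]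
    have hcmp : ∀ p ∈ S, ∀ q ∈ S, p ≠ q → (p.1 < q.1 ∧ p.2 < q.2) ∨ (q.1 < p.1 ∧ q.2 < p.2) :=
      fun p hp q hq hpq => hS hp hq hpq
    -- A block sequence has at most one pair in row `i`. It lies in column `j`, or further left, or
    -- is absent; these cases match the three terms of the maximum.
    by_cases h1 : (i, j) ∈ r.goodBelow S ch (i + 1) (j + 1)
    · have h1' := Finset.mem_filter.1 h1
      have hsub : r.goodBelow S ch (i + 1) (j + 1) ⊆ insert (i, j) (r.goodBelow S ch i j) := by
        intro p hp
        obtain ⟨p1, p2, p3, p4⟩ := Finset.mem_filter.1 hp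
        rw [Finset.mem_insert]
        by_cases hpe : p = (i, j)
        · exact Or.inl hpe
        · right
          have := hcmp p p1 (i, j) h1'.1 hpe
          exact Finset.mem_filter.2 ⟨p1, by simp only at this; omega, by simp only at this; omega, p4⟩
      have h2 := (Finset.card_le_card hsub).trans (Finset.card_insert_le _ _)
      have h3 := hval h1'.2.2.2.1 j (by omega) h1'.1 h1'.2.2.2.2
      have h4 := he j (by omega)
      have h5 := Nat.mul_le_mul_left θ h2
      rw [Nat.mul_add, Nat.mul_one] at h5
      have : θ * (r.goodBelow S ch (i + 1) (j + 1)).card ≤ e j + val j := by omega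
      exact this.trans ((le_max_right _ _).trans (le_max_left _ _))
    · by_cases h2 : ∃ j', (i, j') ∈ r.goodBelow S ch (i + 1) (j + 1)
      · obtain ⟨j', hj'⟩ := h2
        have hj'' := Finset.mem_filter.1 hj'
        have hne : j' ≠ j := by rintro rfl; exact h1 hj'
        have hsub : r.goodBelow S ch (i + 1) (j + 1) ⊆ r.goodBelow S ch (i + 1) j := by
          intro p hp
          obtain ⟨p1, p2, p3, p4⟩ := Finset.mem_filter.1 hp
          refine Finset.mem_filter.2 ⟨p1, p2, ?_, p4⟩
          by_cases hpe : p = (i, j')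
          · subst hpe; simp only at p3 ⊢; omega
          · have := hcmp p p1 (i, j') hj''.1 hpe
            have h6 := hj''.2.2.1
            simp only at this h6
            omega
        exact (Nat.mul_le_mul_left θ (Finset.card_le_card hsub)).trans
          (ih.trans ((le_max_left _ _).trans (le_max_left _ _)))
      · have hsub : r.goodBelow S ch (i + 1) (j + 1) ⊆ r.goodBelow S ch i (j + 1) := by
          intro p hp
          obtain ⟨p1, p2, p3, p4⟩ := Finset.mem_filter.1 hp
          refine Finset.mem_filter.2 ⟨p1, ?_, p3, p4⟩
          by_contra hcon
          have : p.1 = i := by omega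
          exact h2 ⟨p.2, by rw [show (i, p.2) = p from Prod.ext this.symm rfl]; exact hp⟩
        exact (Nat.mul_le_mul_left θ (Finset.card_le_card hsub)).trans
          ((he _ hj).trans (le_max_right _ _))

/-- Step of the upper bound for the dynamic program. -/
theorem dpRow_le_lcs {i : ℕ} {e val : ℕ → ℕ}
    (he : ∀ j ≤ I.N, e j ≤ lcs (I.x.take (i * I.m)) (I.y.take (j * I.m)))
    (hval : ∀ j < I.N, val j ≤ blcs I i j) :
    ∀ j ≤ I.N, dpRow e val j ≤ lcs (I.x.take ((i + 1) * I.m)) (I.y.take (j * I.m)) := by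
  intro j
  induction j with
  | zero => intro _; exact Nat.zero_le _
  | succ j ih =>
    intro hj
    have hx : (I.x.take (i * I.m)).Sublist (I.x.take ((i + 1) * I.m)) := by
      rw [take_succ_mul]; exact List.sublist_append_left _ _
    have hy : (I.y.take (j * I.m)).Sublist (I.y.take ((j + 1) * I.m)) := by
      rw [take_succ_mul]; exact List.sublist_append_left _ _
    rw [dpRow]
    refine max_le (max_le ?_ ?_) ?_
    · exact (ih (by omega)).trans (lcs_mono (List.Sublist.refl _) hy)
    · refine (Nat.add_le_add (he j (by omega)) (hval j (by omega))).trans ?_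
      rw [take_succ_mul, take_succ_mul]
      exact lcs_add_lcs_le _ _ _ _
    · exact (he _ hj).trans (lcs_mono hx (List.Sublist.refl _))

/-- Data that witness a lower bound for the result of a run. -/
structure Witness (I : Setup) where
  S : Finset (ℕ × ℕ)
  ch : ℕ → ℕ → List (ℕ × ℕ)
  θ : ℕ
  seq : IsBlockSeq S
  chain : ∀ p ∈ S, IsBlockChain I.m I.x I.y p.1 p.2 (ch p.1 p.2)
  le_length : ∀ p ∈ S, θ ≤ (ch p.1 p.2).length

/-- The state of the dynamic program before block `i`. -/
structure RowInv (r : I.Run) (W : Witness I) (fuel i : ℕ) (s : Mem) : Prop where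
  zero : s.arr a_best 0 = 0
  le_lcs : ∀ j ≤ I.N, s.arr a_best j ≤ lcs (I.x.take (i * I.m)) (I.y.take (j * I.m))
  le_fuel : fuel ≤ s.reg r_fuel + ∑ i' ∈ Finset.range i, r.rowUse i'
  good : s.reg r_fuel ≠ 0 →
    ∀ j ≤ I.N, W.θ * (r.goodBelow W.S W.ch i j).card ≤ s.arr a_best j

/-- All numbers on the tape of the round are below `2 ^ H`, so rate `1` selects every row. Hence the
last level credits a good pair with its full chain. -/
theorem hits_one (r : I.Run) {i j : ℕ} {c : List (ℕ × ℕ)}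
    (hc : IsBlockChain I.m I.x I.y i j c) : r.hits i c 1 = c.length := by
  unfold hits
  rw [List.length_filter_eq_length_iff.2]
  intro p hp
  have h1 := hc.1.2 p hp
  have h2 := hc.2 p hp
  rw [I.input.length_x] at h1
  simp only [decide_eq_true_eq]
  refine (mem_rowsBelow I.m_pos).2 ⟨h1.1, h2.1, ?_⟩
  rw [mul_one]
  refine r.tape_lt _ ?_
  have h3 : (r.g + 1) * (2 * I.n) ≤ I.G * I.H * (2 * I.n) := Nat.mul_le_mul_right _ r.g_lt
  rw [Nat.succ_mul] at h3
  omega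

/-- Correctness from above holds without condition; the lower bound is only claimed while fuel
remains, because a cut-off computation may miss points of a chain. -/
theorem rowProg_wp {s : Mem} {w : ℕ} (hw : 10 * I.H + 25 ≤ w) (hs : s.Bdd I.V) (hC : r.Ctx s)
    {i : ℕ} (hi : s.reg r_i = i) (hiN : i < I.N) {W : Witness I} {fuel : ℕ}
    (hI : r.RowInv W fuel i s) :
    Wp I.V w rowProg ((9 * I.m + 15 * I.N + 18) * (I.H + 1) + 20 * I.N + 16)
      (r.RowInv W fuel (i + 1)) s := by
  classical
  have huH := r.u_le
  have hvH := r.v_le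
  have hxl := I.input.length_x
  have hevc : (.read a_tape (!ₑr_g *ₑ (§2 *ₑ !ₑr_n) +ₑ !ₑr_n +ₑ !ₑr_i) *ₑ .read a_pow (!ₑr_v) <ₑ
      !ₑr_Q : Expr).eval s = if r.Sel i then 1 else 0 := by
    simp only [Expr.eval, Op.eval, hC.base.n, hC.base.Q, hC.base.tape, hC.g, hC.v, hi]
    rw [hC.base.pow _ (by omega)]
    simp only [Sel, z, Nat.add_assoc]
    exact if_congr Iff.rfl rfl rfl
  unfold rowProg
  refine Wp.mono (c := ((4 * I.N + 3) + (((9 * I.m + 15 * I.N + 15) + 3) * (r.u + 1) + 3 +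
    (16 * I.N + 7) + 1) + 1) + 1) (Wp.ite hs (fun hc => ?_) (fun hc => ?_)) (fun _ _ _ h => h) ?_
  · rw [hevc] at hc
    have hsel : r.Sel i := by by_contra h; simp [h] at hc
    refine Wp.seq (c := 4 * I.N + 3) (R := fun s' => ∀ j < I.N, s'.arr a_val j = 0) ?_ ?_
    · refine Wp.mono (Wp.forLoop (V := I.V) (w := w) (c := 1) (k := I.N)
        (fun j s' => ∀ j' < j, s'.arr a_val j' = 0) hs (by decide) (by decide)
        (I.N_le_n.trans (by have := I.n_lt_V; omega)) ?_ ?_ ?_) ?_ le_rfl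
      · intro s' hF
        have := hF.1 r_N (by decide)
        simpa [Expr.eval, hC.base.N] using this
      · simp
      · rintro j s' hj hs' hF hjr h
        refine Wp.store hs' (Nat.zero_le _) ?_
        simp only [Mem.setReg_arr, Mem.setArr_arr, if_true, Expr.eval, hjr]
        intro j' hj'
        rw [Function.update_apply]
        split
        · rfl
        · exact h j' (by omega)
      · rintro s' - - ⟨h, -⟩
        exact h
    · intro s1 hs1 hF1 hz
      have hC1 : r.Ctx s1 := hC.frame hF1 (by decide) (by decide)
      have i1 : s1.reg r_i = i := by rw [hF1.1 r_i (by decide)]; exact hi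
      have f1 : s1.reg r_fuel = s.reg r_fuel := hF1.1 r_fuel (by decide)
      have b1 : s1.arr a_best = s.arr a_best := hF1.2 a_best (by decide)
      refine Wp.seq (c := ((9 * I.m + 15 * I.N + 15) + 3) * (r.u + 1) + 3)
        (R := fun s' => r.LevelInv i (W.ch i) (s.reg r_fuel) (r.u + 1) s' ∧
          s'.arr a_best = s.arr a_best ∧ r.Ctx s') ?_ ?_
      · refine Wp.mono (Wp.forLoop (V := I.V) (w := w) (c := 9 * I.m + 15 * I.N + 15)
          (k := r.u + 1) (fun k s' => r.LevelInv i (W.ch i) (s.reg r_fuel) k s') hs1 (by decide)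
          (by decide) ?_ ?_ ?_ ?_) ?_ le_rfl
        · have := I.H_lt
          have := I.pow_le_V (k := I.H) (by omega)
          omega
        · intro s' hF
          have := hF.1 r_u (by decide)
          simp [Expr.eval, Op.eval, this, hC1.u]
        · refine ⟨fun j hj => ?_, ?_, ?_, ?_⟩
          · simp [hz j hj]
          · simp [f1]
          · simp [f1]
          · intro _ _ _ _ _ h; omega
        · intro k s' hk hs' hF hkr hL
          have hC' : r.Ctx s' := hC1.frame hF (by decide) (by decide)
          refine (levelProg_wp hw hs' hC' (by rw [hF.1 r_i (by decide)]; exact i1) hiN hkr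
            (by omega) hL).mono ?_ le_rfl
          rintro s'' - - ⟨h1, h2, h3, h4⟩
          exact ⟨h1, by simpa using h2, by simpa using h3, by simpa using h4⟩
        · rintro s' - hF ⟨h, -⟩
          refine ⟨h, ?_, hC1.frame hF (by decide) (by decide)⟩
          rw [hF.2 a_best (by decide), b1]
      · rintro s2 hs2 hF2 ⟨hL, b2, hC2⟩
        have hval : ∀ j < I.N, s2.arr a_val j ≤ blcs I i j := hL.le_lcs
        refine (dpProg_wp (e := s.arr a_best) (val := s2.arr a_val) hs2 hC2.base.N b2 rfl hI.zero
          (fun j hj => (hI.le_lcs j hj).trans ((lcs_le_length_left _ _).trans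
            ((List.length_take_le' _ _).trans hxl.le)))
          (fun j hj => (hval j hj).trans (blcs_le_n I i j))).mono ?_ le_rfl
        intro s3 _ hF3 hdp
        have f3 : s3.reg r_fuel = s2.reg r_fuel := hF3.1 r_fuel (by decide)
        refine ⟨?_, fun j hj => ?_, ?_, fun hf => ?_⟩
        · rw [hdp 0 (Nat.zero_le _)]; rfl
        · rw [hdp j hj]
          exact dpRow_le_lcs hI.le_lcs hval j hj
        · rw [Finset.sum_range_succ, f3]
          have h1 := hI.le_fuel
          have h2 := hL.le_fuel
          have h3 : r.rowUse i = ∑ k ∈ Finset.range (r.u + 1), ∑ j ∈ Finset.range I.N,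
              r.pairUse i j k := by
            unfold rowUse; rw [if_pos hsel]
          rw [h3]
          omega
        · rw [f3] at hf
          -- Fuel does not grow within a row, so fuel left now means that there was fuel before the
          -- row.
          have hf0 : s.reg r_fuel ≠ 0 := by have := hL.fuel_le; omega
          refine card_goodBelow_le W.seq W.ch hdp (hI.good hf0) fun _ j hj hm hg => ?_
          have hch := W.chain _ hm
          have := hL.good hf j hj hch hg (by omega)
          rw [show r.u - (r.u + 1 - 1) = 0 by omega, pow_zero, r.hits_one hch] at this
          exact (W.le_length _ hm).trans this
  · rw [hevc] at hc
    have hsel : ¬ r.Sel i := by intro h; simp [h] at hc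
    refine (Wp.skip hs ?_).mono (fun _ _ _ h => h) (by omega)
    refine ⟨hI.zero, fun j hj => (hI.le_lcs j hj).trans (lcs_mono ?_ (List.Sublist.refl _)), ?_,
      fun hf j hj => ?_⟩
    · rw [take_succ_mul]; exact List.sublist_append_left _ _
    · rw [Finset.sum_range_succ]; have := hI.le_fuel; omega
    · refine le_trans (Nat.mul_le_mul_left _ (Finset.card_le_card ?_)) (hI.good hf j hj)
      intro p hp
      obtain ⟨p1, p2, p3, p4⟩ := Finset.mem_filter.1 hp
      refine Finset.mem_filter.2 ⟨p1, ?_, p3, p4⟩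
      rcases Nat.lt_or_ge p.1 i with h | h
      · exact h
      · have : p.1 = i := by omega
        exact absurd (this ▸ p4.1) hsel
  · have : (9 * I.m + 15 * I.N + 15 + 3) * (r.u + 1) ≤ (9 * I.m + 15 * I.N + 18) * (I.H + 1) :=
      Nat.mul_le_mul_left _ (by omega)
    omega

end Run

end Setup

end LCSApprox

/-! ### A single run and the loop over all runs -/

namespace LCSApprox

namespace Setup

/-- The fuel of a run. -/
def F (I : Setup) : ℕ := 2 ^ 24 * I.T * I.H * I.H

theorem F_le_V (I : Setup) : I.F ≤ I.V := by
  have h1 : I.T ≤ 2 ^ (2 * I.H) := by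
    refine I.input.budget_le.trans ?_
    rw [mul_comm, pow_mul]
    exact Nat.pow_le_pow_left I.lt_pow.le 2
  have h2 := I.H_lt.le
  have h3 : I.F ≤ 2 ^ 24 * 2 ^ (2 * I.H) * 2 ^ I.H * 2 ^ I.H :=
    Nat.mul_le_mul (Nat.mul_le_mul (Nat.mul_le_mul_left _ h1) h2) h2
  rw [← pow_add, ← pow_add, ← pow_add] at h3
  exact I.le_V_of_le h3 (by omega)

/-- Step bound for one block row. -/
noncomputable def rowCost (I : Setup) : ℕ :=
  (9 * I.m + 15 * I.N + 18) * (I.H + 1) + 20 * I.N + 16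

/-- Step bound for one run, if each unit of fuel pays for `w` steps. -/
noncomputable def runCost (I : Setup) (w : ℕ) : ℕ :=
  w * I.F + (I.rowCost + 3) * I.N + 4 * I.N + 20

namespace Run

variable {I : Setup} {r : I.Run}

/-- The lower bound carries no hypothesis on the tape except that the total demand stays below the
fuel. -/
theorem runProg_wp {s : Mem} {w : ℕ} (hw : 10 * I.H + 25 ≤ w) (hs : s.Bdd I.V) (hC : r.Ctx s)
    (W : Witness I) (hout : s.reg r_out ≤ lcs I.x I.y) :
    Wp I.V w runProg (I.runCost w)
      (fun s' => s.reg r_out ≤ s'.reg r_out ∧ s'.reg r_out ≤ lcs I.x I.y ∧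
        (∑ i ∈ Finset.range I.N, r.rowUse i < I.F →
          W.θ * (r.goodBelow W.S W.ch I.N I.N).card ≤ s'.reg r_out)) s := by
  classical
  have hev : (§(2 ^ 24) *ₑ !ₑr_T *ₑ !ₑr_H *ₑ !ₑr_H : Expr).eval s = I.F := by
    simp only [Expr.eval, Op.eval, hC.base.T, hC.base.H, F]
  have hNV : I.N + 1 ≤ I.V := by
    have := I.N_le_n
    have := I.n_lt_V
    omega
  unfold runProg
  refine Wp.mono (c := (1 + w * I.F) + (((1 + 3) * (I.N + 1) + 3) +
    (((I.rowCost + 3) * I.N + 3) + 2 + 1) + 1) + 1)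
    (Wp.seq (R := fun s' => s' = s.setReg r_fuel I.F) ?_ ?_) (fun _ _ _ h => h)
    (by unfold runCost; omega)
  -- Refuelling creates credit, so the assignment is charged `w * F` steps on top of its own.
  · refine ⟨_, 1, .assign hs _ _, hs.setReg (by rw [hev]; exact I.F_le_V), by rw [hev], ?_⟩
    simp only [hev, Mem.setReg_reg, if_true]
    omega
  rintro s1 hs1 - rfl
  have hC1 : r.Ctx (s.setReg r_fuel I.F) := hC.setReg (by decide)
  refine Wp.seq (R := fun s' => ∀ j ≤ I.N, s'.arr a_best j = 0) ?_ ?_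
  · refine Wp.mono (Wp.forLoop (V := I.V) (w := w) (c := 1) (k := I.N + 1)
      (fun j s' => ∀ j' < j, s'.arr a_best j' = 0) hs1 (by decide) (by decide) hNV ?_ ?_ ?_)
      ?_ le_rfl
    · intro s' hF
      have := hF.1 r_N (by decide)
      simp [Expr.eval, Op.eval, this, hC.base.N]
    · simp
    · rintro j s' hj hs' hF hjr h
      refine Wp.store hs' (Nat.zero_le _) ?_
      simp only [Mem.setReg_arr, Mem.setArr_arr, if_true, Expr.eval, hjr]
      intro j' hj'
      rw [Function.update_apply]
      split
      · rfl
      · exact h j' (by omega)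
    · rintro s' - - ⟨h, -⟩ j hj
      exact h j (by omega)
  intro s2 hs2 hF2 hz
  have hC2 : r.Ctx s2 := hC1.frame hF2 (by decide) (by decide)
  have f2 : s2.reg r_fuel = I.F := by rw [hF2.1 r_fuel (by decide)]; simp
  have o2 : s2.reg r_out = s.reg r_out := by rw [hF2.1 r_out (by decide)]; simp
  refine Wp.seq (c := (I.rowCost + 3) * I.N + 3) (c' := 2)
    (R := fun s' => r.RowInv W I.F I.N s' ∧ r.Ctx s' ∧ s'.reg r_out = s.reg r_out) ?_ ?_
  · refine Wp.mono (Wp.forLoop (V := I.V) (w := w) (c := I.rowCost) (k := I.N)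
      (fun i s' => r.RowInv W I.F i s') hs2 (by decide) (by decide) (by omega) ?_ ?_ ?_) ?_ le_rfl
    · intro s' hF
      have := hF.1 r_N (by decide)
      simpa [Expr.eval, hC2.base.N] using this
    · refine ⟨?_, fun j hj => ?_, ?_, fun _ j hj => ?_⟩
      · simpa using hz 0 (Nat.zero_le _)
      · simp [hz j hj]
      · simp [f2]
      · have : r.goodBelow W.S W.ch 0 j = ∅ := by
          unfold goodBelow; exact Finset.filter_eq_empty_iff.2 (by simp)
        simp [this]
    · intro i s' hi hs' hF hir hR
      have hC' : r.Ctx s' := hC2.frame hF (by decide) (by decide)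
      refine (rowProg_wp hw hs' hC' hir hi hR).mono ?_ le_rfl
      rintro s'' - - ⟨h1, h2, h3, h4⟩
      exact ⟨by simpa using h1, by simpa using h2, by simpa using h3, by simpa using h4⟩
    · rintro s' - hF ⟨h, -⟩
      exact ⟨h, hC2.frame hF (by decide) (by decide), by rw [hF.1 r_out (by decide), o2]⟩
  rintro s3 hs3 hF3 ⟨hR, hC3, o3⟩
  have hN3 := hC3.base.N
  have hup : s3.arr a_best I.N ≤ lcs I.x I.y :=
    (hR.le_lcs I.N le_rfl).trans (lcs_mono (List.take_sublist _ _) (List.take_sublist _ _))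
  -- A total demand below `F` leaves a nonzero amount of fuel at the end.
  have hlow : ∑ i ∈ Finset.range I.N, r.rowUse i < I.F →
      W.θ * (r.goodBelow W.S W.ch I.N I.N).card ≤ s3.arr a_best I.N := fun h =>
    hR.good (by have := hR.le_fuel; omega) I.N le_rfl
  refine Wp.ite (c := 1) hs3 (fun hc => Wp.assign hs3 (hs3.2 _ _) (by decide) ?_)
    (fun hc => Wp.skip hs3 ?_)
  · have hlt : s.reg r_out < s3.arr a_best I.N := by
      by_contra hcon
      simp [Expr.eval, Op.eval, hN3, o3, hcon] at hc
    simp only [Expr.eval, Mem.setReg_reg, if_true, hN3]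
    exact ⟨hlt.le, hup, hlow⟩
  · have hge : s3.arr a_best I.N ≤ s.reg r_out := by
      by_contra hcon
      have : s.reg r_out < s3.arr a_best I.N := by omega
      simp [Expr.eval, Op.eval, hN3, o3, this] at hc
    rw [o3]
    exact ⟨le_rfl, hout, fun h => (hlow h).trans hge⟩

end Run

/-- `G` occurs only in a constant, so side conditions can be decided for the closed program with `G
= 0`. -/
theorem mainProg_regs (G : ℕ) : (mainProg G).regs = (mainProg 0).regs := rfl

theorem mainProg_arrs (G : ℕ) : (mainProg G).arrs = (mainProg 0).arrs := rfl

/-- Step bound for all runs. -/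
noncomputable def mainCost (I : Setup) (w : ℕ) : ℕ :=
  ((((I.runCost w + 3) * (3 * I.H + 7) + 6) * (I.H + 1) + 6) * (I.H + 1) + 6) * (I.G * I.H) + 3

/-- The output so far is correct, and at least `b` once `P` holds. -/
def OutInv (I : Setup) (b : ℕ) (P : Prop) (s : Mem) : Prop :=
  s.reg r_out ≤ lcs I.x I.y ∧ (P → b ≤ s.reg r_out)

/-- The output never decreases, so what the run `r₀` achieves persists; the nested disjunctions say
that `r₀` precedes the current run lexicographically. The alternative `W.θ = 0` makes the lower
bound void and yields termination and soundness on every tape. -/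
theorem mainProg_wp {I : Setup} {s : Mem} {w : ℕ} (hw : 10 * I.H + 25 ≤ w) (hs : s.Bdd I.V)
    (r₀ : I.Run) (hC : I.Ctx r₀.ζ s) (hout : s.reg r_out = 0) (W : Run.Witness I)
    (huse : ∑ i ∈ Finset.range I.N, r₀.rowUse i < I.F ∨ W.θ = 0) :
    Wp I.V w (mainProg I.G) (I.mainCost w)
      (fun s' => s'.reg r_out ≤ lcs I.x I.y ∧
        W.θ * (r₀.goodBelow W.S W.ch I.N I.N).card ≤ s'.reg r_out) s := by
  set b := W.θ * (r₀.goodBelow W.S W.ch I.N I.N).card with hb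
  have hHV : 3 * I.H + 7 ≤ I.V := by
    have h1 := I.H_lt
    have h2 := I.pow_le_V (k := I.H + 4) (by omega)
    rw [pow_add] at h2
    omega
  have hGV : I.G * I.H ≤ I.V := by
    unfold V
    have h1 := I.H_lt.le.trans (Nat.pow_le_pow_right (show 0 < 2 by norm_num)
      (show I.H ≤ 8 * I.H + 40 by omega))
    exact Nat.mul_le_mul (by nlinarith) h1
  unfold mainProg mainCost
  refine Wp.mono (Wp.forLoop (V := I.V) (w := w)
    (c := (((I.runCost w + 3) * (3 * I.H + 7) + 6) * (I.H + 1) + 6) * (I.H + 1) + 3)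
    (k := I.G * I.H)
    (fun g s' => I.OutInv b (r₀.g < g) s') hs (by decide) (by decide) hGV ?_ ?_ ?_) ?_ le_rfl
  · intro s' hF
    have := hF.1 r_H (by rw [← mainProg, mainProg_regs]; decide)
    simp [Expr.eval, Op.eval, this, hC.H]
  · exact ⟨by simp [hout], by simp⟩
  · intro g s1 hg hs1 hF1 hgr hI1
    have hC1 : I.Ctx r₀.ζ s1 := hC.frame hF1 (by rw [← mainProg, mainProg_regs]; decide)
      (by rw [← mainProg, mainProg_arrs]; decide)
    refine Wp.mono (Wp.forLoop (V := I.V) (w := w)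
      (c := ((I.runCost w + 3) * (3 * I.H + 7) + 6) * (I.H + 1) + 3) (k := I.H + 1)
      (fun u s' => I.OutInv b (r₀.g < g ∨ (r₀.g = g ∧ r₀.u < u)) s') hs1 (by decide) (by decide)
      (by omega) ?_ ?_ ?_) ?_ le_rfl
    · intro s' hF
      have := hF.1 r_H (by decide)
      simp [Expr.eval, Op.eval, this, hC1.H]
    · refine ⟨by simpa using hI1.1, fun h => ?_⟩
      simpa using hI1.2 (by omega)
    · intro u s2 hu hs2 hF2 hur hI2
      have hC2 : I.Ctx r₀.ζ s2 := hC1.frame hF2 (by decide) (by decide)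
      have g2 : s2.reg r_g = g := by rw [hF2.1 r_g (by decide)]; exact hgr
      refine Wp.mono (Wp.forLoop (V := I.V) (w := w)
        (c := (I.runCost w + 3) * (3 * I.H + 7) + 3) (k := I.H + 1)
        (fun v s' => I.OutInv b
          (r₀.g < g ∨ (r₀.g = g ∧ (r₀.u < u ∨ (r₀.u = u ∧ r₀.v < v)))) s') hs2 (by decide)
        (by decide) (by omega) ?_ ?_ ?_) ?_ le_rfl
      · intro s' hF
        have := hF.1 r_H (by decide)
        simp [Expr.eval, Op.eval, this, hC2.H]
      · refine ⟨by simpa using hI2.1, fun h => ?_⟩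
        simpa using hI2.2 (by omega)
      · intro v s3 hv hs3 hF3 hvr hI3
        have hC3 : I.Ctx r₀.ζ s3 := hC2.frame hF3 (by decide) (by decide)
        have g3 : s3.reg r_g = g := by rw [hF3.1 r_g (by decide)]; exact g2
        have u3 : s3.reg r_u = u := by rw [hF3.1 r_u (by decide)]; exact hur
        refine Wp.mono (Wp.forLoop (V := I.V) (w := w) (c := I.runCost w) (k := 3 * I.H + 7)
          (fun wi s' => I.OutInv b (r₀.g < g ∨ (r₀.g = g ∧ (r₀.u < u ∨
            (r₀.u = u ∧ (r₀.v < v ∨ (r₀.v = v ∧ r₀.w < wi)))))) s') hs3 (by decide) (by decide)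
          hHV ?_ ?_ ?_) ?_ le_rfl
        · intro s' hF
          have := hF.1 r_H (by decide)
          simp [Expr.eval, Op.eval, this, hC3.H]
        · refine ⟨by simpa using hI3.1, fun h => ?_⟩
          simpa using hI3.2 (by omega)
        · intro wi s4 hwi hs4 hF4 hwr hI4
          have hC4 : I.Ctx r₀.ζ s4 := hC3.frame hF4 (by decide) (by decide)
          let r : I.Run := ⟨r₀.ζ, g, u, v, wi, hg, by omega, by omega, hwi, r₀.tape_lt⟩
          have hCr : r.Ctx s4 := ⟨hC4, by rw [hF4.1 r_g (by decide)]; exact g3,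
            by rw [hF4.1 r_u (by decide)]; exact u3,
            by rw [hF4.1 r_v (by decide)]; exact hvr, hwr⟩
          refine (Run.runProg_wp hw hs4 hCr W hI4.1).mono ?_ le_rfl
          rintro s5 - - ⟨h1, h2, h3⟩
          refine ⟨by simpa using h2, fun hP => ?_⟩
          simp only [Mem.setReg_reg]
          norm_num
          by_cases heq : r₀.g = g ∧ r₀.u = u ∧ r₀.v = v ∧ r₀.w = wi
          · have hr : r₀ = r := by
              obtain ⟨e1, e2, e3, e4⟩ := heq
              cases r₀
              simp only at e1 e2 e3 e4
              subst e1 e2 e3 e4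
              rfl
            rcases huse with h | h
            · rw [hb, hr]
              rw [hr] at h
              exact h3 h
            · rw [hb, h, zero_mul]; exact Nat.zero_le _
          · exact (hI4.2 (by omega)).trans h1
        · rintro s' - - ⟨h, -⟩
          refine ⟨by simpa using h.1, fun hP => ?_⟩
          have := r₀.w_lt
          simpa using h.2 (by omega)
      · rintro s' - - ⟨h, -⟩
        refine ⟨by simpa using h.1, fun hP => ?_⟩
        have := r₀.v_le
        simpa using h.2 (by omega)
    · rintro s' - - ⟨h, -⟩
      refine ⟨by simpa using h.1, fun hP => ?_⟩
      have := r₀.u_le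
      simpa using h.2 (by omega)
  · rintro s' - - ⟨h, -⟩
    exact ⟨h.1, h.2 r₀.g_lt⟩

end Setup

end LCSApprox

/-! ### Bucketing the positions of `y` and computing the parameters -/

namespace LCSApprox

theorem occBelow_succ (y : List ℕ) (m j σ b : ℕ) :
    occBelow y m j σ (b + 1) =
      occBelow y m j σ b ++ if b / m = j ∧ y.getD b 0 = σ then [b] else [] := by
  simp only [occBelow, List.range_succ, List.filter_append]
  congr 1
  simp only [List.filter_cons, List.filter_nil, decide_eq_true_eq]

theorem occBelow_length_le {m : ℕ} (hm : 1 ≤ m) (y : List ℕ) (j σ b : ℕ) :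
    (occBelow y m j σ b).length ≤ m := by
  have hnd : (occBelow y m j σ b).Nodup := List.nodup_range.filter _
  rw [← List.toFinset_card_of_nodup hnd]
  calc _ ≤ (Finset.Ico (j * m) (j * m + m)).card := by
        refine Finset.card_le_card fun t ht => ?_
        simp only [occBelow, List.mem_toFinset, List.mem_filter, decide_eq_true_eq] at ht
        exact Finset.mem_Ico.2 ((div_eq_iff_block hm).1 ht.2.1)
    _ = m := by simp

theorem mul_add_inj {N a b i j : ℕ} (hi : i < N) (hj : j < N) (h : a * N + i = b * N + j) :
    a = b ∧ i = j := by
  have h1 : (a * N + i) / N = a := by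
    rw [mul_comm, Nat.mul_add_div (by omega), Nat.div_eq_of_lt hi, Nat.add_zero]
  have h2 : (b * N + j) / N = b := by
    rw [mul_comm, Nat.mul_add_div (by omega), Nat.div_eq_of_lt hj, Nat.add_zero]
  rw [h, h2] at h1
  subst h1
  exact ⟨rfl, by omega⟩

namespace Setup

variable {I : Setup}

/-- The address `(σ N + j) m + c` determines `σ`, `j` and `c` when `j < N` and `c < m`, so an
insertion disturbs no other bucket. The counters start from the zeros of the initial memory. -/
theorem bucketProg_wp {s : Mem} {w : ℕ} (hs : s.Bdd I.V) (hn : s.reg r_n = I.n)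
    (hm : s.reg r_m = I.m) (hN : s.reg r_N = I.N) (hy : s.arr a_y = fun i => I.y.getD i 0)
    (hcnt : s.arr a_cnt = fun _ => 0) :
    Wp I.V w bucketProg (8 * I.n + 3)
      (fun s' => (∀ σ, ∀ j < I.N, s'.arr a_cnt (σ * I.N + j) = (occ I.y I.m j σ).length) ∧
        ∀ σ, ∀ j < I.N, ∀ c < (occ I.y I.m j σ).length,
          s'.arr a_cell ((σ * I.N + j) * I.m + c) = (occ I.y I.m j σ).getD c 0) s := by
  have hnV := I.n_lt_V
  unfold bucketProg
  refine Wp.mono (Wp.forLoop (V := I.V) (w := w) (c := 5) (k := I.n)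
    (fun b s' => (∀ σ, ∀ j < I.N,
      s'.arr a_cnt (σ * I.N + j) = (occBelow I.y I.m j σ b).length) ∧
        ∀ σ, ∀ j < I.N, ∀ c < (occBelow I.y I.m j σ b).length,
          s'.arr a_cell ((σ * I.N + j) * I.m + c) = (occBelow I.y I.m j σ b).getD c 0) hs
    (by decide) (by decide) (by omega) ?_ ?_ ?_) ?_ le_rfl
  · intro s' hF
    have := hF.1 r_n (by decide)
    simpa [Expr.eval, hn] using this
  · simp [occBelow, hcnt]
  · rintro b s1 hb hs1 hF hbr ⟨h1, h2⟩
    have m1 : s1.reg r_m = I.m := by rw [hF.1 r_m (by decide)]; exact hm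
    have N1 : s1.reg r_N = I.N := by rw [hF.1 r_N (by decide)]; exact hN
    have y1 : s1.arr a_y = fun i => I.y.getD i 0 := by rw [hF.2 a_y (by decide)]; exact hy
    set σ₀ := I.y.getD b 0 with hσ₀
    set j₀ := b / I.m with hj₀
    have hj₀N : j₀ < I.N := lt_numBlocks I.m_pos hb
    have hev : (.read a_y (!ₑr_b) *ₑ !ₑr_N +ₑ !ₑr_b /ₑ !ₑr_m : Expr).eval s1 = σ₀ * I.N + j₀ := by
      simp only [Expr.eval, Op.eval, m1, N1, y1, hbr, hσ₀, hj₀]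
    refine Wp.assign_seq (c := 3) hs1 (by rw [hev]; exact I.key_le_V (I.getD_y_le _) hj₀N.le)
      (by decide) fun hs2 => ?_
    rw [hev] at hs2 ⊢
    refine Wp.store_seq (c := 1) hs2 (hs2.1 _) fun hs3 => ?_
    have hc0 := h1 σ₀ j₀ hj₀N
    have e1 : (!ₑr_key *ₑ !ₑr_m +ₑ .read a_cnt (!ₑr_key) : Expr).eval
        (s1.setReg r_key (σ₀ * I.N + j₀)) =
        (σ₀ * I.N + j₀) * I.m + (occBelow I.y I.m j₀ σ₀ b).length := by
      simp [Expr.eval, Op.eval, m1, hc0]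
    have e2 : (!ₑr_b : Expr).eval (s1.setReg r_key (σ₀ * I.N + j₀)) = b := by
      simp [Expr.eval, hbr]
    rw [e1, e2] at hs3 ⊢
    -- Counting the new occurrence as well shows that its offset in the bucket is strictly below
    -- `m`.
    have hlen' := occBelow_length_le I.m_pos I.y j₀ σ₀ (b + 1)
    rw [occBelow_succ, if_pos ⟨hj₀.symm, hσ₀.symm⟩, List.length_append,
      List.length_singleton] at hlen'
    have hmn := I.m_le_n
    refine Wp.store hs3 ?_ ?_
    · simp [Expr.eval, Op.eval, hc0]; omega
    · have e3 : (!ₑr_key : Expr).eval ((s1.setReg r_key (σ₀ * I.N + j₀)).setArr a_cell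
          ((σ₀ * I.N + j₀) * I.m + (occBelow I.y I.m j₀ σ₀ b).length) b) = σ₀ * I.N + j₀ := by
        simp [Expr.eval]
      have e4 : (.read a_cnt (!ₑr_key) +ₑ §1 : Expr).eval
          ((s1.setReg r_key (σ₀ * I.N + j₀)).setArr a_cell
          ((σ₀ * I.N + j₀) * I.m + (occBelow I.y I.m j₀ σ₀ b).length) b) =
          (occBelow I.y I.m j₀ σ₀ b).length + 1 := by
        simp [Expr.eval, Op.eval, hc0]
      rw [e3, e4]
      simp only [Mem.setReg_arr, Mem.setArr_arr, if_true]
      norm_num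
      refine ⟨fun σ j hj => ?_, fun σ j hj c hc => ?_⟩
      · rw [occBelow_succ, Function.update_apply]
        split
        · rename_i h
          obtain ⟨rfl, rfl⟩ := mul_add_inj hj hj₀N h
          rw [if_pos ⟨hj₀.symm, hσ₀.symm⟩]
          simp
        · rename_i h
          rw [if_neg, List.append_nil]
          · exact h1 σ j hj
          · rintro ⟨g1, g2⟩
            exact h (by rw [hj₀, hσ₀, g1, g2])
      · rw [occBelow_succ] at hc ⊢
        by_cases hk : b / I.m = j ∧ I.y.getD b 0 = σ
        · rw [if_pos hk] at hc ⊢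
          obtain rfl : j = j₀ := hk.1.symm
          obtain rfl : σ = σ₀ := hk.2.symm
          rw [List.length_append, List.length_singleton] at hc
          rw [Function.update_apply]
          split
          · rename_i h
            obtain rfl : c = (occBelow I.y I.m j₀ σ₀ b).length := by omega
            simp [hj₀, hσ₀]
          · rename_i h
            have hc' : c < (occBelow I.y I.m j₀ σ₀ b).length := by
              by_contra hcon
              have : c = (occBelow I.y I.m j₀ σ₀ b).length := by omega
              exact h (by rw [this])
            rw [List.getElem?_append_left hc', h2 σ₀ j₀ hj₀N c hc', List.getD_eq_getElem?_getD]
        · rw [if_neg hk, List.append_nil] at hc ⊢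
          rw [Function.update_apply, if_neg]
          · rw [h2 σ j hj c hc, List.getD_eq_getElem?_getD]
          · intro h
            have hcm := occBelow_length_le I.m_pos I.y j σ b
            obtain ⟨hkey, -⟩ := mul_add_inj (by omega) (by omega) h
            obtain ⟨g1, g2⟩ := mul_add_inj hj hj₀N hkey
            exact hk ⟨g2.symm, g1.symm⟩
  · rintro s' - - ⟨⟨h1, h2⟩, -⟩
    have : I.n = I.y.length := I.input.length_y.symm
    rw [this] at h1 h2
    exact ⟨h1, h2⟩

/-- The initial memory. -/
def initMem (I : Setup) : Mem := (initConfig .skip I.x I.y I.T).mem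

theorem initMem_bdd (I : Setup) : I.initMem.Bdd I.V := by
  have hn := I.n_lt_V
  have hT : I.T ≤ I.V := by
    refine I.input.budget_le.trans ?_
    have h2 : I.n ^ 2 ≤ (2 ^ I.H) ^ 2 := Nat.pow_le_pow_left I.lt_pow.le 2
    rw [← pow_mul] at h2
    exact I.le_V_of_le h2 (by omega)
  have hA : I.A * I.n ≤ I.V := by
    have := I.key_le_V (σ := I.A * I.n) (j := 0) le_rfl (Nat.zero_le _)
    have h2 := Nat.le_mul_of_pos_right (I.A * I.n) I.N_pos
    omega
  refine ⟨fun v => ?_, fun a i => ?_⟩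
  · simp only [initMem, initConfig]
    rw [I.input.length_x]
    split
    · omega
    · split
      · exact hT
      · exact Nat.zero_le _
  · simp only [initMem, initConfig]
    split
    · exact (I.getD_x_le i).trans hA
    · split
      · exact (I.getD_y_le i).trans hA
      · exact Nat.zero_le _

theorem pow_cond_wp {s : Mem} {w : ℕ} (hs : s.Bdd I.V) (hn : s.reg r_n = I.n)
    (hH : s.reg r_H = 0) (hQ : s.reg r_Q = 1) :
    Wp I.V w (.loop (!ₑr_Q <ₑ !ₑr_n +ₑ §1) (r_Q ≔ !ₑr_Q *ₑ §2 ;; r_H ≔ !ₑr_H +ₑ §1))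
      (4 * I.H + 1) (fun s' => s'.reg r_H = I.H ∧ s'.reg r_Q = 2 ^ I.H) s := by
  have hlt := I.lt_pow
  have hle := I.pow_le
  have hV := Run.two_mul_n_lt_V I
  have hHV : I.H ≤ I.V := I.H_lt.le.trans (I.pow_le_V (by omega))
  refine Wp.mono (Wp.loop (V := I.V) (w := w) (c := 3) (k := I.H)
    (fun k s' => s'.reg r_H + k = I.H ∧ s'.reg r_Q = 2 ^ s'.reg r_H) hs ?_ ?_) ?_ le_rfl
  · simp [hH, hQ]
  · rintro k s' hs' hF ⟨h1, h2⟩ hc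
    have n1 : s'.reg r_n = I.n := by rw [hF.1 r_n (by decide)]; exact hn
    have hQn : s'.reg r_Q ≤ I.n := by
      by_contra hcon
      simp [Expr.eval, Op.eval, n1] at hc
      omega
    have hk : k ≠ 0 := by
      rintro rfl
      rw [Nat.add_zero] at h1
      rw [h2, h1] at hQn
      omega
    refine ⟨k - 1, by omega, ?_⟩
    refine Wp.assign_seq (c := 1) hs' (by simp [Expr.eval, Op.eval]; omega) (by decide) fun hs2 =>
      Wp.assign hs2 (by simp [Expr.eval, Op.eval]; omega) (by decide) ?_
    simp [Expr.eval, Op.eval, h2, pow_succ]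
    omega
  · rintro s' - hF ⟨⟨k, h1, h2⟩, hc⟩
    have n1 : s'.reg r_n = I.n := by rw [hF.1 r_n (by decide)]; exact hn
    have hQn : I.n < s'.reg r_Q := by
      by_contra hcon
      simp [Expr.eval, Op.eval, n1] at hc
      omega
    -- `2 ^ H ≤ 2 n` while the power reached already exceeds `n`, so the exponent cannot fall short
    -- of `H`.
    have hk : s'.reg r_H = I.H := by
      rw [h2] at hQn
      have h3 : 2 ^ I.H < 2 ^ (s'.reg r_H + 1) := by rw [pow_succ]; omega
      have := (Nat.pow_lt_pow_iff_right (by norm_num)).1 h3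
      omega
    exact ⟨hk, by rw [h2, hk]⟩

/-- A linear search is affordable, as it ends after fewer than `n ≤ T` increments. -/
theorem blockLen_wp {s : Mem} {w : ℕ} (hs : s.Bdd I.V) (hn : s.reg r_n = I.n)
    (hT : s.reg r_T = I.T) (hm : s.reg r_m = 1) :
    Wp I.V w (.loop (!ₑr_m *ₑ !ₑr_m *ₑ !ₑr_T <ₑ !ₑr_n *ₑ !ₑr_n) (r_m ≔ !ₑr_m +ₑ §1))
      (2 * I.n + 1) (fun s' => s'.reg r_m = I.m) s := by
  have hV := I.n_lt_V
  have hmn := I.m_le_n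
  have hm1 := I.m_pos
  refine Wp.mono (Wp.loop (V := I.V) (w := w) (c := 1) (k := I.m - 1)
    (fun k s' => s'.reg r_m + k = I.m) hs (by omega) ?_) ?_ (by omega)
  · rintro k s' hs' hF h1 hc
    have n1 : s'.reg r_n = I.n := by rw [hF.1 r_n (by decide)]; exact hn
    have T1 : s'.reg r_T = I.T := by rw [hF.1 r_T (by decide)]; exact hT
    have hlt : ¬ I.m ≤ s'.reg r_m := by
      rw [I.m_le_iff]
      intro hcon
      simp [Expr.eval, Op.eval, n1, T1] at hc
      omega
    refine ⟨k - 1, by omega, Wp.assign hs' (by simp [Expr.eval, Op.eval]; omega) (by decide) ?_⟩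
    simp [Expr.eval, Op.eval]
    omega
  · rintro s' - hF ⟨⟨k, h1⟩, hc⟩
    have n1 : s'.reg r_n = I.n := by rw [hF.1 r_n (by decide)]; exact hn
    have T1 : s'.reg r_T = I.T := by rw [hF.1 r_T (by decide)]; exact hT
    have hle : I.m ≤ s'.reg r_m := by
      rw [I.m_le_iff]
      simpa [Expr.eval, Op.eval, n1, T1] using hc
    omega

theorem setupProg_wp (I : Setup) {w : ℕ} :
    Wp I.V w setupProg (10 * I.n + 16 * I.H + 60)
      (fun s' => I.Ctx (fun _ => 0) s' ∧ s'.reg r_out = 0 ∧ s'.reg r_idx = 0) I.initMem := by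
  have hs := I.initMem_bdd
  have hnV := I.n_lt_V
  have hn0 : I.initMem.reg r_n = I.n := I.input.length_x
  have hT0 : I.initMem.reg r_T = I.T := rfl
  unfold setupProg
  refine Wp.mono (c := ((2 * I.n + 1) + (((4 * I.H + 1) + (((4 * (3 * I.H + 7) + 3) +
    ((8 * I.n + 3) + 1 + 1) + 1) + 2) + 1) + 2 + 2 + 2) + 1) + 2) ?_ (fun _ _ _ h => h) (by omega)
  refine Wp.assign_seq hs (by simp [Expr.eval]; omega) (by decide) fun hs1 => ?_
  refine Wp.seq (c := 2 * I.n + 1)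
    (blockLen_wp hs1 (by simpa using hn0) (by simpa using hT0) (by simp [Expr.eval]))
    fun s2 hs2 hF2 m2 => ?_
  have n2 : s2.reg r_n = I.n := by rw [hF2.1 r_n (by decide)]; simpa using hn0
  have T2 : s2.reg r_T = I.T := by rw [hF2.1 r_T (by decide)]; simpa using hT0
  have o2 : s2.reg r_out = 0 := by rw [hF2.1 r_out (by decide)]; rfl
  have a2 : s2.arr = I.initMem.arr := by
    funext a; rw [hF2.2 a (by simp [Prog.arrs])]; simp
  have hevN : ((!ₑr_n +ₑ !ₑr_m -ₑ §1) /ₑ !ₑr_m : Expr).eval s2 = I.N := by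
    simp [Expr.eval, Op.eval, n2, m2, N, numBlocks]
  have hNn := I.N_le_n
  refine Wp.assign_seq hs2 (by rw [hevN]; omega) (by decide) fun hs3 => ?_
  rw [hevN] at hs3 ⊢
  refine Wp.assign_seq hs3 (Nat.zero_le _) (by decide) fun hs4 => ?_
  refine Wp.assign_seq hs4 (by simp [Expr.eval]; omega) (by decide) fun hs5 => ?_
  refine Wp.seq (c := 4 * I.H + 1) (pow_cond_wp hs5 (by simpa using n2) (by simp [Expr.eval])
    (by simp [Expr.eval])) fun s6 hs6 hF6 ⟨H6, Q6⟩ => ?_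
  have n6 : s6.reg r_n = I.n := by rw [hF6.1 r_n (by decide)]; simpa using n2
  have T6 : s6.reg r_T = I.T := by rw [hF6.1 r_T (by decide)]; simpa using T2
  have o6 : s6.reg r_out = 0 := by rw [hF6.1 r_out (by decide)]; simpa using o2
  have m6 : s6.reg r_m = I.m := by rw [hF6.1 r_m (by decide)]; simpa using m2
  have N6 : s6.reg r_N = I.N := by rw [hF6.1 r_N (by decide)]; simp
  have a6 : s6.arr = I.initMem.arr := by
    funext a; rw [hF6.2 a (by simp [Prog.arrs])]; simp [a2]
  refine Wp.store_seq hs6 (by simp [Expr.eval]; omega) fun hs7 => ?_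
  have ez : (§0 : Expr).eval s6 = 0 := rfl
  have eo : (§1 : Expr).eval s6 = 1 := rfl
  rw [ez, eo] at hs7 ⊢
  have hHV : 3 * I.H + 7 ≤ I.V := by
    have h1 := I.H_lt
    have h2 := I.pow_le_V (k := I.H + 4) (by omega)
    rw [pow_add] at h2
    omega
  refine Wp.seq (c := 4 * (3 * I.H + 7) + 3)
    (R := fun s' => ∀ t < 3 * I.H + 8, s'.arr a_pow t = 2 ^ t) ?_ ?_
  · refine Wp.mono (Wp.forLoop (V := I.V) (w := w) (c := 1) (k := 3 * I.H + 7)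
      (fun k s' => ∀ t ≤ k, s'.arr a_pow t = 2 ^ t) hs7 (by decide) (by decide) hHV ?_ ?_ ?_) ?_
      le_rfl
    · intro s' hF
      have := hF.1 r_H (by decide)
      simp [Expr.eval, Op.eval, this, H6]
    · intro t ht
      obtain rfl : t = 0 := by omega
      simp
    · intro k s' hk hs' hF hkr h
      have hp : (§2 *ₑ .read a_pow (!ₑr_idx) : Expr).eval s' = 2 ^ (k + 1) := by
        simp [Expr.eval, Op.eval, hkr, h k le_rfl, pow_succ']
      have hi : (!ₑr_idx +ₑ §1 : Expr).eval s' = k + 1 := by simp [Expr.eval, Op.eval, hkr]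
      refine Wp.store hs' (by rw [hp]; exact I.pow_le_V (by omega)) ?_
      rw [hp, hi]
      intro t ht
      simp only [Mem.setReg_arr, Mem.setArr_arr, if_true]
      rw [Function.update_apply]
      split
      · rename_i h'; rw [h']
      · exact h t (by omega)
    · rintro s' - - ⟨h, -⟩ t ht
      exact h t (by omega)
  · intro s8 hs8 hF8 hp8
    have n8 : s8.reg r_n = I.n := by rw [hF8.1 r_n (by decide)]; simpa using n6
    have T8 : s8.reg r_T = I.T := by rw [hF8.1 r_T (by decide)]; simpa using T6
    have o8 : s8.reg r_out = 0 := by rw [hF8.1 r_out (by decide)]; simpa using o6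
    have m8 : s8.reg r_m = I.m := by rw [hF8.1 r_m (by decide)]; simpa using m6
    have N8 : s8.reg r_N = I.N := by rw [hF8.1 r_N (by decide)]; simpa using N6
    have H8 : s8.reg r_H = I.H := by rw [hF8.1 r_H (by decide)]; simpa using H6
    have Q8 : s8.reg r_Q = 2 ^ I.H := by rw [hF8.1 r_Q (by decide)]; simpa using Q6
    have a8 : ∀ a, a ≠ 3 → s8.arr a = I.initMem.arr a := by
      intro a ha
      rw [hF8.2 a (by simpa [forLoop, Prog.arrs] using ha)]
      simp [ha, a6]
    refine Wp.seq (c := 8 * I.n + 3) (c' := 1) (bucketProg_wp hs8 n8 m8 N8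
      (by rw [a8 _ (by decide)]; rfl) (by rw [a8 _ (by decide)]; rfl))
      fun s9 hs9 hF9 ⟨c9, d9⟩ => ?_
    refine Wp.assign hs9 (Nat.zero_le _) (by decide) ?_
    refine ⟨⟨?_, ?_, ?_, ?_, ?_, ?_, ?_, ?_, ?_, c9, d9⟩, ?_, ?_⟩
    · simpa [hF9.1 r_n (by decide)] using n8
    · simpa [hF9.1 r_T (by decide)] using T8
    · simpa [hF9.1 r_m (by decide)] using m8
    · simpa [hF9.1 r_N (by decide)] using N8
    · simpa [hF9.1 r_H (by decide)] using H8
    · simpa [hF9.1 r_Q (by decide)] using Q8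
    · rw [Mem.setReg_arr, hF9.2 a_x (by decide), a8 _ (by decide)]; rfl
    · rw [Mem.setReg_arr, hF9.2 a_tape (by decide), a8 _ (by decide)]; rfl
    · rw [Mem.setReg_arr, hF9.2 a_pow (by decide)]; exact hp8
    · simpa [hF9.1 r_out (by decide)] using o8
    · simp [Expr.eval]

end Setup

end LCSApprox

namespace LCSApprox

/-! ### Distribution of the final configuration -/

section uniform

variable {α β γ : Type*} [Fintype α] [Nonempty α] [Fintype β] [Nonempty β]

theorem uniformOfFintype_map_equiv (e : α ≃ β) :
    (PMF.uniformOfFintype α).map e = PMF.uniformOfFintype β := by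
  ext b
  rw [PMF.map_apply, tsum_eq_single (e.symm b)]
  · simp [Fintype.card_congr e]
  · intro a ha
    rw [if_neg]
    rintro rfl
    simp at ha

theorem uniformOfFintype_bind_map (h : α → β → γ) :
    ((PMF.uniformOfFintype α).bind fun a => (PMF.uniformOfFintype β).map (h a)) =
      (PMF.uniformOfFintype (α × β)).map fun p => h p.1 p.2 := by
  have key : ((PMF.uniformOfFintype α).bind fun a => (PMF.uniformOfFintype β).map (Prod.mk a)) =
      PMF.uniformOfFintype (α × β) := by
    ext ⟨a, b⟩
    rw [PMF.bind_apply, tsum_eq_single a]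
    · rw [PMF.map_apply, tsum_eq_single b]
      · simp only [PMF.uniformOfFintype_apply, if_true, Fintype.card_prod, Nat.cast_mul]
        rw [ENNReal.mul_inv (by simp) (by simp)]
      · intro b' hb'
        rw [if_neg]
        simpa using hb'.symm
    · intro a' ha'
      rw [PMF.map_apply, ENNReal.tsum_eq_zero.2, mul_zero]
      intro b'
      rw [if_neg]
      simp [ha'.symm]
  rw [← key, PMF.map_bind]
  simp only [PMF.map_comp]
  rfl

theorem uniformBelow_eq_map (Q : ℕ) [NeZero Q] :
    uniformBelow Q = (PMF.uniformOfFintype (Fin Q)).map Fin.val := by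
  obtain ⟨k, hk⟩ := Nat.exists_eq_succ_of_ne_zero (NeZero.ne Q)
  subst hk
  ext a
  simp only [uniformBelow, PMF.uniformOfFinset_apply, Finset.mem_range, PMF.map_apply,
    PMF.uniformOfFintype_apply, Finset.card_range, Fintype.card_fin]
  split
  · rename_i h
    rw [tsum_eq_single ⟨a, h⟩]
    · simp
    · intro b hb
      rw [if_neg]
      rintro rfl
      exact hb rfl
  · rename_i h
    symm
    rw [ENNReal.tsum_eq_zero]
    intro b
    rw [if_neg]
    rintro rfl
    exact h b.2

/-- One fresh number followed by a uniform vector of length `r` is a uniform vector of length `r +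
1`: the inductive step for the tape. -/
theorem uniformBelow_bind_map {Q r : ℕ} [NeZero Q] (h : ℕ → (Fin r → Fin Q) → γ) :
    ((uniformBelow Q).bind fun a => (PMF.uniformOfFintype (Fin r → Fin Q)).map (h a)) =
      (PMF.uniformOfFintype (Fin (r + 1) → Fin Q)).map fun z => h (z 0) (Fin.tail z) := by
  rw [uniformBelow_eq_map, PMF.bind_map]
  have h1 := uniformOfFintype_bind_map (fun (a : Fin Q) (z : Fin r → Fin Q) => h a z)
  have h2 := uniformOfFintype_map_equiv (Fin.consEquiv fun _ : Fin (r + 1) => Fin Q)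
  rw [← h2, PMF.map_comp]
  refine Eq.trans ?_ (h1.trans ?_)
  · rfl
  · rfl

end uniform

/-- Halting configurations do not change. -/
theorem stepN_halted {c : Config} (hc : c.todo = []) (k : ℕ) : stepN c k = PMF.pure c := by
  obtain ⟨todo, s, t⟩ := c
  simp only at hc
  subst hc
  induction k with
  | zero => rfl
  | succ k ih =>
    simp only [stepN]
    rw [ih, PMF.pure_bind]
    rfl

theorem stepN_halted_of_le {c c' : Config} {k l : ℕ} (h : stepN c k = PMF.pure c')
    (hc' : c'.todo = []) (hkl : k ≤ l) : stepN c l = PMF.pure c' := by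
  obtain ⟨j, rfl⟩ := Nat.exists_eq_add_of_le hkl
  exact stepN_pure_trans h (stepN_halted hc' j)

theorem pure_injective {α : Type*} {a b : α} (h : PMF.pure a = PMF.pure b) : a = b := by
  have h1 : a ∈ (PMF.pure a).support := by simp
  rw [h] at h1
  simpa using h1

/-- Separate runs of the calculus, one for each witness, all speak about the same final
configuration. -/
theorem halted_unique {c c₁ c₂ : Config} {k₁ k₂ : ℕ} (h₁ : stepN c k₁ = PMF.pure c₁)
    (h₂ : stepN c k₂ = PMF.pure c₂) (hc₁ : c₁.todo = []) (hc₂ : c₂.todo = []) : c₁ = c₂ := by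
  have e₁ := stepN_halted_of_le h₁ hc₁ (le_max_left k₁ k₂)
  have e₂ := stepN_halted_of_le h₂ hc₂ (le_max_right k₁ k₂)
  exact pure_injective (e₁.symm.trans e₂)

theorem time_le_of_mem_support_step {c c' : Config} (h : c' ∈ (step c).support) :
    c.time ≤ c'.time := by
  obtain ⟨todo, s, t⟩ := c
  rcases todo with _ | ⟨p, r⟩
  · simp only [step, PMF.support_pure, Set.mem_singleton_iff] at h
    simp [h]
  · cases p with
    | sample v e =>
      simp only [step, PMF.support_map, Set.mem_image] at h
      obtain ⟨a, -, rfl⟩ := h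
      show t ≤ t + 1 + e.cost s
      omega
    | _ =>
      simp only [step, PMF.support_pure, Set.mem_singleton_iff] at h
      subst h
      simp only
      omega

theorem time_le_of_mem_support_stepN {c c' : Config} {k : ℕ} (h : c' ∈ (stepN c k).support) :
    c.time ≤ c'.time := by
  induction k generalizing c' with
  | zero =>
    simp only [stepN, PMF.support_pure, Set.mem_singleton_iff] at h
    rw [h]
  | succ k ih =>
    simp only [stepN, PMF.mem_support_bind_iff] at h
    obtain ⟨d, hd, hd₂⟩ := h
    exact (ih hd).trans (time_le_of_mem_support_step hd₂)

/-- If after `K` steps the program has halted within time `B` on every random tape, then `B` bounds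
the expected running time. -/
theorem expectedTime_le {P : Prog} {x y : List ℕ} {T K B : ℕ}
    (hB : ∀ c ∈ (stepN (initConfig P x y T) K).support, c.todo = [] ∧ c.time ≤ B) :
    expectedTime P x y T ≤ B := by
  refine iSup_le fun k => ?_
  -- Running `K` further steps does not decrease the time, and by then the computation has halted
  -- within time `B`.
  have key : ∀ c ∈ (stepN (initConfig P x y T) k).support, c.time ≤ B := by
    intro c hc
    obtain ⟨c', hc'⟩ := (stepN c K).support_nonempty
    have h1 : c' ∈ (stepN (initConfig P x y T) (k + K)).support := by
      rw [stepN_add, PMF.mem_support_bind_iff]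
      exact ⟨c, hc, hc'⟩
    rw [Nat.add_comm, stepN_add, PMF.mem_support_bind_iff] at h1
    obtain ⟨d, hd, hd₂⟩ := h1
    rw [stepN_halted (hB d hd).1, PMF.support_pure, Set.mem_singleton_iff] at hd₂
    rw [← hd₂] at hd
    exact (time_le_of_mem_support_stepN hc').trans (hB c' hd).2
  calc ∑' c, stepN (initConfig P x y T) k c * (c.time : ENNReal)
      ≤ ∑' c, stepN (initConfig P x y T) k c * (B : ENNReal) := by
        refine ENNReal.tsum_le_tsum fun c => ?_
        by_cases hc : c ∈ (stepN (initConfig P x y T) k).support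
        · gcongr
          exact key c hc
        · rw [PMF.mem_support_iff, not_not] at hc
          simp [hc]
    _ = B := by rw [ENNReal.tsum_mul_right, PMF.tsum_coe, one_mul]

theorem outputProb_eq_one {P : Prog} {x y : List ℕ} {T K : ℕ} {Q : ℕ → Prop}
    (hQ : ∀ c ∈ (stepN (initConfig P x y T) K).support, c.todo = [] ∧ Q (c.mem.reg 2)) :
    outputProb P x y T Q = 1 := by
  refine le_antisymm (iSup_le fun k => ?_) (le_iSup_of_le K ?_)
  · refine (MeasureTheory.OuterMeasure.mono _ (Set.subset_univ _)).trans ?_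
    exact ((PMF.toOuterMeasure_apply_eq_one_iff _ _).2 (Set.subset_univ _)).le
  · exact ((PMF.toOuterMeasure_apply_eq_one_iff _ _).2 fun c hc => hQ c hc).ge

theorem le_outputProb {P : Prog} {x y : List ℕ} {T K : ℕ} {Q : ℕ → Prop} {Ω : Type*} [Fintype Ω]
    [Nonempty Ω] {f : Ω → Config}
    (h : stepN (initConfig P x y T) K = (PMF.uniformOfFintype Ω).map f) {B : Finset Ω}
    (hf : ∀ z, (f z).todo = []) (hB : ∀ z, z ∉ B → Q ((f z).mem.reg 2)) :
    ENNReal.ofReal (1 - (B.card : ℝ) / Fintype.card Ω) ≤ outputProb P x y T Q := by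
  classical
  refine le_iSup_of_le K ?_
  rw [h, PMF.toOuterMeasure_map_apply, PMF.toOuterMeasure_uniformOfFintype_apply]
  have hpos : (0 : ℝ) < Fintype.card Ω := by exact_mod_cast Fintype.card_pos
  have h1 : Fintype.card Ω ≤ Fintype.card (f ⁻¹' {c | c.todo = [] ∧ Q (c.mem.reg 2)}) + B.card := by
    have h2 : (Bᶜ).card ≤ Fintype.card (f ⁻¹' {c | c.todo = [] ∧ Q (c.mem.reg 2)}) := by
      rw [← Set.toFinset_card]
      refine Finset.card_le_card fun z hz => ?_
      simp only [Set.mem_toFinset, Set.mem_preimage, Set.mem_ofPred_eq]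
      exact ⟨hf z, hB z (by simpa using hz)⟩
    rw [Finset.card_compl] at h2
    omega
  rw [← ENNReal.ofReal_natCast, ← ENNReal.ofReal_natCast, ← ENNReal.ofReal_div_of_pos hpos]
  refine ENNReal.ofReal_le_ofReal ?_
  rw [le_div_iff₀ hpos, sub_mul, div_mul_cancel₀ _ hpos.ne']
  have : (Fintype.card Ω : ℝ) ≤ Fintype.card (f ⁻¹' {c | c.todo = [] ∧ Q (c.mem.reg 2)}) + B.card := by
    exact_mod_cast h1
  linarith

/-! ### Filling the tape -/

/-- After filling `r` cells of the tape from position `i₀` on with the numbers `z`. -/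
structure TapeFilled (V : ℕ) (s : Mem) (i₀ : ℕ) {r Q : ℕ} (z : Fin r → Fin Q) (s' : Mem) :
    Prop where
  bdd : s'.Bdd V
  reg : ∀ v, v ≠ r_idx → v ≠ r_tmp → s'.reg v = s.reg v
  arr : ∀ a, a ≠ a_tape → s'.arr a = s.arr a
  lt : ∀ i < i₀, s'.arr a_tape i = s.arr a_tape i
  eq : ∀ i : Fin r, s'.arr a_tape (i₀ + i) = z i
  ge : ∀ i, i₀ + r ≤ i → s'.arr a_tape i = s.arr a_tape i

/-- This is the only part that samples. An iteration takes six steps (test, sequence, sample,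
sequence, store, increment) whatever number is drawn. All branches stay synchronous, and the
distribution after a fixed number of steps is the image of a uniform vector. -/
theorem tapeProg_stepN {V K Q G R : ℕ} [NeZero Q] (hV : 2 ≤ V) (hK : (tapeProg G).Ok V K)
    (hRV : R ≤ V) (hQV : Q ≤ V) (rest : List Prog) (r : ℕ) (s : Mem) (t : ℕ) (hs : s.Bdd V)
    (hQ : s.reg r_Q = Q) (hR : G * s.reg r_H * (2 * s.reg r_n) = R) (hr : s.reg r_idx + r = R) :
    ∃ f : (Fin r → Fin Q) → Config,
      stepN ⟨tapeProg G :: rest, s, t⟩ (6 * r + 1) =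
        (PMF.uniformOfFintype (Fin r → Fin Q)).map f ∧
      ∀ z, (f z).todo = rest ∧ TapeFilled V s (s.reg r_idx) z (f z).mem ∧
        (f z).time ≤ t + (6 * r + 1) * stepCost V K := by
  have hc := Expr.Ok.cost_le hV hs hK.1
  set cond : Expr := !ₑr_idx <ₑ §G *ₑ !ₑr_H *ₑ (§2 *ₑ !ₑr_n) with hcond
  have hbody : tapeProg G = .loop cond
    (.sample r_tmp (!ₑr_Q) ;; .store a_tape (!ₑr_idx) (!ₑr_tmp) ;; r_idx ≔ !ₑr_idx +ₑ §1) := rfl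
  have hS : 1 + K * (2 + K * V.size) + K * (2 + K * V.size) = stepCost V K := by
    simp only [stepCost]; ring
  induction r generalizing s t with
  | zero =>
    have he : cond.eval s = 0 := by
      simp only [hcond, Expr.eval, Op.eval, hR]
      rw [if_neg (by omega)]
    refine ⟨fun _ => ⟨rest, s, t + 1 + cond.cost s⟩, ?_, fun z => ⟨rfl, ⟨hs, fun _ _ _ => rfl,
      fun _ _ => rfl, fun _ _ => rfl, fun i => i.elim0, fun _ _ => rfl⟩, ?_⟩⟩
    · rw [stepN_one, hbody]
      simp only [step, he, ne_eq, not_true_eq_false, if_false]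
      exact (PMF.map_const _ _).symm
    · simp only; omega
  | succ r ih =>
    have he : cond.eval s ≠ 0 := by
      simp only [hcond, Expr.eval, Op.eval, hR]
      rw [if_pos (by omega)]
      norm_num
    set s1 : ℕ → Mem := fun a => s.setReg r_tmp a with hs1
    set s2 : ℕ → Mem := fun a => (s1 a).setArr a_tape (s.reg r_idx) a with hs2
    set s3 : ℕ → Mem := fun a => (s2 a).setReg r_idx (s.reg r_idx + 1) with hs3
    set t3 : ℕ → ℕ := fun a => t + 1 + cond.cost s + 1 + 1 + (!ₑr_Q : Expr).cost s + 1 + 1 +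
      (!ₑr_idx : Expr).cost (s1 a) + (!ₑr_tmp : Expr).cost (s1 a) + 1 +
      (!ₑr_idx +ₑ §1 : Expr).cost (s2 a) with ht3
    have h6 : stepN ⟨tapeProg G :: rest, s, t⟩ 6 =
        (uniformBelow Q).map fun a => ⟨tapeProg G :: rest, s3 a, t3 a⟩ := by
      have hstep : stepN ⟨tapeProg G :: rest, s, t⟩ 6 =
        ((((((PMF.pure ⟨tapeProg G :: rest, s, t⟩).bind step).bind step).bind step).bind
          step).bind step).bind step := rfl
      rw [hstep, hbody]
      simp only [PMF.pure_bind, step, he, ne_eq, not_false_eq_true, if_true]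
      simp only [Expr.eval, hQ]
      simp only [PMF.bind_map, Function.comp_def, step, PMF.bind_bind, PMF.pure_bind]
      refine Eq.trans ?_ (PMF.bind_pure_comp _ _)
      congr 1
    have hbd : ∀ a, a < Q → (s1 a).Bdd V ∧ (s2 a).Bdd V ∧ (s3 a).Bdd V := by
      intro a ha
      have b1 : (s1 a).Bdd V := hs.setReg (by omega)
      have b2 : (s2 a).Bdd V := b1.setArr (by omega)
      exact ⟨b1, b2, b2.setReg (by omega)⟩
    -- Only numbers below `Q` are drawn, and only for these is the memory known to be bounded; the
    -- other values are filled with a dummy.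
    have hex : ∀ a : ℕ, ∃ f : (Fin r → Fin Q) → Config, a < Q →
        stepN ⟨tapeProg G :: rest, s3 a, t3 a⟩ (6 * r + 1) =
          (PMF.uniformOfFintype (Fin r → Fin Q)).map f ∧
        ∀ z, (f z).todo = rest ∧ TapeFilled V (s3 a) (s.reg r_idx + 1) z (f z).mem ∧
          (f z).time ≤ t3 a + (6 * r + 1) * stepCost V K := by
      intro a
      by_cases ha : a < Q
      · obtain ⟨b1, b2, b3⟩ := hbd a ha
        obtain ⟨f, hf1, hf2⟩ := ih (s3 a) (t3 a) b3 (by simpa [hs3, hs2, hs1] using hQ)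
          (by simpa [hs3, hs2, hs1] using hR) (by simp [hs3, hs2, hs1]; omega)
          (Expr.Ok.cost_le hV b3 hK.1)
        refine ⟨f, fun _ => ⟨hf1, fun z => ?_⟩⟩
        have := hf2 z
        simpa [hs3] using this
      · exact ⟨fun _ => ⟨[], s, t⟩, fun h => absurd h ha⟩
    choose f hf using hex
    refine ⟨fun z => f (z 0) (Fin.tail z), ?_, fun z => ?_⟩
    · rw [show 6 * (r + 1) + 1 = 6 + (6 * r + 1) by ring, stepN_add, h6, PMF.bind_map,
        ← uniformBelow_bind_map f, uniformBelow_eq_map, PMF.bind_map, PMF.bind_map]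
      congr 1
      funext a
      exact (hf a a.2).1
    · obtain ⟨h1, h2, h3⟩ := (hf (z 0) (z 0).2).2 (Fin.tail z)
      obtain ⟨b1, b2, b3⟩ := hbd _ (z 0).2
      refine ⟨h1, ⟨h2.bdd, fun v hv hv' => ?_, fun a ha => ?_, fun i hi => ?_, fun i => ?_,
        fun i hi => ?_⟩, ?_⟩
      · rw [h2.reg v hv hv']
        simp [hs3, hs2, hs1, hv, hv']
      · rw [h2.arr a ha]
        simp [hs3, hs2, hs1, ha]
      · rw [h2.lt i (by omega)]
        simp only [hs3, hs2, hs1, Mem.setReg_arr, Mem.setArr_arr, if_true]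
        rw [Function.update_of_ne (by omega)]
      · refine Fin.cases ?_ (fun i => ?_) i
        · rw [h2.lt _ (by simp)]
          simp [hs3, hs2, hs1]
        · have := h2.eq i
          rw [show s.reg r_idx + (i.succ : ℕ) = s.reg r_idx + 1 + i by simp; ring, this]
          rfl
      · rw [h2.ge i (by omega)]
        simp only [hs3, hs2, hs1, Mem.setReg_arr, Mem.setArr_arr, if_true]
        rw [Function.update_of_ne (by omega)]
      · have c0 := Expr.Ok.cost_le hV hs (e := !ₑr_Q) hK.2.1
        have c1 := Expr.Ok.cost_le hV b1 (e := !ₑr_idx) hK.2.2.1.1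
        have c2 := Expr.Ok.cost_le hV b1 (e := !ₑr_tmp) hK.2.2.1.2
        have c3 := Expr.Ok.cost_le hV b2 (e := !ₑr_idx +ₑ §1) hK.2.2.2
        refine h3.trans ?_
        simp only [ht3]
        rw [show (6 * (r + 1) + 1) * stepCost V K = 6 * stepCost V K + (6 * r + 1) * stepCost V K
          by ring]
        omega

end LCSApprox

/-! ### The final configuration as a function of the tape -/

namespace LCSApprox

theorem lcsProg_ok {V G : ℕ} (hG : G ≤ V) (hV : 2 ^ 24 ≤ V) : (lcsProg G).Ok V 32 := by
  have h1 : 1 ≤ V := le_trans (by norm_num) hV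
  have h2 : 2 ≤ V := le_trans (by norm_num) hV
  have h3 : 3 ≤ V := le_trans (by norm_num) hV
  have h7 : 7 ≤ V := le_trans (by norm_num) hV
  have h64 : 64 ≤ V := le_trans (by norm_num) hV
  have h128 : 128 ≤ V := le_trans (by norm_num) hV
  simp only [lcsProg, setupProg, tapeProg, mainProg, runProg, rowProg, dpProg, levelProg, rowsProg,
    pairProg, pairCond, tokenProg, insertProg, searchProg, bucketProg, forLoop, Prog.Ok, Expr.Ok,
    Expr.ConstLe, Expr.nodes, h1, h2, h3, h7, h64, h128, hG, hV, Nat.zero_le]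
  norm_num

theorem Config.eq_mk_of_todo_eq {c : Config} {l : List Prog} (h : c.todo = l) :
    c = ⟨l, c.mem, c.time⟩ := by
  subst h
  rfl

namespace Setup

variable (I : Setup)

/-- Number of random numbers on the tape. -/
abbrev R : ℕ := I.G * I.H * (2 * I.n)

/-- The random tapes. -/
abbrev Tape : Type := Fin I.R → Fin (2 ^ I.H)

/-- The content of the tape array. -/
def tapeOf (z : I.Tape) (t : ℕ) : ℕ := if h : t < I.R then z ⟨t, h⟩ else 0

theorem tapeOf_lt (z : I.Tape) (t : ℕ) : I.tapeOf z t < 2 ^ I.H := by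
  unfold tapeOf
  split
  · exact (z _).2
  · positivity

/-- Bound for the number of machine steps. -/
noncomputable def totalCost : ℕ :=
  10 * I.n + 16 * I.H + 63 + 6 * I.R + I.mainCost (10 * I.H + 25)

theorem R_le_V : I.R ≤ I.V := by
  unfold R V
  have h1 := I.H_lt.le
  have h2 : 2 * I.n ≤ 2 * 2 ^ I.H := by have := I.lt_pow; omega
  have h3 : I.H * (2 * I.n) ≤ 2 ^ (8 * I.H + 40) := by
    calc I.H * (2 * I.n) ≤ 2 ^ I.H * (2 * 2 ^ I.H) := Nat.mul_le_mul h1 h2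
      _ = 2 ^ (2 * I.H + 1) := by ring
      _ ≤ _ := Nat.pow_le_pow_right (by norm_num) (by omega)
  rw [mul_assoc]
  exact Nat.mul_le_mul (by nlinarith) h3

theorem G_le_V : I.G ≤ I.V := by
  unfold V
  have : 1 ≤ 2 ^ (8 * I.H + 40) := Nat.one_le_two_pow
  calc I.G ≤ (I.A + 1) * (I.G + 1) * 1 := by nlinarith
    _ ≤ _ := Nat.mul_le_mul_left _ this

/-- After sufficiently many steps the program has halted, and its output is described in terms of
the uniformly random tape. -/
theorem lcsProg_dist (hG : 1 ≤ I.G) :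
    ∃ (K : ℕ) (f : I.Tape → Config),
      stepN (initConfig (lcsProg I.G) I.x I.y I.T) K = (PMF.uniformOfFintype I.Tape).map f ∧
      ∀ z, (f z).todo = [] ∧ (f z).time ≤ I.totalCost * stepCost I.V 32 ∧
        (f z).mem.reg 2 ≤ lcs I.x I.y ∧
        ∀ (r : I.Run) (W : Run.Witness I), r.ζ = I.tapeOf z →
          ∑ i ∈ Finset.range I.N, r.rowUse i < I.F →
          W.θ * (r.goodBelow W.S W.ch I.N I.N).card ≤ (f z).mem.reg 2 := by
  have hV2 : 2 ≤ I.V := by have := I.n_lt_V; have := I.n_pos; omega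
  have hok : (lcsProg I.G).Ok I.V 32 := lcsProg_ok I.G_le_V (I.pow_le_V (by omega))
  set S := stepCost I.V 32 with hS
  have hS1 : 1 ≤ S := by simp [hS, stepCost]
  set w := 10 * I.H + 25 with hw
  -- The fuel register is `0` before and after the setup, so no credit enters the bound for `u1`.
  obtain ⟨s1, u1, ex1, b1, ⟨⟨C1, o1, i1⟩, f1⟩, c1⟩ := (setupProg_wp I (w := w)).mono
    (R := fun s' => (I.Ctx (fun _ => 0) s' ∧ s'.reg r_out = 0 ∧ s'.reg r_idx = 0) ∧
      s'.reg 7 = 0) (fun s' _ hF h => ⟨h, by rw [hF.1 7 (by decide)]; rfl⟩) le_rfl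
  have h70 : I.initMem.reg 7 = 0 := rfl
  rw [f1, h70] at c1
  obtain ⟨k1, t1, e1, d1⟩ := ex1.stepN_eq hV2 hok.1 [tapeProg I.G ;; mainProg I.G] 1
  have hinit : stepN (initConfig (lcsProg I.G) I.x I.y I.T) (1 + (k1 + 1)) =
      PMF.pure ⟨[tapeProg I.G, mainProg I.G], s1, t1 + 1⟩ := by
    refine stepN_pure_trans (c' := ⟨[setupProg, tapeProg I.G ;; mainProg I.G], I.initMem, 1⟩) ?_
      (stepN_pure_trans e1 ?_)
    · rw [stepN_one]; rfl
    · rw [stepN_one]; rfl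
  obtain ⟨f, hf, hft⟩ := tapeProg_stepN (V := I.V) (K := 32) (Q := 2 ^ I.H) (G := I.G) (R := I.R)
    hV2 hok.2.1 I.R_le_V (I.pow_le_V (by omega)) [mainProg I.G] I.R s1 (t1 + 1) b1 C1.Q
    (by rw [C1.H, C1.n]) (by omega)
  have hctx : ∀ z, I.Ctx (I.tapeOf z) (f z).mem := by
    intro z
    obtain ⟨-, h, -⟩ := hft z
    have ha : ∀ a, a ≠ 2 → (f z).mem.arr a = s1.arr a := h.arr
    refine ⟨?_, ?_, ?_, ?_, ?_, ?_, ?_, ?_, ?_, ?_, ?_⟩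
    · rw [h.reg _ (by decide) (by decide)]; exact C1.n
    · rw [h.reg _ (by decide) (by decide)]; exact C1.T
    · rw [h.reg _ (by decide) (by decide)]; exact C1.m
    · rw [h.reg _ (by decide) (by decide)]; exact C1.N
    · rw [h.reg _ (by decide) (by decide)]; exact C1.H
    · rw [h.reg _ (by decide) (by decide)]; exact C1.Q
    · rw [ha _ (by decide)]; exact C1.x
    · funext t
      unfold tapeOf
      split
      · rename_i ht
        have := h.eq ⟨t, ht⟩
        rwa [i1, Nat.zero_add] at this
      · rename_i ht
        rw [h.ge t (by omega), C1.tape]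
    · rw [ha _ (by decide)]; exact C1.pow
    · rw [ha _ (by decide)]; exact C1.cnt
    · rw [ha _ (by decide)]; exact C1.cell
  have hrun : ∀ z, ∀ (r : I.Run) (W : Run.Witness I), r.ζ = I.tapeOf z →
      (∑ i ∈ Finset.range I.N, r.rowUse i < I.F ∨ W.θ = 0) →
      ∃ k c, stepN (f z) k = PMF.pure c ∧ c.todo = [] ∧ c.time ≤ I.totalCost * S ∧
        c.mem.reg 2 ≤ lcs I.x I.y ∧ W.θ * (r.goodBelow W.S W.ch I.N I.N).card ≤ c.mem.reg 2 := by
    intro z r W hr hu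
    obtain ⟨h1, h2, h3⟩ := hft z
    have ho : (f z).mem.reg r_out = 0 := by rw [h2.reg _ (by decide) (by decide)]; exact o1
    have h7 : (f z).mem.reg 7 = 0 := by rw [h2.reg _ (by decide) (by decide)]; exact f1
    obtain ⟨s', u, ex, b, ⟨g1, g2⟩, cu⟩ := mainProg_wp (w := w) le_rfl h2.bdd r
      (by rw [hr]; exact hctx z) ho W hu
    obtain ⟨k, t, e, d⟩ := ex.stepN_eq hV2 hok.2.2 [] (f z).time
    refine ⟨k, ⟨[], s', t⟩, ?_, rfl, ?_, g1, g2⟩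
    · rw [Config.eq_mk_of_todo_eq h1]
      exact e
    · simp only
      rw [h7] at cu
      rw [← hS] at d d1 h3
      have m1 : u ≤ I.mainCost w := by omega
      have m2 : u1 ≤ 10 * I.n + 16 * I.H + 60 := by omega
      have m3 := Nat.mul_le_mul_right S m1
      have m4 := Nat.mul_le_mul_right S m2
      have : I.totalCost * S = (10 * I.n + 16 * I.H + 60) * S + 2 * S + (6 * I.R + 1) * S +
          I.mainCost w * S := by unfold totalCost; rw [← hw]; ring
      omega
  have hpos : 0 < I.G * I.H := Nat.mul_pos hG I.H_pos
  -- The empty witness with `θ = 0` shows that the program halts in time and soundly on every tape.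
  have hfin : ∀ z, ∃ k c, stepN (f z) k = PMF.pure c ∧ c.todo = [] ∧ c.time ≤ I.totalCost * S ∧
      c.mem.reg 2 ≤ lcs I.x I.y := by
    intro z
    obtain ⟨k, c, h1, h2, h3, h4, -⟩ := hrun z
      ⟨I.tapeOf z, 0, 0, 0, 0, hpos, Nat.zero_le _, Nat.zero_le _, by omega,
        fun t _ => I.tapeOf_lt z t⟩
      ⟨∅, fun _ _ => [], 0, by simp [IsBlockSeq], by simp, by simp⟩ rfl (Or.inr rfl)
    exact ⟨k, c, h1, h2, h3, h4⟩
  choose k c hk using hfin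
  -- Halted configurations are stationary, so the maximum of the finitely many halting times serves
  -- all tapes at once.
  refine ⟨1 + (k1 + 1) + (6 * I.R + 1 + Finset.univ.sup k), c, ?_, fun z => ⟨(hk z).2.1, (hk z).2.2.1,
    (hk z).2.2.2, fun r W hr hu => ?_⟩⟩
  · refine stepN_pure_trans hinit ?_
    rw [stepN_add, hf, PMF.bind_map, ← PMF.bind_pure_comp]
    refine congrArg _ (funext fun z => ?_)
    exact stepN_halted_of_le (hk z).1 (hk z).2.1 (Finset.le_sup (Finset.mem_univ z))
  · obtain ⟨k', c', h1, h2, -, -, h3⟩ := hrun z r W hr (Or.inl hu)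
    rw [halted_unique (hk z).1 h1 (hk z).2.1 h2]
    exact h3

end Setup

end LCSApprox

namespace LCSApprox

/-! ### Finite probability spaces -/

section mean

variable {Ω : Type*} [Fintype Ω]

/-- Mean value with respect to the uniform distribution. -/
noncomputable def mean (f : Ω → ℝ) : ℝ := (∑ ω, f ω) / Fintype.card Ω

open Classical in
/-- Probability with respect to the uniform distribution. -/
noncomputable def pr (P : Ω → Prop) : ℝ := mean fun ω => if P ω then 1 else 0

theorem mean_mono {f g : Ω → ℝ} (h : ∀ ω, f ω ≤ g ω) : mean f ≤ mean g := by
  unfold mean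
  gcongr
  exact h _

theorem mean_sum {ι : Type*} (s : Finset ι) (f : ι → Ω → ℝ) :
    mean (fun ω => ∑ i ∈ s, f i ω) = ∑ i ∈ s, mean (f i) := by
  unfold mean
  rw [Finset.sum_comm, Finset.sum_div]

theorem mean_add (f g : Ω → ℝ) : mean (fun ω => f ω + g ω) = mean f + mean g := by
  unfold mean
  rw [Finset.sum_add_distrib, add_div]

theorem mean_const_mul (a : ℝ) (f : Ω → ℝ) : mean (fun ω => a * f ω) = a * mean f := by
  unfold mean
  rw [← Finset.mul_sum, mul_div_assoc]

theorem mean_mul_const (a : ℝ) (f : Ω → ℝ) : mean (fun ω => f ω * a) = mean f * a := by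
  simp_rw [mul_comm _ a, mean_const_mul]

theorem mean_const [Nonempty Ω] (a : ℝ) : mean (fun _ : Ω => a) = a := by
  unfold mean
  have : (Fintype.card Ω : ℝ) ≠ 0 := by exact_mod_cast Fintype.card_ne_zero
  rw [Finset.sum_const, Finset.card_univ, nsmul_eq_mul]
  field_simp

theorem pr_nonneg (P : Ω → Prop) : 0 ≤ pr P := by
  unfold pr mean
  refine div_nonneg (Finset.sum_nonneg fun _ _ => ?_) (Nat.cast_nonneg _)
  split <;> norm_num

theorem pr_mono {P R : Ω → Prop} (h : ∀ ω, P ω → R ω) : pr P ≤ pr R := by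
  refine mean_mono fun ω => ?_
  by_cases hP : P ω
  · simp [hP, h ω hP]
  · simp only [hP, if_false]
    split <;> norm_num

theorem pr_or_le (P R : Ω → Prop) : pr (fun ω => P ω ∨ R ω) ≤ pr P + pr R := by
  unfold pr
  rw [← mean_add]
  refine mean_mono fun ω => ?_
  by_cases hP : P ω <;> by_cases hR : R ω <;> simp [hP, hR]

theorem pr_exists_le {ι : Type*} (s : Finset ι) (P : ι → Ω → Prop) :
    pr (fun ω => ∃ i ∈ s, P i ω) ≤ ∑ i ∈ s, pr (P i) := by
  unfold pr
  rw [← mean_sum]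
  refine mean_mono fun ω => ?_
  split
  · rename_i h
    obtain ⟨i, hi, hP⟩ := h
    refine le_trans ?_ (Finset.single_le_sum (fun j _ => ?_) hi)
    · simp [hP]
    · split <;> norm_num
  · refine Finset.sum_nonneg fun j _ => ?_
    split <;> norm_num

/-- Markov's inequality. -/
theorem mul_pr_le_mean {f : Ω → ℝ} (hf : ∀ ω, 0 ≤ f ω) (t : ℝ) :
    t * pr (fun ω => t ≤ f ω) ≤ mean f := by
  unfold pr
  rw [← mean_const_mul]
  refine mean_mono fun ω => ?_
  split
  · simpa
  · simpa using hf ω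

theorem pr_le_of_mean_le {f : Ω → ℝ} (hf : ∀ ω, 0 ≤ f ω) {t a : ℝ} (ht : 0 < t)
    (h : mean f ≤ a * t) : pr (fun ω => t ≤ f ω) ≤ a := by
  have := mul_pr_le_mean hf t
  nlinarith [pr_nonneg fun ω => t ≤ f ω]

theorem pr_eq_card_div (P : Ω → Prop) [DecidablePred P] :
    pr P = ((Finset.univ.filter P).card : ℝ) / Fintype.card Ω := by
  unfold pr mean
  rw [← Finset.sum_boole]
  refine congrArg (· / _) (Finset.sum_congr rfl fun ω _ => ?_)
  by_cases h : P ω <;> simp [h]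

end mean

section product

variable {ι : Type*} [Fintype ι] [DecidableEq ι] {κ : Type*} [Fintype κ]

/-- Exchanging the coordinate `ω c` with the fresh value `q` is an involution on pairs `(ω, q)`. -/
theorem sum_sum_update (c : ι) (g : (ι → κ) → ℝ) :
    ∑ ω : ι → κ, ∑ q : κ, g (Function.update ω c q) = Fintype.card κ * ∑ ω, g ω := by
  let e : ((ι → κ) × κ) ≃ ((ι → κ) × κ) :=
    { toFun := fun p => (Function.update p.1 c p.2, p.1 c)
      invFun := fun p => (Function.update p.1 c p.2, p.1 c)
      left_inv := fun p => by simp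
      right_inv := fun p => by simp }
  have h1 : ∑ ω : ι → κ, ∑ q : κ, g (Function.update ω c q) =
      ∑ p : (ι → κ) × κ, g (e p).1 := by
    rw [Fintype.sum_prod_type]
    rfl
  rw [h1, Equiv.sum_comp e fun p => g p.1, Fintype.sum_prod_type, Finset.mul_sum]
  simp

/-- A function of one coordinate is independent of a function of the other coordinates. -/
theorem mean_mul_of_update [Nonempty κ] (c : ι) (u : κ → ℝ) {f : (ι → κ) → ℝ}
    (hf : ∀ ω q, f (Function.update ω c q) = f ω) :
    mean (fun ω : ι → κ => u (ω c) * f ω) = mean u * mean f := by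
  have h := sum_sum_update c fun ω : ι → κ => u (ω c) * f ω
  simp only [Function.update_self, hf] at h
  simp_rw [← Finset.sum_mul, ← Finset.mul_sum] at h
  have hk : (Fintype.card κ : ℝ) ≠ 0 := by exact_mod_cast Fintype.card_ne_zero
  unfold mean
  rw [eq_div_of_mul_eq hk ((mul_comm _ _).trans h.symm)]
  ring

theorem mean_coord [Nonempty κ] (c : ι) (u : κ → ℝ) :
    mean (fun ω : ι → κ => u (ω c)) = mean u := by
  have := mean_mul_of_update (ι := ι) c u (f := fun _ => 1) (fun _ _ => rfl)
  simpa [mean_const] using this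

/-- Chebyshev's inequality for a sum of independent indicators of mean `p`. -/
theorem pr_sum_coord_lt [Nonempty κ] (C : Finset ι) (u : κ → ℝ) (hu : ∀ q, u q = 0 ∨ u q = 1)
    {p : ℝ} (hp : mean u = p) (hpos : 0 < C.card * p) {t : ℝ} (ht : 2 * t ≤ C.card * p) :
    pr (fun ω : ι → κ => ∑ c ∈ C, u (ω c) < t) ≤ 4 / (C.card * p) := by
  set a : ℝ := C.card * p with ha
  set u' : κ → ℝ := fun q => u q - p with hu'
  have hmu' : mean u' = 0 := by
    have := mean_add u (fun _ => -p)
    rw [mean_const, hp] at this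
    simpa [hu', sub_eq_add_neg] using this
  have hvar : ∀ c ∈ C, ∀ c' ∈ C, mean (fun ω : ι → κ => u' (ω c) * u' (ω c')) ≤
      if c = c' then p else 0 := by
    intro c _ c' _
    split
    · rename_i h
      subst h
      have h1 := mean_coord (ι := ι) c fun q => u' q * u' q
      rw [h1]
      -- An indicator equals its square, so the variance is `p - p ^ 2 ≤ p`.
      have h2 : ∀ q, u' q * u' q = (1 - 2 * p) * u q + p ^ 2 := by
        intro q
        rcases hu q with h | h <;> simp only [hu', h] <;> ring
      simp_rw [h2]
      rw [mean_add, mean_const, mean_const_mul, hp]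
      nlinarith [sq_nonneg p]
    · rename_i h
      refine (mean_mul_of_update c u' (f := fun ω => u' (ω c')) fun ω q => ?_).le.trans ?_
      · rw [Function.update_of_ne (Ne.symm h)]
      · rw [hmu', zero_mul]
  have hsq : mean (fun ω : ι → κ => (∑ c ∈ C, u (ω c) - a) ^ 2) ≤ a := by
    have h1 : ∀ ω : ι → κ, (∑ c ∈ C, u (ω c) - a) ^ 2 =
        ∑ c ∈ C, ∑ c' ∈ C, u' (ω c) * u' (ω c') := by
      intro ω
      have : ∑ c ∈ C, u (ω c) - a = ∑ c ∈ C, u' (ω c) := by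
        simp only [hu', Finset.sum_sub_distrib, Finset.sum_const, nsmul_eq_mul, ha]
      rw [this, sq, Finset.sum_mul_sum]
    simp_rw [h1]
    rw [mean_sum]
    calc ∑ c ∈ C, mean (fun ω : ι → κ => ∑ c' ∈ C, u' (ω c) * u' (ω c'))
        = ∑ c ∈ C, ∑ c' ∈ C, mean (fun ω : ι → κ => u' (ω c) * u' (ω c')) :=
          Finset.sum_congr rfl fun c _ => mean_sum _ _
      _ ≤ ∑ c ∈ C, ∑ c' ∈ C, (if c = c' then p else 0) :=
          Finset.sum_le_sum fun c hc => Finset.sum_le_sum fun c' hc' => hvar c hc c' hc'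
      _ = a := by
          rw [ha, ← nsmul_eq_mul, ← Finset.sum_const]
          refine Finset.sum_congr rfl fun c hc => ?_
          rw [Finset.sum_ite_eq, if_pos hc]
  -- Falling below `t ≤ a / 2` is a deviation of at least `a / 2` from the mean; a variance of at
  -- most `a` then gives `4 / a`.
  refine (pr_mono (R := fun ω : ι → κ => (a / 2) ^ 2 ≤ (∑ c ∈ C, u (ω c) - a) ^ 2)
    fun ω h => ?_).trans (pr_le_of_mean_le (fun ω => sq_nonneg _) (by positivity) ?_)
  · have : a / 2 ≤ a - ∑ c ∈ C, u (ω c) := by linarith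
    nlinarith
  · refine hsq.trans (le_of_eq ?_)
    field_simp
    ring

end product

/-- The indicator of a selection at rate `1 / d`. -/
def rate (d : ℕ) {Q : ℕ} (q : Fin Q) : ℝ := if (q : ℕ) * d < Q then 1 else 0

theorem rate_eq (d : ℕ) {Q : ℕ} (q : Fin Q) : rate d q = 0 ∨ rate d q = 1 := by
  unfold rate
  split <;> simp

/-- Since the range is a power of two, the condition reads `q < 2 ^ (H - h)`, and the rate is exact.
-/
theorem mean_rate {h H : ℕ} (hh : h ≤ H) : mean (rate (2 ^ h) (Q := 2 ^ H)) = 1 / 2 ^ h := by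
  obtain ⟨l, rfl⟩ := Nat.exists_eq_add_of_le hh
  unfold mean rate
  rw [Finset.sum_boole, Fintype.card_fin]
  have h1 : (Finset.univ.filter fun q : Fin (2 ^ (h + l)) => (q : ℕ) * 2 ^ h < 2 ^ (h + l)).card =
      2 ^ l := by
    have h2 : (Finset.univ.filter fun q : Fin (2 ^ (h + l)) => (q : ℕ) * 2 ^ h < 2 ^ (h + l)) =
        Finset.univ.filter fun q : Fin (2 ^ (h + l)) => (q : ℕ) < 2 ^ l := by
      refine Finset.filter_congr fun q _ => ?_
      have h3 : 2 ^ (h + l) = 2 ^ l * 2 ^ h := by rw [pow_add, mul_comm]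
      have h4 := Nat.mul_lt_mul_right (show 0 < 2 ^ h by positivity) (b := (q : ℕ)) (c := 2 ^ l)
      rw [← h3] at h4
      exact h4
    rw [h2, Fin.card_filter_val_lt]
    exact min_eq_right (Nat.pow_le_pow_right (by norm_num) (by omega))
  rw [h1]
  push_cast
  rw [pow_add]
  field_simp

end LCSApprox

namespace LCSApprox

namespace Setup

/-! ### One round -/

/-- The random numbers of one round. -/
abbrev Round (I : Setup) : Type := Fin (2 * I.n) → Fin (2 ^ I.H)

/-- Position `a` of the tape of a round. -/
def coord (I : Setup) (a : ℕ) : Fin (2 * I.n) :=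
  ⟨a % (2 * I.n), Nat.mod_lt _ (by have := I.n_pos; omega)⟩

theorem coord_injOn (I : Setup) {a b : ℕ} (ha : a < 2 * I.n) (hb : b < 2 * I.n)
    (h : I.coord a = I.coord b) : a = b := by
  simpa [coord, Nat.mod_eq_of_lt ha, Nat.mod_eq_of_lt hb] using h

/-- The parameters of a run. -/
structure Params (I : Setup) where
  u : ℕ
  v : ℕ
  w : ℕ
  u_le : u ≤ I.H
  v_le : v ≤ I.H
  w_lt : w < 3 * I.H + 7
  G_pos : 1 ≤ I.G

/-- Number of matching pairs of a block pair. -/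
noncomputable def bmatch (I : Setup) (i j : ℕ) : ℕ :=
  matchingPairs (block I.m I.x i) (block I.m I.y j)

/-- The positions in block `i`. -/
noncomputable def blockRows (I : Setup) (i : ℕ) : Finset ℕ :=
  (Finset.range I.n).filter fun a => a / I.m = i

/-- Number of partners in block `j` of position `a`. -/
noncomputable def deg (I : Setup) (j a : ℕ) : ℕ := (block I.m I.y j).count (I.x.getD a 0)

theorem mem_blockRows {I : Setup} {i a : ℕ} : a ∈ I.blockRows i ↔ a < I.n ∧ a / I.m = i := by
  simp [blockRows]

theorem blockRows_eq_image (I : Setup) (i : ℕ) :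
    I.blockRows i = (Finset.range (block I.m I.x i).length).image fun a => i * I.m + a := by
  ext a
  rw [mem_blockRows, div_eq_iff_block I.m_pos]
  simp only [Finset.mem_image, Finset.mem_range, block_length, I.input.length_x, lt_min_iff]
  constructor
  · rintro ⟨h1, h2, h3⟩
    exact ⟨a - i * I.m, ⟨by omega, by omega⟩, by omega⟩
  · rintro ⟨b, ⟨h1, h2⟩, rfl⟩
    omega

theorem card_blockRows_le (I : Setup) (i : ℕ) : (I.blockRows i).card ≤ I.m := by
  rw [blockRows_eq_image]
  exact Finset.card_image_le.trans (by simpa using block_length_le I.m I.x i)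

theorem sum_deg (I : Setup) (i j : ℕ) : ∑ a ∈ I.blockRows i, I.deg j a = I.bmatch i j := by
  rw [blockRows_eq_image, Finset.sum_image (by intro a _ b _ h; simpa using h), bmatch,
    matchingPairs_eq_sum]
  refine Finset.sum_congr rfl fun a ha => ?_
  rw [Finset.mem_range] at ha
  rw [deg, block_getD _ _ (ha.trans_le (block_length_le _ _ _))]

namespace Params

variable {I : Setup} (P : I.Params)

/-- The run with the given parameters on the tape `ω`. -/
def run (ω : I.Round) : I.Run where
  ζ t := ω (I.coord t)
  g := 0
  u := P.u
  v := P.v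
  w := P.w
  g_lt := Nat.mul_pos P.G_pos I.H_pos
  u_le := P.u_le
  v_le := P.v_le
  w_lt := P.w_lt
  tape_lt _ _ := (ω _).2

theorem run_z (ω : I.Round) (a : ℕ) : (P.run ω).z a = ω (I.coord a) := by
  simp [Run.z, run]

theorem mem_rows {ω : I.Round} {i d a : ℕ} :
    a ∈ (P.run ω).rows i d ↔ a ∈ I.blockRows i ∧ (ω (I.coord a) : ℕ) * d < 2 ^ I.H := by
  unfold Run.rows
  rw [mem_rowsBelow I.m_pos, mem_blockRows, run_z]
  tauto

theorem length_work (ω : I.Round) (i j d : ℕ) :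
    (((P.run ω).work i j d).length : ℝ) =
      ∑ a ∈ I.blockRows i, rate d (ω (I.coord a)) * (1 + I.deg j a) := by
  have hnd : ((P.run ω).rows i d).Nodup := (rowsBelow_pairwise _ _ _ _ _).imp fun h => ne_of_lt h
  unfold Run.work
  rw [tokens_length, ← List.sum_toFinset _ hnd]
  have h1 : ((P.run ω).rows i d).toFinset =
      (I.blockRows i).filter fun a => (ω (I.coord a) : ℕ) * d < 2 ^ I.H := by
    ext a
    simp [mem_rows]
  rw [h1, Finset.sum_filter]
  push_cast
  refine Finset.sum_congr rfl fun a _ => ?_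
  rw [occ_length I.m_pos]
  unfold rate deg
  split <;> simp

/-- Linearity of expectation: row `a` is kept with probability `2 ^ (-h)` and then contributes a row
marker and `deg` points. -/
theorem mean_work_le {h : ℕ} (hh : h ≤ I.H) (i j : ℕ) :
    mean (fun ω : I.Round => (((P.run ω).work i j (2 ^ h)).length : ℝ)) ≤
      (I.m + I.bmatch i j) / 2 ^ h := by
  simp_rw [length_work]
  rw [mean_sum]
  have h1 : ∀ a ∈ I.blockRows i,
      mean (fun ω : I.Round => rate (2 ^ h) (ω (I.coord a)) * (1 + (I.deg j a : ℝ))) =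
        (1 / 2 ^ h) * (1 + I.deg j a) := by
    intro a _
    rw [mean_mul_const, mean_coord (I.coord a) (rate (2 ^ h)), mean_rate hh]
  rw [Finset.sum_congr rfl h1, ← Finset.mul_sum, Finset.sum_add_distrib]
  have h2 : ((I.blockRows i).card : ℝ) ≤ I.m := by exact_mod_cast I.card_blockRows_le i
  have h3 : ∑ a ∈ I.blockRows i, (I.deg j a : ℝ) = I.bmatch i j := by
    exact_mod_cast I.sum_deg i j
  rw [h3, Finset.sum_const, nsmul_eq_mul, mul_one, div_mul_eq_mul_div, one_mul]
  gcongr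

/-- The points of a chain lie in distinct rows, so the hits are a sum over distinct coordinates,
ready for Chebyshev's inequality. The set of coordinates is the same for all rates. -/
theorem hits_eq {i j : ℕ} {c : List (ℕ × ℕ)} (hc : IsBlockChain I.m I.x I.y i j c) :
    ∃ C : Finset (Fin (2 * I.n)), C.card = c.length ∧
      ∀ (ω : I.Round) (d : ℕ), ((P.run ω).hits i c d : ℝ) = ∑ a ∈ C, rate d (ω a) := by
  have hlt : ∀ p ∈ c, p.1 ∈ I.blockRows i := by
    intro p hp
    rw [mem_blockRows, ← I.input.length_x]
    exact ⟨(hc.1.2 p hp).1, (hc.2 p hp).1⟩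
  have hnd : (c.map fun p => I.coord p.1).Nodup := by
    rw [List.Nodup, List.pairwise_map]
    refine hc.1.1.imp_of_mem fun {p q} hp hq hpq h => ?_
    have h1 := (mem_blockRows.1 (hlt p hp)).1
    have h2 := (mem_blockRows.1 (hlt q hq)).1
    exact absurd (I.coord_injOn (by omega) (by omega) h) (ne_of_lt hpq.1)
  refine ⟨(c.map fun p => I.coord p.1).toFinset, ?_, fun ω d => ?_⟩
  · rw [List.toFinset_card_of_nodup hnd, List.length_map]
  · rw [List.sum_toFinset _ hnd, List.map_map]
    unfold Run.hits
    clear hnd hc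
    induction c with
    | nil => simp
    | cons p c ih =>
      have h1 := hlt p (by simp)
      have h2 := ih fun q hq => hlt q (by simp [hq])
      rw [List.filter_cons, List.map_cons, List.sum_cons, ← h2]
      by_cases hm : p.1 ∈ (P.run ω).rows i d
      · have h3 := ((P.mem_rows).1 hm).2
        simp [hm, rate, h3]
        ring
      · have h3 : ¬ (ω (I.coord p.1) : ℕ) * d < 2 ^ I.H := fun h => hm ((P.mem_rows).2 ⟨h1, h⟩)
        simp [hm, rate, h3]

/-- Markov's inequality: the cap is at least `64 H` times the mean work. The factor `H` allows a
union bound over all levels. -/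
theorem pr_work_gt_le {h : ℕ} (hh : h ≤ I.H) {i j : ℕ} (hw : I.bmatch i j ≤ 2 ^ P.w) :
    pr (fun ω : I.Round => (P.run ω).cap (2 ^ h) < ((P.run ω).work i j (2 ^ h)).length) ≤
      1 / (64 * I.H) := by
  have hH : (1 : ℝ) ≤ I.H := by exact_mod_cast I.H_pos
  have hm : (1 : ℝ) ≤ I.m := by exact_mod_cast I.m_pos
  set b : ℝ := (I.m + 2 ^ P.w) / 2 ^ h with hb
  -- The summand `1` in `cap` makes up for the rounding in the integer quotient.
  have hcap : ∀ ω : I.Round, 64 * I.H * b ≤ (P.run ω).cap (2 ^ h) := by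
    intro ω
    unfold Run.cap
    push_cast
    refine mul_le_mul_of_nonneg_left ?_ (by positivity)
    have h1 := Nat.lt_div_mul_add (a := I.m + 2 ^ P.w) (b := 2 ^ h) (by positivity)
    have h2 : ((I.m + 2 ^ P.w : ℕ) : ℝ) ≤ (((I.m + 2 ^ P.w) / 2 ^ h * 2 ^ h + 2 ^ h : ℕ) : ℝ) := by
      exact_mod_cast h1.le
    rw [hb, div_le_iff₀ (by positivity)]
    push_cast at h2
    have h3 : (P.run ω).w = P.w := rfl
    rw [h3]
    linarith
  refine (pr_mono (R := fun ω : I.Round =>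
    64 * I.H * b ≤ (((P.run ω).work i j (2 ^ h)).length : ℝ)) fun ω hω => ?_).trans
    (pr_le_of_mean_le (fun ω => Nat.cast_nonneg _) (by positivity) ?_)
  · refine (hcap ω).trans ?_
    exact_mod_cast hω.le
  · refine (P.mean_work_le hh i j).trans ?_
    have h1 : (I.bmatch i j : ℝ) ≤ 2 ^ P.w := by exact_mod_cast hw
    have h2 : (1 : ℝ) / (64 * I.H) * (64 * I.H * b) = b := by field_simp
    rw [h2, hb]
    gcongr

/-- A cap is exceeded at some level with probability at most `(H + 1) / (64 H) ≤ 1 / 32`. At level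
`k` a chain of length at least `256 * 2 ^ u` has mean number of hits at least `256 * 2 ^ k`, twice
the next threshold, so Chebyshev's bound is `2 ^ (-k) / 64`, which sums to at most `1 / 32`. -/
theorem pr_not_good_le {i j : ℕ} {c : List (ℕ × ℕ)} (hc : IsBlockChain I.m I.x I.y i j c)
    (hu : P.u = 0 ∨ 256 * 2 ^ P.u ≤ c.length) (hw : I.bmatch i j ≤ 2 ^ P.w) :
    pr (fun ω : I.Round => ¬ (P.run ω).Good i j c) ≤ 1 / 16 := by
  have hH : (1 : ℝ) ≤ I.H := by exact_mod_cast I.H_pos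
  have hsplit : ∀ ω : I.Round, ¬ (P.run ω).Good i j c →
      (∃ k ∈ Finset.range (P.u + 1), (P.run ω).cap (2 ^ (P.u - k)) <
        ((P.run ω).work i j (2 ^ (P.u - k))).length) ∨
      ∃ k ∈ Finset.range P.u, (P.run ω).hits i c (2 ^ (P.u - k)) < Run.thr (k + 1) := by
    intro ω h
    by_contra hcon
    push Not at hcon
    refine h ⟨fun k hk => hcon.1 k ?_, fun k hk => hcon.2 k ?_⟩
    · have : k ≤ P.u := hk
      simp; omega
    · have : k < P.u := hk
      simpa using this
  refine (pr_mono hsplit).trans ((pr_or_le _ _).trans ?_)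
  have h1 : pr (fun ω : I.Round => ∃ k ∈ Finset.range (P.u + 1), (P.run ω).cap (2 ^ (P.u - k)) <
      ((P.run ω).work i j (2 ^ (P.u - k))).length) ≤ 1 / 32 := by
    refine (pr_exists_le _ _).trans ((Finset.sum_le_sum fun k _ =>
      P.pr_work_gt_le (h := P.u - k) ((Nat.sub_le _ _).trans P.u_le) hw).trans ?_)
    rw [Finset.sum_const, Finset.card_range, nsmul_eq_mul, mul_one_div,
      div_le_div_iff₀ (by positivity) (by norm_num)]
    have : (P.u : ℝ) ≤ I.H := by exact_mod_cast P.u_le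
    push_cast
    linarith
  have h2 : pr (fun ω : I.Round => ∃ k ∈ Finset.range P.u,
      (P.run ω).hits i c (2 ^ (P.u - k)) < Run.thr (k + 1)) ≤ 1 / 32 := by
    refine (pr_exists_le _ _).trans ?_
    obtain ⟨C, hC, hh⟩ := P.hits_eq hc
    have h3 : ∀ k ∈ Finset.range P.u, pr (fun ω : I.Round =>
        (P.run ω).hits i c (2 ^ (P.u - k)) < Run.thr (k + 1)) ≤ 1 / 64 * (1 / 2) ^ k := by
      intro k hk
      rw [Finset.mem_range] at hk
      have hlen : 256 * 2 ^ P.u ≤ c.length := hu.resolve_left (by omega)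
      have hlen' : (256 * 2 ^ P.u : ℝ) ≤ C.card := by rw [hC]; exact_mod_cast hlen
      have hpow : (2 : ℝ) ^ P.u = 2 ^ k * 2 ^ (P.u - k) := by
        rw [← pow_add]; congr 1; omega
      have hmean : 256 * 2 ^ k ≤ (C.card : ℝ) * (1 / 2 ^ (P.u - k)) := by
        rw [mul_one_div, le_div_iff₀ (by positivity)]
        linarith
      have hp := mean_rate (h := P.u - k) (H := I.H) ((Nat.sub_le _ _).trans P.u_le)
      have hcheb := pr_sum_coord_lt (ι := Fin (2 * I.n)) C (rate (2 ^ (P.u - k))) (rate_eq _)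
        hp (lt_of_lt_of_le (by positivity) hmean) (t := 128 * 2 ^ k) (by linarith)
      refine (pr_mono fun ω hω => ?_).trans (hcheb.trans ?_)
      · rw [← hh]
        have : Run.thr (k + 1) = 128 * 2 ^ k := by
          unfold Run.thr
          rw [pow_succ, Nat.mul_div_cancel _ (by norm_num)]
        rw [this] at hω
        exact_mod_cast hω
      · refine (div_le_div_of_nonneg_left (by norm_num) (by positivity) hmean).trans (le_of_eq ?_)
        rw [one_div_pow]
        field_simp
        norm_num
    refine (Finset.sum_le_sum h3).trans ?_
    rw [← Finset.mul_sum]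
    have h4 : ∑ k ∈ Finset.range P.u, ((1 : ℝ) / 2) ^ k ≤ 2 := by
      rw [geom_sum_eq (by norm_num)]
      have : (0 : ℝ) ≤ (1 / 2) ^ P.u := by positivity
      rw [div_le_iff_of_neg (by norm_num)]
      linarith
    linarith
  linarith

/-- Row sampling reads only the coordinates below `n`, so everything derived from it is independent
of the selection of blocks. -/
theorem rows_update (ω : I.Round) {i' : ℕ} (hi' : i' < I.n) (q : Fin (2 ^ I.H)) (i d : ℕ) :
    (P.run (Function.update ω (I.coord (I.n + i')) q)).rows i d = (P.run ω).rows i d := by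
  unfold Run.rows rowsBelow
  refine List.filter_congr fun a _ => ?_
  by_cases ha : a < I.n
  · simp only [run_z]
    rw [Function.update_of_ne]
    intro h
    have := I.coord_injOn (by omega) (by omega) h
    omega
  · simp [ha]

theorem good_update (ω : I.Round) {i' : ℕ} (hi' : i' < I.n) (q : Fin (2 ^ I.H)) (i j : ℕ)
    (c : List (ℕ × ℕ)) : (P.run (Function.update ω (I.coord (I.n + i')) q)).Good i j c ↔
      (P.run ω).Good i j c := by
  unfold Run.Good Run.hits Run.work
  simp only [P.rows_update ω hi']
  rfl

theorem pairUse_update (ω : I.Round) {i' : ℕ} (hi' : i' < I.n) (q : Fin (2 ^ I.H)) (i j k : ℕ) :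
    (P.run (Function.update ω (I.coord (I.n + i')) q)).pairUse i j k =
      (P.run ω).pairUse i j k := by
  unfold Run.pairUse Run.work
  simp only [P.rows_update ω hi']
  rfl

theorem sel_iff (ω : I.Round) (i : ℕ) :
    (P.run ω).Sel i ↔ rate (2 ^ P.v) (ω (I.coord (I.n + i))) = 1 := by
  unfold Run.Sel rate
  rw [run_z]
  have : (P.run ω).v = P.v := rfl
  rw [this]
  split <;> simp [*]

theorem mean_sel_mul {i : ℕ} {f : I.Round → ℝ}
    (hf : ∀ ω q, f (Function.update ω (I.coord (I.n + i)) q) = f ω) :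
    mean (fun ω : I.Round => if (P.run ω).Sel i then f ω else 0) = 1 / 2 ^ P.v * mean f := by
  rw [← mean_rate P.v_le, ← mean_mul_of_update (I.coord (I.n + i)) (rate (2 ^ P.v)) hf]
  congr 1
  funext ω
  have hs := P.sel_iff ω i
  split
  · rename_i h
    rw [hs.1 h, one_mul]
  · rename_i h
    rw [(rate_eq _ _).resolve_right fun h' => h (hs.2 h'), zero_mul]

end Params

end Setup

end LCSApprox

/-! ### Mean fuel and success probability of one round -/

namespace LCSApprox

namespace Setup

namespace Params

variable {I : Setup} (P : I.Params)

/-- Bound for the mean amount of work on the block pair `(i, j)`, if block `i` is selected. -/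
noncomputable def pairMean (i j : ℕ) : ℝ :=
  (I.m + I.bmatch i j) / 2 ^ P.u +
    Run.blcs I i j * (I.H * (P.u * ((I.m + 2 ^ P.w) / 2 ^ P.u) + 1))

/-- The charging argument. Level `k + 1` is entered only if the LCS is at least `128 * 2 ^ k`, and
the cap there is at most `128 * 2 ^ k` times the bracket on the right. The doubling of the sampling
rate is thus paid for by the doubling of the threshold. -/
theorem pairUse_succ_le (ω : I.Round) (i j : ℕ) {k : ℕ} (hk : k < P.u) :
    ((P.run ω).pairUse i j (k + 1) : ℝ) ≤
      Run.blcs I i j * (I.H * ((I.m + 2 ^ P.w) / 2 ^ P.u + 1 / 2 * (1 / 2) ^ k)) := by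
  have hthr : Run.thr (k + 1) = 128 * 2 ^ k := by
    unfold Run.thr
    rw [pow_succ, Nat.mul_div_cancel _ (by norm_num)]
  unfold Run.pairUse
  rw [if_neg (by omega)]
  split
  · rename_i h
    rw [hthr] at h
    have h1 : (128 * 2 ^ k : ℝ) ≤ Run.blcs I i j := by exact_mod_cast h
    have hpow : (2 : ℝ) ^ P.u = 2 ^ (k + 1) * 2 ^ (P.u - (k + 1)) := by
      rw [← pow_add]; congr 1; omega
    have h2 : ((P.run ω).cap (2 ^ (P.u - (k + 1))) : ℝ) ≤
        64 * I.H * ((I.m + 2 ^ P.w) / 2 ^ (P.u - (k + 1)) + 1) := by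
      unfold Run.cap
      push_cast
      refine mul_le_mul_of_nonneg_left ?_ (by positivity)
      gcongr
      refine Nat.cast_div_le.trans (le_of_eq ?_)
      push_cast
      rfl
    refine h2.trans ?_
    have h3 : (64 * I.H * ((I.m + 2 ^ P.w) / 2 ^ (P.u - (k + 1)) + 1) : ℝ) =
        (128 * 2 ^ k) * (I.H * ((I.m + 2 ^ P.w) / 2 ^ P.u + 1 / 2 * (1 / 2) ^ k)) := by
      rw [hpow, one_div_pow, pow_succ]
      field_simp
      ring
    rw [h3]
    exact mul_le_mul_of_nonneg_right h1 (by positivity)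
  · push_cast
    positivity

/-- Only level `0` is averaged; the later levels are bounded on every tape. Their additive terms
form a geometric series of sum at most `1`. -/
theorem mean_pairUse_le (i j : ℕ) :
    mean (fun ω : I.Round => ∑ k ∈ Finset.range (P.u + 1), ((P.run ω).pairUse i j k : ℝ)) ≤
      P.pairMean i j := by
  have h0 : ∀ ω : I.Round, ∑ k ∈ Finset.range (P.u + 1), ((P.run ω).pairUse i j k : ℝ) ≤
      (((P.run ω).work i j (2 ^ P.u)).length : ℝ) +
        Run.blcs I i j * (I.H * (P.u * ((I.m + 2 ^ P.w) / 2 ^ P.u) + 1)) := by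
    intro ω
    rw [Finset.sum_range_succ', add_comm]
    refine add_le_add (le_of_eq rfl) ?_
    refine (Finset.sum_le_sum fun k hk =>
      P.pairUse_succ_le ω i j (Finset.mem_range.1 hk)).trans ?_
    rw [← Finset.mul_sum, ← Finset.mul_sum, Finset.sum_add_distrib, Finset.sum_const,
      Finset.card_range, nsmul_eq_mul, ← Finset.mul_sum]
    have h4 : ∑ k ∈ Finset.range P.u, ((1 : ℝ) / 2) ^ k ≤ 2 := by
      rw [geom_sum_eq (by norm_num)]
      have : (0 : ℝ) ≤ (1 / 2) ^ P.u := by positivity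
      rw [div_le_iff_of_neg (by norm_num)]
      linarith
    gcongr
    linarith
  refine (mean_mono h0).trans ?_
  rw [mean_add, mean_const]
  exact add_le_add (P.mean_work_le P.u_le i j) le_rfl

theorem mean_rowUse_le {i : ℕ} (hi : i < I.n) :
    mean (fun ω : I.Round => ((P.run ω).rowUse i : ℝ)) ≤
      1 / 2 ^ P.v * ∑ j ∈ Finset.range I.N, P.pairMean i j := by
  have h1 : ∀ ω : I.Round, ((P.run ω).rowUse i : ℝ) = if (P.run ω).Sel i then
      ∑ j ∈ Finset.range I.N, ∑ k ∈ Finset.range (P.u + 1), ((P.run ω).pairUse i j k : ℝ)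
      else 0 := by
    intro ω
    unfold Run.rowUse
    split
    · rw [Finset.sum_comm]
      push_cast
      rfl
    · simp
  simp_rw [h1]
  rw [P.mean_sel_mul]
  · refine mul_le_mul_of_nonneg_left ?_ (by positivity)
    rw [mean_sum]
    exact Finset.sum_le_sum fun j _ => P.mean_pairUse_le i j
  · intro ω q
    simp only [P.pairUse_update ω hi]

/-- With probability at least `1 / 2` a round has enough fuel and finds many good pairs. -/
theorem pr_round_bad_le {S : Finset (ℕ × ℕ)} (hSN : S ⊆ blockPairs I.n I.m) (hS : IsBlockSeq S)
    {ch : ℕ → ℕ → List (ℕ × ℕ)}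
    (hch : ∀ p ∈ S, IsBlockChain I.m I.x I.y p.1 p.2 (ch p.1 p.2))
    (hu : ∀ p ∈ S, P.u = 0 ∨ 256 * 2 ^ P.u ≤ (ch p.1 p.2).length)
    (hw : ∀ p ∈ S, I.bmatch p.1 p.2 ≤ 2 ^ P.w)
    (hF : 1 / 2 ^ P.v * ∑ i ∈ Finset.range I.N, ∑ j ∈ Finset.range I.N, P.pairMean i j ≤ I.F / 8)
    (hg : 32 ≤ (S.card : ℝ) * (1 / 2 ^ P.v)) :
    pr (fun ω : I.Round => ¬ (∑ i ∈ Finset.range I.N, (P.run ω).rowUse i < I.F ∧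
      (S.card : ℝ) * (1 / 2 ^ P.v) / 4 ≤ ((P.run ω).goodBelow S ch I.N I.N).card)) ≤ 1 / 2 := by
  classical
  set ρ : ℝ := 1 / 2 ^ P.v with hρ
  have hlt : ∀ p ∈ S, p.1 < I.N ∧ p.2 < I.N := by
    intro p hp
    have := hSN hp
    simpa [blockPairs, N] using this
  have hinj : ∀ p ∈ S, ∀ q ∈ S, p.1 = q.1 → p = q := by
    intro p hp q hq h
    by_contra hne
    rcases hS hp hq hne with h' | h' <;> omega
  have hNn := I.N_le_n
  have hFpos : (0 : ℝ) < I.F := by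
    have h1 := I.T_pos
    have h2 := I.H_pos
    have : 0 < I.F := by unfold F; positivity
    exact_mod_cast this
  -- fuel
  have e1 : pr (fun ω : I.Round => (I.F : ℝ) ≤ ∑ i ∈ Finset.range I.N, ((P.run ω).rowUse i : ℝ)) ≤
      1 / 8 := by
    refine pr_le_of_mean_le (fun ω => by positivity) hFpos ?_
    rw [mean_sum]
    refine (Finset.sum_le_sum fun i hi => P.mean_rowUse_le
      ((Finset.mem_range.1 hi).trans_le hNn)).trans ?_
    rw [← Finset.mul_sum]
    linarith
  -- selected blocks
  set C : Finset (Fin (2 * I.n)) := S.image fun p => I.coord (I.n + p.1) with hC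
  have hcinj : Set.InjOn (fun p : ℕ × ℕ => I.coord (I.n + p.1)) S := by
    intro p hp q hq h
    have h1 := (hlt p hp).1
    have h2 := (hlt q hq).1
    have := I.coord_injOn (by omega) (by omega) h
    exact hinj p hp q hq (by omega)
  have hCcard : C.card = S.card := Finset.card_image_of_injOn hcinj
  have hsel : ∀ ω : I.Round, ∑ c ∈ C, rate (2 ^ P.v) (ω c) =
      ((S.filter fun p => (P.run ω).Sel p.1).card : ℝ) := by
    intro ω
    rw [hC, Finset.sum_image hcinj, Finset.card_filter]
    push_cast
    refine Finset.sum_congr rfl fun p _ => ?_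
    have hs := P.sel_iff ω p.1
    split
    · rename_i h
      exact hs.1 h
    · rename_i h
      exact (rate_eq _ _).resolve_right fun h' => h (hs.2 h')
  have e2 : pr (fun ω : I.Round => ((S.filter fun p => (P.run ω).Sel p.1).card : ℝ) <
      S.card * ρ / 2) ≤ 1 / 8 := by
    -- Pairs of a block sequence lie in distinct block rows, so the selections are independent; a
    -- mean of at least `32` makes Chebyshev's bound `4 / 32`.
    have h1 := pr_sum_coord_lt C (rate (2 ^ P.v)) (rate_eq _) (mean_rate P.v_le)
      (by rw [hCcard]; linarith) (t := S.card * ρ / 2) (by rw [hCcard]; linarith)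
    simp_rw [hsel] at h1
    refine h1.trans ?_
    rw [hCcard, div_le_div_iff₀ (by linarith) (by norm_num)]
    linarith
  -- selected pairs that fail
  set Z : I.Round → ℝ := fun ω => ∑ p ∈ S, if (P.run ω).Sel p.1 then
    (if ¬ (P.run ω).Good p.1 p.2 (ch p.1 p.2) then 1 else 0) else 0 with hZ
  have hZ0 : ∀ ω, 0 ≤ Z ω := by
    intro ω
    refine Finset.sum_nonneg fun p _ => ?_
    split
    · split <;> norm_num
    · norm_num
  have e3 : pr (fun ω : I.Round => S.card * ρ / 4 ≤ Z ω) ≤ 1 / 4 := by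
    refine pr_le_of_mean_le hZ0 (by linarith) ?_
    rw [hZ, mean_sum]
    -- Selection and tests are independent, so a pair is selected and fails with probability at most
    -- `ρ / 16`. Markov's inequality at `|S| ρ / 4` then gives `1 / 4`.
    have h1 : ∀ p ∈ S, mean (fun ω : I.Round => if (P.run ω).Sel p.1 then
        (if ¬ (P.run ω).Good p.1 p.2 (ch p.1 p.2) then (1 : ℝ) else 0) else 0) ≤ ρ * (1 / 16) := by
      intro p hp
      have hp1 := (hlt p hp).1
      rw [P.mean_sel_mul]
      · refine mul_le_mul_of_nonneg_left ?_ (by positivity)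
        refine le_trans (le_of_eq ?_) (P.pr_not_good_le (hch p hp) (hu p hp) (hw p hp))
        unfold pr
        congr 1
        funext ω
        congr
      · intro ω q
        simp only [P.good_update ω (show p.1 < I.n by omega)]
    refine (Finset.sum_le_sum h1).trans ?_
    rw [Finset.sum_const, nsmul_eq_mul]
    linarith
  refine (pr_mono (R := fun ω : I.Round =>
    (I.F : ℝ) ≤ ∑ i ∈ Finset.range I.N, ((P.run ω).rowUse i : ℝ) ∨
    (((S.filter fun p => (P.run ω).Sel p.1).card : ℝ) < S.card * ρ / 2 ∨
      S.card * ρ / 4 ≤ Z ω)) fun ω hω => ?_).trans ?_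
  · by_contra hcon
    push Not at hcon
    obtain ⟨c1, c2, c3⟩ := hcon
    refine hω ⟨by exact_mod_cast c1, ?_⟩
    have h1 : ((S.filter fun p => (P.run ω).Sel p.1).card : ℝ) =
        ((P.run ω).goodBelow S ch I.N I.N).card + Z ω := by
      rw [hZ, Run.goodBelow, Finset.card_filter, Finset.card_filter]
      push_cast
      rw [← Finset.sum_add_distrib]
      refine Finset.sum_congr rfl fun p hp => ?_
      obtain ⟨p1, p2⟩ := hlt p hp
      by_cases a1 : (P.run ω).Sel p.1 <;> by_cases a2 : (P.run ω).Good p.1 p.2 (ch p.1 p.2) <;>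
        simp [a1, a2, p1, p2]
    linarith
  · refine (pr_or_le _ _).trans ?_
    -- The three failure probabilities add up to `1 / 8 + 1 / 8 + 1 / 4 = 1 / 2`.
    have := pr_or_le (fun ω : I.Round => ((S.filter fun p => (P.run ω).Sel p.1).card : ℝ) <
      S.card * ρ / 2) (fun ω : I.Round => S.card * ρ / 4 ≤ Z ω)
    linarith

end Params

end Setup

end LCSApprox

namespace LCSApprox

/-! ### Independent rounds -/

theorem pr_comp_equiv {Ω Ω' : Type*} [Fintype Ω] [Fintype Ω'] (e : Ω ≃ Ω') (P : Ω' → Prop) :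
    pr (fun ω => P (e ω)) = pr P := by
  classical
  unfold pr mean
  rw [Fintype.card_congr e]
  exact congrArg (· / _) (Equiv.sum_comp e fun ω => if P ω then (1 : ℝ) else 0)

theorem pr_forall_eq {Ω : Type*} [Fintype Ω] (k : ℕ) (P : Ω → Prop) :
    pr (fun ω : Fin k → Ω => ∀ g, P (ω g)) = pr P ^ k := by
  classical
  have h1 : (Finset.univ.filter fun ω : Fin k → Ω => ∀ g, P (ω g)) =
      Fintype.piFinset fun _ : Fin k => Finset.univ.filter P := by
    ext ω
    simp [Fintype.mem_piFinset]
  have h2 : pr (fun ω : Fin k → Ω => ∀ g, P (ω g)) =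
      ((Fintype.piFinset fun _ : Fin k => Finset.univ.filter P).card : ℝ) /
        Fintype.card (Fin k → Ω) := by
    rw [pr_eq_card_div, ← h1]
  rw [h2, pr_eq_card_div, div_pow, Fintype.card_piFinset_const]
  simp

namespace Setup

variable {I : Setup}

/-- The tapes of the single rounds. -/
def splitTape (I : Setup) : I.Tape ≃ (Fin (I.G * I.H) → I.Round) :=
  (Equiv.arrowCongr finProdFinEquiv.symm (Equiv.refl _)).trans (Equiv.curry _ _ _)

theorem tapeOf_eq_splitTape (z : I.Tape) (g : Fin (I.G * I.H)) {a : ℕ} (ha : a < 2 * I.n) :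
    I.tapeOf z (g * (2 * I.n) + a) = I.splitTape z g (I.coord a) := by
  have h1 : (g : ℕ) * (2 * I.n) + a < I.R := by
    have h2 : ((g : ℕ) + 1) * (2 * I.n) ≤ I.G * I.H * (2 * I.n) := Nat.mul_le_mul_right _ g.2
    rw [Nat.succ_mul] at h2
    unfold R
    omega
  unfold tapeOf
  rw [dif_pos h1]
  have h3 : I.splitTape z g (I.coord a) = z (finProdFinEquiv (g, I.coord a)) := rfl
  rw [h3]
  congr 2
  apply Fin.ext
  simp [finProdFinEquiv, coord, Nat.mod_eq_of_lt ha]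
  ring

/-- The round `g` of the tape `z`. -/
def Params.runAt (P : I.Params) (z : I.Tape) (g : Fin (I.G * I.H)) : I.Run where
  ζ := I.tapeOf z
  g := g
  u := P.u
  v := P.v
  w := P.w
  g_lt := g.2
  u_le := P.u_le
  v_le := P.v_le
  w_lt := P.w_lt
  tape_lt t _ := I.tapeOf_lt z t

namespace Params

variable (P : I.Params) (z : I.Tape) (g : Fin (I.G * I.H))

/-- A run reads the tape only at offsets below `2 n` of its own segment, so round `g` of the full
tape behaves like a round in isolation. -/
theorem runAt_z {a : ℕ} (ha : a < 2 * I.n) :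
    (P.runAt z g).z a = (P.run (I.splitTape z g)).z a := by
  rw [run_z]
  exact tapeOf_eq_splitTape z g ha

theorem runAt_rows (i d : ℕ) : (P.runAt z g).rows i d = (P.run (I.splitTape z g)).rows i d := by
  unfold Run.rows rowsBelow
  refine List.filter_congr fun a _ => ?_
  by_cases ha : a < I.n
  · simp only [P.runAt_z z g (a := a) (by omega)]
  · simp [ha]

theorem runAt_sel {i : ℕ} (hi : i < I.n) :
    (P.runAt z g).Sel i ↔ (P.run (I.splitTape z g)).Sel i := by
  unfold Run.Sel
  rw [P.runAt_z z g (by omega)]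
  rfl

theorem runAt_pairUse (i j k : ℕ) :
    (P.runAt z g).pairUse i j k = (P.run (I.splitTape z g)).pairUse i j k := by
  unfold Run.pairUse Run.work
  simp only [runAt_rows]
  rfl

theorem runAt_rowUse {i : ℕ} (hi : i < I.n) :
    (P.runAt z g).rowUse i = (P.run (I.splitTape z g)).rowUse i := by
  unfold Run.rowUse
  simp only [runAt_sel P z g hi, runAt_pairUse]
  rfl

theorem runAt_good (i j : ℕ) (c : List (ℕ × ℕ)) :
    (P.runAt z g).Good i j c ↔ (P.run (I.splitTape z g)).Good i j c := by
  unfold Run.Good Run.hits Run.work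
  simp only [runAt_rows]
  rfl

theorem runAt_goodBelow (S : Finset (ℕ × ℕ)) (ch : ℕ → ℕ → List (ℕ × ℕ)) :
    (P.runAt z g).goodBelow S ch I.N I.N = (P.run (I.splitTape z g)).goodBelow S ch I.N I.N := by
  classical
  unfold Run.goodBelow
  refine Finset.filter_congr fun p _ => ?_
  refine and_congr_right fun h => and_congr_right fun _ => and_congr ?_ ?_
  · exact P.runAt_sel z g (h.trans_le I.N_le_n)
  · exact P.runAt_good z g _ _ _

end Params

/-- Success probability of the algorithm. -/
theorem le_outputProb_lcsProg (P : I.Params) (W : Run.Witness I)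
    (hSN : W.S ⊆ blockPairs I.n I.m) (hu : P.u = 0 ∨ 256 * 2 ^ P.u ≤ W.θ)
    (hw : ∀ p ∈ W.S, I.bmatch p.1 p.2 ≤ 2 ^ P.w)
    (hF : 1 / 2 ^ P.v * ∑ i ∈ Finset.range I.N, ∑ j ∈ Finset.range I.N, P.pairMean i j ≤ I.F / 8)
    (hg : 32 ≤ (W.S.card : ℝ) * (1 / 2 ^ P.v)) {Q : ℕ → Prop}
    (hQ : ∀ out : ℕ, W.θ * ((W.S.card : ℝ) * (1 / 2 ^ P.v) / 4) ≤ out → Q out) :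
    ENNReal.ofReal (1 - (1 / 2) ^ (I.G * I.H)) ≤ outputProb (lcsProg I.G) I.x I.y I.T Q := by
  classical
  obtain ⟨K, f, hf, hz⟩ := I.lcsProg_dist P.G_pos
  have hbad := P.pr_round_bad_le hSN W.seq W.chain
    (fun p hp => hu.imp_right fun h => h.trans (W.le_length p hp)) hw hF hg
  set Bad : I.Round → Prop := fun ω => ¬ (∑ i ∈ Finset.range I.N, (P.run ω).rowUse i < I.F ∧
      (W.S.card : ℝ) * (1 / 2 ^ P.v) / 4 ≤ ((P.run ω).goodBelow W.S W.ch I.N I.N).card) with hBad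
  -- The tapes on which all rounds fail. One successful round is enough, since the output is the
  -- best value over all runs.
  set B : Finset I.Tape := Finset.univ.filter fun z => ∀ g, Bad (I.splitTape z g) with hB
  have hcard : (B.card : ℝ) / Fintype.card I.Tape ≤ (1 / 2) ^ (I.G * I.H) := by
    have h1 := pr_comp_equiv I.splitTape fun ω => ∀ g, Bad (ω g)
    rw [pr_forall_eq, pr_eq_card_div] at h1
    refine le_trans (le_of_eq ?_) (h1.le.trans (pow_le_pow_left₀ (pr_nonneg _) hbad _))
    rw [hB]
  refine (ENNReal.ofReal_le_ofReal ?_).trans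
    (le_outputProb hf (B := B) (fun z => (hz z).1) fun z hzB => hQ _ ?_)
  · linarith
  · rw [hB, Finset.mem_filter, not_and, not_forall] at hzB
    obtain ⟨g, hgz⟩ := hzB (Finset.mem_univ z)
    rw [hBad, not_not] at hgz
    have h1 := (hz z).2.2.2 (P.runAt z g) W rfl ?_
    · rw [P.runAt_goodBelow] at h1
      have h2 : ((W.θ * ((P.run (I.splitTape z g)).goodBelow W.S W.ch I.N I.N).card : ℕ) : ℝ) ≤
          (f z).mem.reg 2 := by exact_mod_cast h1
      refine le_trans ?_ h2
      push_cast
      exact mul_le_mul_of_nonneg_left hgz.2 (Nat.cast_nonneg _)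
    · rw [Finset.sum_congr rfl fun i hi => P.runAt_rowUse z g
        ((Finset.mem_range.1 hi).trans_le I.N_le_n)]
      exact hgz.1

end Setup

end LCSApprox

namespace LCSApprox

/-! ### Choice of the parameters -/

/-- The bound for the mean fuel consumption of a run. -/
theorem mean_fuel_bound {ρ L lam mu n m N D T B M H u : ℝ} (hρ : 0 ≤ ρ) (hL : 0 < L)
    (hlam : 0 < lam) (hmu : 0 < mu) (hn : 0 < n) (hLn : L ≤ n) (hm : 0 ≤ m)
    (hD : 0 < D) (hT : 0 ≤ T) (hH : 1 ≤ H) (hu : 0 ≤ u) (huH : u ≤ H) (hρ₁ : ρ ≤ L / n)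
    (hρ₂ : ρ ≤ L * T / (lam * n)) (hρ₃ : ρ ≤ L ^ 2 * T / (lam * mu * n)) (hLD : L ≤ 2048 * N * D)
    (hNT : N ^ 2 ≤ 4 * T) (hNm : N * m ≤ 2 * n) (hB : B ≤ 2 * m + 16 * (m * mu / L))
    (hM : M ≤ 2 * m * lam) :
    ρ * ((N ^ 2 * m + M) / D + lam * (H * (u * ((m + B) / D) + 1))) ≤ 2 ^ 18 * T * H ^ 2 := by
  rw [le_div_iff₀ (by positivity)] at hρ₁ hρ₂ hρ₃
  -- As `N m` is at most `2 n`, the bound `D ≥ L / (2048 N)` turns into `D ≥ L m / (4096 n)`. Hence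
  -- each of the terms below is balanced by one of the three bounds for `ρ`.
  have hLm : L * m ≤ 4096 * (n * D) := by
    calc L * m ≤ 2048 * N * D * m := by gcongr
      _ = 2048 * D * (N * m) := by ring
      _ ≤ 2048 * D * (2 * n) := by gcongr
      _ = _ := by ring
  have t1 : ρ * (N ^ 2 * m) ≤ 2 ^ 14 * (T * D) := by
    refine le_of_mul_le_mul_left ?_ hn
    calc n * (ρ * (N ^ 2 * m)) = ρ * n * m * N ^ 2 := by ring
      _ ≤ L * m * (4 * T) := by gcongr
      _ ≤ 4096 * (n * D) * (4 * T) := by gcongr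
      _ = _ := by ring
  have t2 : ρ * lam * m ≤ 2 ^ 12 * (T * D) := by
    refine le_of_mul_le_mul_left ?_ hn
    calc n * (ρ * lam * m) = ρ * (lam * n) * m := by ring
      _ ≤ L * T * m := by gcongr
      _ = L * m * T := by ring
      _ ≤ 4096 * (n * D) * T := by gcongr
      _ = _ := by ring
  have t3 : ρ * lam * (m * mu / L) ≤ 2 ^ 12 * (T * D) := by
    refine le_of_mul_le_mul_left ?_ hn
    calc n * (ρ * lam * (m * mu / L)) = ρ * (lam * mu * n) * m / L := by ring
      _ ≤ L ^ 2 * T * m / L := by gcongr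
      _ = L * m * T := by field_simp
      _ ≤ 4096 * (n * D) * T := by gcongr
      _ = _ := by ring
  have t4 : ρ * lam ≤ T := by
    refine le_of_mul_le_mul_left ?_ hn
    calc n * (ρ * lam) = ρ * (lam * n) := by ring
      _ ≤ L * T := hρ₂
      _ ≤ n * T := by gcongr
  have a1 : ρ * (N ^ 2 * m + M) ≤ (2 ^ 14 + 2 ^ 13) * T * D := by
    have : ρ * M ≤ ρ * (2 * m * lam) := by gcongr
    linarith
  have a2 : ρ * lam * (m + B) ≤ 19 * 2 ^ 12 * T * D := by
    have : ρ * lam * (m + B) ≤ ρ * lam * (3 * m + 16 * (m * mu / L)) := by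
      refine mul_le_mul_of_nonneg_left (by linarith) (by positivity)
    linarith
  have b1 : ρ * ((N ^ 2 * m + M) / D) ≤ (2 ^ 14 + 2 ^ 13) * T := by
    rw [← mul_div_assoc, div_le_iff₀ hD]
    exact a1
  have b2 : ρ * lam * ((m + B) / D) ≤ 19 * 2 ^ 12 * T := by
    rw [← mul_div_assoc, div_le_iff₀ hD]
    exact a2
  have hHH : H ≤ H ^ 2 := by nlinarith
  have hH2 : 1 ≤ H ^ 2 := by nlinarith
  have c2 : H * u * (ρ * lam * ((m + B) / D)) ≤ H ^ 2 * (19 * 2 ^ 12 * T) := by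
    calc H * u * (ρ * lam * ((m + B) / D)) ≤ H * u * (19 * 2 ^ 12 * T) := by gcongr
      _ ≤ H * H * (19 * 2 ^ 12 * T) := by gcongr
      _ = _ := by ring
  have c1 : (2 ^ 14 + 2 ^ 13) * T ≤ H ^ 2 * ((2 ^ 14 + 2 ^ 13) * T) :=
    le_mul_of_one_le_left (by positivity) hH2
  have c3 : H * (ρ * lam) ≤ H ^ 2 * T := by gcongr
  have hTH : 0 ≤ H ^ 2 * T := by positivity
  calc ρ * ((N ^ 2 * m + M) / D + lam * (H * (u * ((m + B) / D) + 1)))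
      = ρ * ((N ^ 2 * m + M) / D) + H * u * (ρ * lam * ((m + B) / D)) + H * (ρ * lam) := by ring
    _ ≤ _ := by linarith

theorem exists_pow_two_near {x : ℝ} (hx : 1 ≤ x) : ∃ k : ℕ, x ≤ 2 ^ (k + 1) ∧ 2 ^ k ≤ x := by
  obtain ⟨k, h1, h2⟩ := exists_nat_pow_near hx (by norm_num : (1 : ℝ) < 2)
  exact ⟨k, h2.le, h1⟩

namespace Setup

variable (I : Setup)

theorem lcs_le_n : lcs I.x I.y ≤ I.n := by
  rw [← I.input.length_x]
  exact lcs_le_length_left _ _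

theorem sum_blcs : ∑ i ∈ Finset.range I.N, ∑ j ∈ Finset.range I.N, Run.blcs I i j =
    lcsSum I.n I.T I.x I.y := by
  unfold lcsSum blockPairs
  rw [Finset.sum_product]
  rfl

theorem bmatch_le (i j : ℕ) : I.bmatch i j ≤ 2 * I.m * Run.blcs I i j := by
  refine (matchingPairs_le _ _).trans (Nat.mul_le_mul_right _ ?_)
  have h1 := block_length_le I.m I.x i
  have h2 := block_length_le I.m I.y j
  omega

theorem sum_bmatch_le : ∑ i ∈ Finset.range I.N, ∑ j ∈ Finset.range I.N, I.bmatch i j ≤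
    2 * I.m * lcsSum I.n I.T I.x I.y := by
  rw [← sum_blcs, Finset.mul_sum]
  refine Finset.sum_le_sum fun i _ => ?_
  rw [Finset.mul_sum]
  exact Finset.sum_le_sum fun j _ => I.bmatch_le i j

theorem bmatch_le_sq (i j : ℕ) : I.bmatch i j ≤ I.m * I.m := by
  refine (Finset.card_filter_le _ _).trans ?_
  rw [Finset.card_product, Finset.card_range, Finset.card_range]
  exact Nat.mul_le_mul (block_length_le _ _ _) (block_length_le _ _ _)

/-- Crude, but enough to keep the exponent `w` within the range that is searched. -/
theorem maxMatching_le : maxMatching I.n I.T I.x I.y ≤ 4 * I.n ^ 2 := by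
  classical
  unfold maxMatching
  refine Finset.sup_le fun S hS => ?_
  rw [Finset.mem_filter, Finset.mem_powerset] at hS
  refine (Finset.sum_le_sum_of_subset hS.1).trans ?_
  refine (Finset.sum_le_card_nsmul _ _ (I.m * I.m) fun p _ => I.bmatch_le_sq p.1 p.2).trans ?_
  have h1 : (blockPairs I.n (blockLen I.n I.T)).card = I.N * I.N := by
    simp [blockPairs, N, m]
  rw [h1, smul_eq_mul]
  have h2 := Nat.mul_le_mul I.N_mul_m_le I.N_mul_m_le
  nlinarith

theorem sum_bmatch_le_maxMatching {S : Finset (ℕ × ℕ)} (hS : S ⊆ blockPairs I.n I.m)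
    (hseq : IsBlockSeq S) : ∑ p ∈ S, I.bmatch p.1 p.2 ≤ maxMatching I.n I.T I.x I.y := by
  classical
  unfold maxMatching
  refine Finset.le_sup_of_le (b := S) ?_ (Finset.sum_le_sum fun p _ => le_rfl)
  rw [Finset.mem_filter, Finset.mem_powerset]
  exact ⟨hS, hseq⟩

/-- At least half of the pairs of a block sequence have at most twice the average number of
matching pairs. -/
theorem exists_light_subset {S : Finset (ℕ × ℕ)} (hS : S ⊆ blockPairs I.n I.m)
    (hseq : IsBlockSeq S) (hmu : 0 < maxMatching I.n I.T I.x I.y) :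
    ∃ S' ⊆ S, S.card ≤ 2 * S'.card ∧
      ∀ p ∈ S', I.bmatch p.1 p.2 * S.card ≤ 2 * maxMatching I.n I.T I.x I.y := by
  set μ := maxMatching I.n I.T I.x I.y
  refine ⟨S.filter fun p => I.bmatch p.1 p.2 * S.card ≤ 2 * μ, Finset.filter_subset _ _, ?_,
    fun p hp => (Finset.mem_filter.1 hp).2⟩
  have h1 := I.sum_bmatch_le_maxMatching hS hseq
  set Y := S.filter fun p => ¬ I.bmatch p.1 p.2 * S.card ≤ 2 * μ with hY
  have hcard := Finset.card_filter_add_card_filter_not (s := S)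
    (fun p => I.bmatch p.1 p.2 * S.card ≤ 2 * μ)
  have h2 : Y.card * (2 * μ) ≤ μ * S.card := by
    calc Y.card * (2 * μ) ≤ ∑ p ∈ Y, I.bmatch p.1 p.2 * S.card := by
          rw [← smul_eq_mul]
          refine Finset.card_nsmul_le_sum _ _ _ fun p hp => ?_
          have := (Finset.mem_filter.1 hp).2
          omega
      _ ≤ ∑ p ∈ S, I.bmatch p.1 p.2 * S.card :=
          Finset.sum_le_sum_of_subset (Finset.filter_subset _ _)
      _ ≤ μ * S.card := by
          rw [← Finset.sum_mul]
          exact Nat.mul_le_mul_right _ h1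
  have h3 : 2 * Y.card ≤ S.card := by
    refine Nat.le_of_mul_le_mul_left (c := μ) ?_ hmu
    calc μ * (2 * Y.card) = Y.card * (2 * μ) := by ring
      _ ≤ _ := h2
  rw [← hY] at hcard
  omega

theorem m_mul_sqrt_ge : (I.n : ℝ) ≤ I.m * Real.sqrt I.T := by
  rw [← div_le_iff₀ I.sqrt_pos]
  exact Nat.le_ceil _

theorem sqrt_le_n : Real.sqrt I.T ≤ I.n := by
  rw [Real.sqrt_le_left (by positivity)]
  exact_mod_cast I.input.budget_le

/-- The budget `T ≤ n ^ 2` gives `n / √T ≥ 1`, so rounding up at most doubles the block length. -/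
theorem m_mul_sqrt_le : I.m * Real.sqrt I.T ≤ 2 * I.n := by
  have h1 : (I.m : ℝ) < I.n / Real.sqrt I.T + 1 :=
    Nat.ceil_lt_add_one (div_nonneg (Nat.cast_nonneg _) I.sqrt_pos.le)
  have h2 := mul_le_mul_of_nonneg_right h1.le I.sqrt_pos.le
  rw [add_mul, div_mul_cancel₀ _ I.sqrt_pos.ne', one_mul] at h2
  have := I.sqrt_le_n
  linarith

theorem N_sq_le : I.N ^ 2 ≤ 4 * I.T := by
  have hm : (0 : ℝ) < I.m := by exact_mod_cast I.m_pos
  have h1 : (I.N : ℝ) * I.m ≤ 2 * I.n := by exact_mod_cast I.N_mul_m_le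
  have h2 := I.m_mul_sqrt_ge
  have h3 : (I.N : ℝ) ≤ 2 * Real.sqrt I.T := by
    refine le_of_mul_le_mul_right ?_ hm
    linarith
  have h4 : (I.N : ℝ) ^ 2 ≤ (2 * Real.sqrt I.T) ^ 2 := by gcongr
  rw [mul_pow, Real.sq_sqrt (Nat.cast_nonneg _)] at h4
  have h5 : ((I.N ^ 2 : ℕ) : ℝ) ≤ ((4 * I.T : ℕ) : ℝ) := by push_cast; linarith
  exact_mod_cast h5

theorem sum_pairMean (P : I.Params) :
    ∑ i ∈ Finset.range I.N, ∑ j ∈ Finset.range I.N, P.pairMean i j =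
      ((I.N : ℝ) ^ 2 * I.m +
        ((∑ i ∈ Finset.range I.N, ∑ j ∈ Finset.range I.N, I.bmatch i j : ℕ) : ℝ)) / 2 ^ P.u +
      (lcsSum I.n I.T I.x I.y : ℝ) * (I.H * (P.u * ((I.m + 2 ^ P.w) / 2 ^ P.u) + 1)) := by
  rw [← sum_blcs]
  unfold Params.pairMean
  simp only [Finset.sum_add_distrib, ← Finset.sum_mul, ← Finset.sum_div, Finset.sum_const,
    Finset.card_range, nsmul_eq_mul]
  push_cast
  ring

/-- The lower bound for the output. -/
theorem output_ge (hG : 1 ≤ I.G) {L lam mu E : ℝ} (hL : L = lcs I.x I.y)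
    (hlam : lam = lcsSum I.n I.T I.x I.y) (hmu : mu = maxMatching I.n I.T I.x I.y)
    (hE : 1024 ≤ E) (h₁ : E ≤ L ^ 2 * Real.sqrt I.T / (I.n : ℝ) ^ 2)
    (h₂ : E ≤ L ^ 2 * (I.T * Real.sqrt I.T) / (lam * (I.n : ℝ) ^ 2))
    (h₃ : E ≤ L ^ 3 * (I.T * Real.sqrt I.T) / (lam * mu * (I.n : ℝ) ^ 2)) :
    ENNReal.ofReal (1 - (1 / 2) ^ (I.G * I.H)) ≤ outputProb (lcsProg I.G) I.x I.y I.T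
      (fun out => 1 / 512 * min (L ^ 3 / (I.n : ℝ) ^ 2)
        (min (L ^ 3 * (I.T : ℝ) / (lam * (I.n : ℝ) ^ 2))
          (L ^ 4 * (I.T : ℝ) / (lam * mu * (I.n : ℝ) ^ 2))) ≤ (out : ℝ)) := by
  have hn : (1 : ℝ) ≤ I.n := by exact_mod_cast I.n_pos
  have hn0 : (0 : ℝ) < I.n := by linarith
  have hm1 : (1 : ℝ) ≤ I.m := by exact_mod_cast I.m_pos
  have hN1 : (1 : ℝ) ≤ I.N := by exact_mod_cast I.N_pos
  have hT1 : (1 : ℝ) ≤ I.T := by exact_mod_cast I.T_pos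
  have hH1 : (1 : ℝ) ≤ I.H := by exact_mod_cast I.H_pos
  have hs := I.sqrt_pos
  have hsn := I.sqrt_le_n
  have hms := I.m_mul_sqrt_le
  have hNm : (I.N : ℝ) * I.m ≤ 2 * I.n := by exact_mod_cast I.N_mul_m_le
  have hNT : (I.N : ℝ) ^ 2 ≤ 4 * I.T := by exact_mod_cast I.N_sq_le
  have hHpow : (I.n : ℝ) < 2 ^ I.H := by exact_mod_cast I.lt_pow
  set s := Real.sqrt I.T with hsdef
  -- If `L`, `lam` or `mu` vanished, one of the quotients would be `0`, also where it divides by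
  -- zero, against `E ≥ 1024`.
  have hL0 : 0 < L := by
    refine lt_of_le_of_ne (by rw [hL]; positivity) fun h => ?_
    rw [← h] at h₁
    norm_num at h₁
    linarith
  have hlam0 : 0 < lam := by
    refine lt_of_le_of_ne (by rw [hlam]; positivity) fun h => ?_
    rw [← h] at h₂
    norm_num at h₂
    linarith
  have hmu0 : 0 < mu := by
    refine lt_of_le_of_ne (by rw [hmu]; positivity) fun h => ?_
    rw [← h] at h₃
    norm_num at h₃
    linarith
  have hLn : L ≤ I.n := by rw [hL]; exact_mod_cast I.lcs_le_n
  have hmuN : 0 < maxMatching I.n I.T I.x I.y := by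
    rw [hmu] at hmu0; exact_mod_cast hmu0
  -- the selection rate of the blocks
  set r : ℝ := min (L / I.n) (min (L * I.T / (lam * I.n)) (L ^ 2 * I.T / (lam * mu * I.n))) with hr
  -- The three hypotheses, one for each term of the minimum, say precisely this.
  have hrlow : E * I.n / (L * s) ≤ r := by
    rw [div_le_iff₀ (by positivity), hr]
    rw [le_div_iff₀ (by positivity)] at h₁ h₂ h₃
    have key : ∀ a : ℝ, E * (I.n : ℝ) ^ 2 ≤ a * I.n * (L * s) → E * I.n ≤ a * (L * s) := by
      intro a ha
      refine le_of_mul_le_mul_right (a := (I.n : ℝ)) ?_ hn0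
      linarith
    rw [min_mul_of_nonneg _ _ (by positivity), min_mul_of_nonneg _ _ (by positivity)]
    refine le_min (key _ ?_) (le_min (key _ ?_) (key _ ?_))
    · have : L / I.n * I.n * (L * s) = L ^ 2 * s := by field_simp
      linarith
    · have : L * I.T / (lam * I.n) * I.n * (L * s) = L ^ 2 * (I.T * s) / lam := by field_simp
      rw [this, le_div_iff₀ hlam0]
      linarith
    · have : L ^ 2 * I.T / (lam * mu * I.n) * I.n * (L * s) = L ^ 3 * (I.T * s) / (lam * mu) := by
        field_simp
      rw [this, le_div_iff₀ (by positivity)]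
      linarith
  have hr0 : 0 < r := lt_of_lt_of_le (by positivity) hrlow
  have hrL : E * I.n ≤ r * L * s := by
    rw [div_le_iff₀ (by positivity)] at hrlow
    linarith
  have hr1 : r ≤ L / I.n := min_le_left _ _
  have hr2 : r ≤ L * I.T / (lam * I.n) := (min_le_right _ _).trans (min_le_left _ _)
  have hr3 : r ≤ L ^ 2 * I.T / (lam * mu * I.n) := (min_le_right _ _).trans (min_le_right _ _)
  have hrle1 : r ≤ 1 := hr1.trans (div_le_one_of_le₀ hLn hn0.le)
  -- Needed so that the exponent of the selection rate is among the values tried.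
  have hrn : 1 / r ≤ I.n := by
    rw [div_le_iff₀ hr0]
    have h4 : r * L * s ≤ r * I.n * I.n := by gcongr
    have h5 : 1 * (I.n : ℝ) ≤ E * I.n := by gcongr; linarith
    refine le_of_mul_le_mul_right (a := (I.n : ℝ)) ?_ hn0
    linarith
  -- The rate `2 ^ (-(v' + 1))` lies between `r / 2` and `r`.
  obtain ⟨v', hv1, hv2⟩ := exists_pow_two_near (x := 1 / r) (by rw [le_div_iff₀ hr0]; linarith)
  have hvH : v' + 1 ≤ I.H := by
    have : (2 : ℝ) ^ v' < 2 ^ I.H := by linarith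
    exact (pow_lt_pow_iff_right₀ (by norm_num)).1 this
  have hρr : (1 : ℝ) / 2 ^ (v' + 1) ≤ r := by
    rw [div_le_iff₀ (by positivity)]
    rw [div_le_iff₀ hr0] at hv1
    linarith
  have hrρ : r / 2 ≤ 1 / 2 ^ (v' + 1) := by
    rw [le_div_iff₀ (by positivity), pow_succ]
    rw [le_div_iff₀ hr0] at hv2
    linarith
  -- the block sequence
  obtain ⟨S, hSsub, hSseq, hScard, hSheavy⟩ :=
    exists_heavy_blockSeq (n := I.n) I.m_pos I.input.length_x I.input.length_y
  obtain ⟨S', hS'S, hS'card, hS'light⟩ := I.exists_light_subset hSsub hSseq hmuN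
  have hS1 : L ≤ 4 * I.m * S.card := by rw [hL]; exact_mod_cast hScard
  have hS2 : (S.card : ℝ) ≤ 2 * S'.card := by exact_mod_cast hS'card
  have hS0 : (0 : ℝ) < S.card := by
    by_contra hcon
    have : (S.card : ℝ) = 0 := le_antisymm (not_lt.1 hcon) (by positivity)
    rw [this] at hS1
    linarith
  -- the threshold for matching pairs
  set b : ℝ := 8 * (I.m * mu / L) with hb
  have hb0 : 0 ≤ b := by positivity
  obtain ⟨w', hw1, hw2⟩ := exists_pow_two_near (x := 1 + b) (by linarith)
  -- `1 + b ≤ 33 n ^ 3`, which is less than `2 ^ (3 H + 6)`.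
  have hwH : w' + 1 < 3 * I.H + 7 := by
    have hL1 : (1 : ℝ) ≤ L := by
      rw [hL] at hL0 ⊢
      exact_mod_cast hL0
    have hmn : (I.m : ℝ) ≤ I.n := by exact_mod_cast I.m_le_n
    have hmun : mu ≤ 4 * (I.n : ℝ) ^ 2 := by rw [hmu]; exact_mod_cast I.maxMatching_le
    have h4 : b ≤ 32 * (I.n : ℝ) ^ 3 := by
      calc b ≤ 8 * (I.m * mu / 1) := by rw [hb]; gcongr
        _ ≤ 8 * (I.n * (4 * (I.n : ℝ) ^ 2) / 1) := by gcongr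
        _ = _ := by ring
    have h5 : (1 : ℝ) ≤ (I.n : ℝ) ^ 3 := one_le_pow₀ hn
    have h6 : (I.n : ℝ) ^ 3 < (2 ^ I.H) ^ 3 := by gcongr
    have h7 : (2 : ℝ) ^ w' < 2 ^ (3 * I.H + 6) := by
      rw [pow_add, mul_comm 3, pow_mul]
      linarith
    have := (pow_lt_pow_iff_right₀ (by norm_num : (1 : ℝ) < 2)).1 h7
    omega
  have hlight : ∀ p ∈ S', I.bmatch p.1 p.2 ≤ 2 ^ (w' + 1) := by
    intro p hp
    have h4 : (I.bmatch p.1 p.2 : ℝ) * S.card ≤ 2 * mu := by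
      rw [hmu]; exact_mod_cast hS'light p hp
    have h5 : (I.bmatch p.1 p.2 : ℝ) ≤ b := by
      rw [hb, ← mul_div_assoc, le_div_iff₀ hL0]
      calc (I.bmatch p.1 p.2 : ℝ) * L ≤ I.bmatch p.1 p.2 * (4 * I.m * S.card) := by gcongr
        _ = 4 * I.m * (I.bmatch p.1 p.2 * S.card) := by ring
        _ ≤ 4 * I.m * (2 * mu) := by gcongr
        _ = _ := by ring
    have h6 : (I.bmatch p.1 p.2 : ℝ) ≤ 2 ^ (w' + 1) := by linarith
    exact_mod_cast h6
  -- the sampling rate of the rows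
  set θ : ℕ := ⌈L / (4 * I.N)⌉₊ with hθ
  have hθge : L / (4 * I.N) ≤ θ := Nat.le_ceil _
  have hθn : θ ≤ I.n := by
    rw [hθ, Nat.ceil_le]
    refine (div_le_self hL0.le (by linarith)).trans hLn
  -- The largest `u` with `256 * 2 ^ u ≤ θ`; for `θ < 256` the logarithm of `0` gives `u = 0`, and
  -- there are no tests to pass.
  set u : ℕ := Nat.log 2 (θ / 256) with hu
  have huH : u ≤ I.H := by
    refine (Nat.log_mono_right ((Nat.div_le_self _ _).trans (hθn.trans I.lt_pow.le))).trans ?_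
    rw [Nat.log_pow (by norm_num)]
  have huθ : u = 0 ∨ 256 * 2 ^ u ≤ θ := by
    by_cases h : θ / 256 = 0
    · left; rw [hu, h, Nat.log_zero_right]
    · right
      have := Nat.pow_log_le_self 2 h
      rw [← hu] at this
      omega
  have hθu : θ ≤ 512 * 2 ^ u := by
    have := Nat.lt_pow_succ_log_self (b := 2) (by norm_num) (θ / 256)
    rw [← hu, pow_succ] at this
    omega
  have hLD : L ≤ 2048 * I.N * 2 ^ u := by
    have h4 : (θ : ℝ) ≤ 512 * 2 ^ u := by exact_mod_cast hθu
    have h5 := hθge.trans h4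
    rw [div_le_iff₀ (by linarith)] at h5
    linarith
  choose ch hch hchl using fun i j => exists_blockChain I.m_pos I.x I.y i j
  let W : Run.Witness I :=
    { S := S'
      ch := ch
      θ := θ
      seq := fun p hp q hq => hSseq (hS'S hp) (hS'S hq)
      chain := fun p _ => hch p.1 p.2
      le_length := fun p hp => by
        rw [hchl, hθ, Nat.ceil_le, div_le_iff₀ (by linarith), hL]
        have := hSheavy p (hS'S hp)
        have h4 : (lcs I.x I.y : ℝ) ≤
            4 * I.N * lcs (block I.m I.x p.1) (block I.m I.y p.2) := by exact_mod_cast this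
        linarith }
  let P : I.Params := ⟨u, v' + 1, w' + 1, huH, hvH, hwH, hG⟩
  -- `|S'| ≥ |S| / 2 ≥ L / (8 m)`, and the rate is at least `r / 2`.
  have hSρ : r * L / (16 * I.m) ≤ (S'.card : ℝ) * (1 / 2 ^ (v' + 1)) := by
    have h4 : L / (8 * I.m) ≤ S'.card := by
      rw [div_le_iff₀ (by positivity)]
      have : (4 * I.m : ℝ) * S.card ≤ 4 * I.m * (2 * S'.card) := by gcongr
      linarith
    calc r * L / (16 * I.m) = L / (8 * I.m) * (r / 2) := by ring
      _ ≤ _ := by gcongr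
  refine I.le_outputProb_lcsProg P W (hS'S.trans hSsub) huθ hlight ?_ ?_ ?_
  · rw [I.sum_pairMean P]
    have hF : (I.F : ℝ) / 8 = 2 ^ 21 * I.T * (I.H : ℝ) ^ 2 := by
      unfold F; push_cast; ring
    rw [hF, ← hlam]
    have hM : ((∑ i ∈ Finset.range I.N, ∑ j ∈ Finset.range I.N, I.bmatch i j : ℕ) : ℝ) ≤
        2 * I.m * lam := by rw [hlam]; exact_mod_cast I.sum_bmatch_le
    have hB : (2 : ℝ) ^ (w' + 1) ≤ 2 * I.m + 16 * (I.m * mu / L) := by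
      rw [pow_succ]
      linarith
    have key := mean_fuel_bound (ρ := 1 / 2 ^ (v' + 1)) (D := 2 ^ u) (u := u) (by positivity) hL0
      hlam0 hmu0 hn0 hLn (by linarith) (by positivity) (by linarith) hH1
      (Nat.cast_nonneg _) (by exact_mod_cast huH) (hρr.trans hr1) (hρr.trans hr2) (hρr.trans hr3)
      hLD hNT hNm hB hM
    refine key.trans ?_
    gcongr <;> norm_num
  · refine le_trans ?_ hSρ
    rw [le_div_iff₀ (by positivity)]
    refine le_of_mul_le_mul_right (a := s) ?_ hs
    -- `1024 = 32 * 16 * 2`, where the last factor comes from `m √T ≤ 2 n`.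
    have h4 : 1024 * (I.n : ℝ) ≤ E * I.n := by gcongr
    linarith
  · intro out hout
    refine le_trans ?_ hout
    have h4 : L / (4 * I.N) * (r * L / (16 * I.m) / 4) ≤
        (θ : ℝ) * ((S'.card : ℝ) * (1 / 2 ^ (v' + 1)) / 4) := by gcongr
    refine le_trans ?_ h4
    have h5 : min (L ^ 3 / (I.n : ℝ) ^ 2) (min (L ^ 3 * (I.T : ℝ) / (lam * (I.n : ℝ) ^ 2))
        (L ^ 4 * (I.T : ℝ) / (lam * mu * (I.n : ℝ) ^ 2))) = r * (L ^ 2 / I.n) := by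
      rw [hr, min_mul_of_nonneg _ _ (by positivity), min_mul_of_nonneg _ _ (by positivity)]
      congr 1
      · field_simp
      · congr 1 <;> field_simp
    rw [h5]
    -- The chain bound `L / (4 N)` times the count `r L / (64 m)` is `r L ^ 2 / (256 N m)`, and `N m
    -- ≤ 2 n` yields the constant `1 / 512`.
    calc 1 / 512 * (r * (L ^ 2 / I.n)) = r * L ^ 2 / (256 * (2 * I.n)) := by field_simp; norm_num
      _ ≤ r * L ^ 2 / (256 * (I.N * I.m)) := by gcongr
      _ = _ := by field_simp; norm_num

end Setup

end LCSApprox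

namespace LCSApprox

namespace Setup

variable (I : Setup)

/-! ### Running time -/

/-- Apart from fuel, each of the `N` block rows costs `O((m + N) H)`, and both `N m` and `N ^ 2` are
`O(T)`. The fuel contributes `T H ^ 2` units of `O(H)` steps. -/
theorem runCost_le : I.runCost (10 * I.H + 25) ≤ 2 ^ 30 * (I.T * I.H ^ 3) := by
  have hH := I.H_pos
  have hN := I.N_pos
  have hnT := I.input.le_budget
  have hNT : I.N ≤ I.T := I.N_le_n.trans hnT
  have hNm : I.N * I.m ≤ 2 * I.T := I.N_mul_m_le.trans (by omega)
  have hN2 := I.N_sq_le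
  have h1 : I.rowCost ≤ (18 * I.m + 102 * I.N) * I.H := by
    unfold rowCost
    have a1 : I.H + 1 ≤ 2 * I.H := by omega
    have a2 : 9 * I.m + 15 * I.N + 18 ≤ 9 * I.m + 33 * I.N := by omega
    have a3 := Nat.mul_le_mul a2 a1
    have a4 : 20 * I.N + 16 ≤ 36 * I.N * I.H := by
      calc 20 * I.N + 16 ≤ 36 * I.N * 1 := by omega
        _ ≤ _ := Nat.mul_le_mul_left _ hH
    calc _ ≤ (9 * I.m + 33 * I.N) * (2 * I.H) + 36 * I.N * I.H := by omega
      _ = _ := by ring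
  have h2 : I.rowCost * I.N ≤ 444 * (I.T * I.H) := by
    calc I.rowCost * I.N ≤ (18 * I.m + 102 * I.N) * I.H * I.N := Nat.mul_le_mul_right _ h1
      _ = (18 * (I.N * I.m) + 102 * I.N ^ 2) * I.H := by ring
      _ ≤ (18 * (2 * I.T) + 102 * (4 * I.T)) * I.H := by gcongr
      _ = _ := by ring
  have hT := I.T_pos
  have h3 : I.T * I.H ≤ I.T * I.H ^ 3 := Nat.mul_le_mul_left _ (Nat.le_self_pow (by norm_num) _)
  have h4 : I.T ≤ I.T * I.H ^ 3 := Nat.le_mul_of_pos_right _ (by positivity)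
  have h5 : (10 * I.H + 25) * I.F ≤ 35 * 2 ^ 24 * (I.T * I.H ^ 3) := by
    calc (10 * I.H + 25) * I.F ≤ (35 * I.H) * I.F := Nat.mul_le_mul_right _ (by omega)
      _ = _ := by unfold F; ring
  unfold runCost
  have h6 : (I.rowCost + 3) * I.N = I.rowCost * I.N + 3 * I.N := by ring
  omega

theorem mainCost_le (hG : 1 ≤ I.G) :
    I.mainCost (10 * I.H + 25) ≤ 2 ^ 40 * (I.G * (I.T * I.H ^ 7)) := by
  have hH := I.H_pos
  have hT := I.T_pos
  have h0 := I.runCost_le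
  have hp : ∀ k, 1 ≤ I.T * I.H ^ k := fun k => Nat.mul_pos hT (by positivity)
  have h1 : (I.runCost (10 * I.H + 25) + 3) * (3 * I.H + 7) + 6 ≤ 2 ^ 35 * (I.T * I.H ^ 4) := by
    have a1 : I.runCost (10 * I.H + 25) + 3 ≤ 2 ^ 31 * (I.T * I.H ^ 3) := by
      have := hp 3; omega
    have a2 : 3 * I.H + 7 ≤ 10 * I.H := by omega
    have a3 := Nat.mul_le_mul a1 a2
    have a4 : 2 ^ 31 * (I.T * I.H ^ 3) * (10 * I.H) = 10 * 2 ^ 31 * (I.T * I.H ^ 4) := by ring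
    have := hp 4
    omega
  have h2 : ((I.runCost (10 * I.H + 25) + 3) * (3 * I.H + 7) + 6) * (I.H + 1) + 6 ≤
      2 ^ 37 * (I.T * I.H ^ 5) := by
    have a3 := Nat.mul_le_mul h1 (show I.H + 1 ≤ 2 * I.H by omega)
    have a4 : 2 ^ 35 * (I.T * I.H ^ 4) * (2 * I.H) = 2 ^ 36 * (I.T * I.H ^ 5) := by ring
    have := hp 5
    omega
  have h3 : (((I.runCost (10 * I.H + 25) + 3) * (3 * I.H + 7) + 6) * (I.H + 1) + 6) * (I.H + 1) +
      6 ≤ 2 ^ 39 * (I.T * I.H ^ 6) := by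
    have a3 := Nat.mul_le_mul h2 (show I.H + 1 ≤ 2 * I.H by omega)
    have a4 : 2 ^ 37 * (I.T * I.H ^ 5) * (2 * I.H) = 2 ^ 38 * (I.T * I.H ^ 6) := by ring
    have := hp 6
    omega
  unfold mainCost
  have a3 := Nat.mul_le_mul_right (I.G * I.H) h3
  have a4 : 2 ^ 39 * (I.T * I.H ^ 6) * (I.G * I.H) = 2 ^ 39 * (I.G * (I.T * I.H ^ 7)) := by ring
  have : 1 ≤ I.G * (I.T * I.H ^ 7) := Nat.mul_pos hG (hp 7)
  omega

theorem totalCost_le (hG : 1 ≤ I.G) : I.totalCost ≤ 2 ^ 41 * (I.G * (I.T * I.H ^ 7)) := by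
  have h1 := I.mainCost_le hG
  have hH := I.H_pos
  have hnT := I.input.le_budget
  have hT := I.T_pos
  have hTH : I.T ≤ I.T * I.H ^ 7 := Nat.le_mul_of_pos_right _ (by positivity)
  have hHT : I.H ≤ I.T * I.H ^ 7 := (Nat.le_self_pow (by norm_num) _).trans
    (Nat.le_mul_of_pos_left _ hT)
  have hX : I.T * I.H ^ 7 ≤ I.G * (I.T * I.H ^ 7) := Nat.le_mul_of_pos_left _ hG
  have hR : I.R ≤ 2 * (I.G * (I.T * I.H ^ 7)) := by
    calc I.R = 2 * (I.G * (I.n * I.H)) := by unfold R; ring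
      _ ≤ 2 * (I.G * (I.T * I.H ^ 7)) := by
        gcongr
        exact Nat.le_self_pow (by norm_num) _
  unfold totalCost
  omega

theorem stepCost_le :
    stepCost I.V 32 ≤ 2 ^ 12 * (((I.A + 1) * (I.G + 1)).size + 50) * I.H := by
  have hH := I.H_pos
  have hlt := Nat.lt_size_self ((I.A + 1) * (I.G + 1))
  generalize ((I.A + 1) * (I.G + 1)).size = a at hlt ⊢
  have h1 : I.V.size ≤ a + 8 * I.H + 40 := by
    rw [Nat.size_le]
    unfold V
    rw [show a + 8 * I.H + 40 = a + (8 * I.H + 40) by ring, pow_add 2 a]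
    exact (Nat.mul_lt_mul_right (by positivity)).2 hlt
  have h2 : a ≤ a * I.H := Nat.le_mul_of_pos_right _ hH
  unfold stepCost
  have h3 : 2 ^ 12 * (a + 50) * I.H = 2 ^ 12 * (a * I.H) + 2 ^ 12 * 50 * I.H := by ring
  omega

theorem H_le_log : (I.H : ℝ) ≤ 2 * (1 + Real.log I.n) := by
  have hn : (1 : ℝ) ≤ I.n := by exact_mod_cast I.n_pos
  have h1 : (2 : ℝ) ^ I.H ≤ 2 * I.n := by exact_mod_cast I.pow_le
  have h2 := Real.log_le_log (by positivity) h1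
  rw [Real.log_pow, Real.log_mul (by norm_num) (by linarith)] at h2
  have h3 := Real.log_two_gt_d9
  have h4 := Real.log_two_lt_d9
  have h5 := Real.log_nonneg hn
  have h6 : (0 : ℝ) ≤ I.H := Nat.cast_nonneg _
  nlinarith

/-- Every input extends to a setup. -/
theorem exists_setup {A n T : ℕ} {x y : List ℕ} (h : IsInput A n T x y) (G : ℕ) :
    ∃ I : Setup, I.A = A ∧ I.n = n ∧ I.T = T ∧ I.x = x ∧ I.y = y ∧ I.G = G := by
  have hn := h.one_le
  refine ⟨⟨A, n, T, Nat.log 2 n + 1, G, x, y, h, Nat.lt_pow_succ_log_self (by norm_num) n, ?_⟩,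
    rfl, rfl, rfl, rfl, rfl, rfl⟩
  have := Nat.pow_log_le_self 2 (show n ≠ 0 by omega)
  rw [pow_succ]
  omega

theorem expectedTime_lcsProg_le (hG : 1 ≤ I.G) :
    expectedTime (lcsProg I.G) I.x I.y I.T ≤
      ENNReal.ofReal (2 ^ 61 * I.G * (((I.A + 1) * (I.G + 1)).size + 50) * I.T *
        (1 + Real.log I.n) ^ 8) := by
  obtain ⟨K, f, hf, hz⟩ := I.lcsProg_dist hG
  refine (expectedTime_le (K := K) (B := I.totalCost * stepCost I.V 32) fun c hc => ?_).trans ?_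
  · rw [hf, PMF.support_map] at hc
    obtain ⟨z, -, rfl⟩ := hc
    exact ⟨(hz z).1, (hz z).2.1⟩
  · rw [← ENNReal.ofReal_natCast]
    refine ENNReal.ofReal_le_ofReal ?_
    have h1 := Nat.mul_le_mul (I.totalCost_le hG) I.stepCost_le
    generalize ((I.A + 1) * (I.G + 1)).size = a at h1 ⊢
    -- Seven powers of `H` come from the number of steps and one from the cost of a step; `H ≤ 2 (1
    -- + log n)` then raises the constant by `2 ^ 8`.
    have h2 : ((I.totalCost * stepCost I.V 32 : ℕ) : ℝ) ≤
        2 ^ 53 * I.G * (a + 50) * I.T * (I.H : ℝ) ^ 8 := by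
      calc ((I.totalCost * stepCost I.V 32 : ℕ) : ℝ) ≤ ((2 ^ 41 * (I.G * (I.T * I.H ^ 7)) *
            (2 ^ 12 * (a + 50) * I.H) : ℕ) : ℝ) := by exact_mod_cast h1
        _ = _ := by push_cast; ring
    refine h2.trans ?_
    calc (2 ^ 53 * I.G * (a + 50) * I.T * (I.H : ℝ) ^ 8 : ℝ)
        ≤ 2 ^ 53 * I.G * (a + 50) * I.T * (2 * (1 + Real.log I.n)) ^ 8 := by
          exact mul_le_mul_of_nonneg_left (pow_le_pow_left₀ (Nat.cast_nonneg _) I.H_le_log 8)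
            (mul_nonneg (mul_nonneg (mul_nonneg (by norm_num) (Nat.cast_nonneg _))
              (add_nonneg (Nat.cast_nonneg _) (by norm_num))) (Nat.cast_nonneg _))
      _ = _ := by rw [mul_pow]; ring

theorem outputProb_le_lcs (hG : 1 ≤ I.G) :
    outputProb (lcsProg I.G) I.x I.y I.T (fun out => out ≤ lcs I.x I.y) = 1 := by
  obtain ⟨K, f, hf, hz⟩ := I.lcsProg_dist hG
  refine outputProb_eq_one (K := K) fun c hc => ?_
  rw [hf, PMF.support_map] at hc
  obtain ⟨z, -, rfl⟩ := hc
  exact ⟨(hz z).1, (hz z).2.2.1⟩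

/-- `n < 2 ^ H` gives `n ^ c ≤ n ^ G ≤ 2 ^ (G H)`: this is why the number of rounds is a multiple of
`H`. -/
theorem half_pow_le {c : ℝ} (hc : c ≤ I.G) : (1 / 2 : ℝ) ^ (I.G * I.H) ≤ (I.n : ℝ) ^ (-c) := by
  have hn : (1 : ℝ) ≤ I.n := by exact_mod_cast I.n_pos
  have h1 : (I.n : ℝ) ^ c ≤ 2 ^ (I.G * I.H) := by
    calc (I.n : ℝ) ^ c ≤ (I.n : ℝ) ^ (I.G : ℝ) := Real.rpow_le_rpow_of_exponent_le hn hc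
      _ = (I.n : ℝ) ^ I.G := Real.rpow_natCast _ _
      _ ≤ (2 ^ I.H) ^ I.G := by
          gcongr
          exact_mod_cast I.lt_pow.le
      _ = _ := by rw [← pow_mul, mul_comm]
  rw [Real.rpow_neg (by linarith), one_div, inv_pow]
  exact inv_anti₀ (Real.rpow_pos_of_pos (by linarith) _) h1

end Setup

end LCSApprox

/-! ### The approximation theorem -/

theorem mainTheorem3 :
    ∃ κ : ℝ, 0 < κ ∧
      ∀ (c : ℝ) (A : ℕ), 0 < c →
        ∃ (P : LCSApprox.Prog) (C : ℝ) (k : ℕ),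
          (∀ (n T : ℕ) (x y : List ℕ), LCSApprox.IsInput A n T x y →
            LCSApprox.expectedTime P x y T
                ≤ ENNReal.ofReal (C * (T : ℝ) * (1 + Real.log (n : ℝ)) ^ k) ∧
            LCSApprox.outputProb P x y T (fun out => out ≤ LCSApprox.lcs x y) = 1) ∧
          (∀ ε : ℝ, 0 < ε → ∃ n₀ : ℕ,
            ∀ (n T : ℕ) (x y : List ℕ), n₀ ≤ n → LCSApprox.IsInput A n T x y →
              ∀ L lam mu : ℝ,
                L = (LCSApprox.lcs x y : ℝ) →
                lam = (LCSApprox.lcsSum n T x y : ℝ) →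
                mu = (LCSApprox.maxMatching n T x y : ℝ) →
                (n : ℝ) ^ ε ≤ L ^ 2 * (T : ℝ) ^ (0.5 : ℝ) / (n : ℝ) ^ 2 →
                (n : ℝ) ^ ε ≤ L ^ 2 * (T : ℝ) ^ (1.5 : ℝ) / (lam * (n : ℝ) ^ 2) →
                (n : ℝ) ^ ε ≤ L ^ 3 * (T : ℝ) ^ (1.5 : ℝ) / (lam * mu * (n : ℝ) ^ 2) →
                ENNReal.ofReal (1 - (n : ℝ) ^ (-c)) ≤
                  LCSApprox.outputProb P x y T (fun out =>
                    κ * min (L ^ 3 / (n : ℝ) ^ 2)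
                        (min (L ^ 3 * (T : ℝ) / (lam * (n : ℝ) ^ 2))
                          (L ^ 4 * (T : ℝ) / (lam * mu * (n : ℝ) ^ 2)))
                      ≤ (out : ℝ))) := by
  refine ⟨1 / 512, by norm_num, fun c A hc => ?_⟩
  have hG : 1 ≤ ⌈c⌉₊ := Nat.one_le_ceil_iff.2 hc
  refine ⟨LCSApprox.lcsProg ⌈c⌉₊,
    2 ^ 61 * ⌈c⌉₊ * (((A + 1) * (⌈c⌉₊ + 1)).size + 50), 8, ?_, ?_⟩
  · intro n T x y h
    obtain ⟨I, rfl, rfl, rfl, rfl, rfl, hIG⟩ := LCSApprox.Setup.exists_setup h ⌈c⌉₊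
    rw [← hIG] at hG ⊢
    exact ⟨I.expectedTime_lcsProg_le hG, I.outputProb_le_lcs hG⟩
  · intro ε hε
    -- The factor `n ^ ε` is only needed to exceed the constant `1024`, so `n₀` depends on `ε`
    -- alone.
    obtain ⟨n₀, hn₀⟩ := Filter.eventually_atTop.1
      (((tendsto_rpow_atTop hε).comp tendsto_natCast_atTop_atTop).eventually_ge_atTop (1024 : ℝ))
    refine ⟨n₀, fun n T x y hn h L lam mu hL hlam hmu h₁ h₂ h₃ => ?_⟩
    have hE : (1024 : ℝ) ≤ (n : ℝ) ^ ε := hn₀ n hn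
    obtain ⟨I, rfl, rfl, rfl, rfl, rfl, hIG⟩ := LCSApprox.Setup.exists_setup h ⌈c⌉₊
    have hcG : c ≤ I.G := by rw [hIG]; exact Nat.le_ceil c
    rw [← hIG] at hG ⊢
    have hT : (0 : ℝ) < I.T := by exact_mod_cast I.T_pos
    have hs : (I.T : ℝ) ^ (0.5 : ℝ) = Real.sqrt I.T := by
      rw [Real.sqrt_eq_rpow]; norm_num
    have hs' : (I.T : ℝ) ^ (1.5 : ℝ) = I.T * Real.sqrt I.T := by
      rw [← hs, ← Real.rpow_one_add' hT.le (by norm_num)]; norm_num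
    rw [hs] at h₁
    rw [hs'] at h₂ h₃
    refine (ENNReal.ofReal_le_ofReal ?_).trans (I.output_ge hG hL hlam hmu hE h₁ h₂ h₃)
    have := I.half_pow_le hcG
    linarith
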